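/- Let $\Gamma$ be a Conway 99-graph, i.e. a strongly regular graph with parameters $(99,14,1,2)$: a graph on $99$ vertices, regular of degree $14$, in which any two adjacent vertices have exactly $1$ common neighbor and any two distinct nonadjacent vertices have exactly $2$ common neighbors. Let $G=\mathrm{Aut}(\Gamma)$ be its automorphism group. (a) If $2$ divides $|G|$, then $|G|$ divides $6$; consequently $G$ is isomorphic to $\mathbb Z_2$, $\mathbb Z_6$ or $S_3$. (b) If $7$ divides $|G|$, then $G$ is isomorphic to $\mathbb Z_7$ or to $\mathrm{Frob}(21)$, where $\mathrm{Frob}(21)$ denotes the Frobenius group of order $21$, i.e. the unique subgroup of index $2$ in the holomorph $\mathbb Z_7\rtimes\mathrm{Aut}(\mathbb Z_7)$. -/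

import Mathlib

/-- The holomorph `ℤ₇ ⋊ Aut(ℤ₇)` of the cyclic group of order `7`, where `Aut(ℤ₇)` acts
tautologically. -/
abbrev HolZ7 : Type :=
  SemidirectProduct (Multiplicative (ZMod 7)) (MulAut (Multiplicative (ZMod 7))) (MonoidHom.id _)

theorem mulAut_z7_comm (a b : MulAut (Multiplicative (ZMod 7))) : a * b = b * a := by
  have h : IsCyclic (Multiplicative (ZMod 7)) := inferInstance
  apply (IsCyclic.mulAutMulEquiv (Multiplicative (ZMod 7))).injective
  rw [map_mul, map_mul, mul_comm]

/-- The Frobenius group of order `21`: the elements `(a, σ)` of the holomorph `ℤ₇ ⋊ Aut(ℤ₇)` with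
`σ ^ 3 = 1`. By `frob21_index` and `eq_frob21_of_index` below, this is the unique subgroup of
index `2` in the holomorph. -/
def Frob21 : Subgroup HolZ7 where
  carrier := {g | g.right ^ 3 = 1}
  one_mem' := by simp
  mul_mem' := by
    intro a b ha hb
    simp only [Set.mem_ofPred_eq, SemidirectProduct.mul_right] at *
    rw [(show Commute a.right b.right from mulAut_z7_comm _ _).mul_pow, ha, hb, one_mul]
  inv_mem' := by
    intro a ha
    simp only [Set.mem_ofPred_eq, SemidirectProduct.inv_right] at *
    rw [inv_pow, ha, inv_one]

theorem mem_frob21 (g : HolZ7) : g ∈ Frob21 ↔ g.right ^ 3 = 1 := Iff.rfl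

theorem units_pow_three_aux : Nat.card {u : (ZMod 7)ˣ // u ^ 3 = 1} = 3 := by
  rw [Nat.card_eq_fintype_card]; decide

theorem holZ7_card : Nat.card HolZ7 = 42 := by
  rw [SemidirectProduct.card, IsCyclic.card_mulAut]
  simp only [Nat.card_eq_fintype_card, Fintype.card_multiplicative, ZMod.card]
  decide

theorem frob21_card : Nat.card Frob21 = 21 := by
  obtain ⟨f⟩ : Nonempty (MulAut (Multiplicative (ZMod 7)) ≃* (ZMod 7)ˣ) :=
    ⟨(MulAutMultiplicative (ZMod 7)).trans (ZMod.AddAutEquivUnits 7).toMultiplicative⟩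
  have e : Frob21 ≃ Multiplicative (ZMod 7) × {u : (ZMod 7)ˣ // u ^ 3 = 1} :=
    { toFun := fun g => (g.1.left, ⟨f g.1.right, by
            rw [← map_pow, (mem_frob21 _).1 g.2, map_one]⟩)
      invFun := fun p => ⟨⟨p.1, f.symm p.2.1⟩, by
            rw [mem_frob21, ← map_pow, p.2.2, map_one]⟩
      left_inv := fun g => Subtype.ext (SemidirectProduct.ext rfl (f.symm_apply_apply _))
      right_inv := fun p => Prod.ext rfl (Subtype.ext (f.apply_symm_apply _)) }
  rw [Nat.card_congr e, Nat.card_prod, units_pow_three_aux]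
  simp

theorem frob21_index : Frob21.index = 2 := by
  have h := Frob21.card_mul_index
  rw [frob21_card, holZ7_card] at h
  omega

theorem eq_frob21_of_index (H : Subgroup HolZ7) (hH : H.index = 2) : H = Frob21 := by
  have hfin : Finite HolZ7 := Nat.finite_of_card_ne_zero (by rw [holZ7_card]; norm_num)
  have hc : Nat.card H = 21 := by
    have h := H.card_mul_index
    rw [hH, holZ7_card] at h
    omega
  have hsq : Frob21 ≤ H := by
    intro g hg
    have h1 : g ^ 21 = 1 := by
      have : (⟨g, hg⟩ : Frob21) ^ Nat.card Frob21 = 1 := pow_card_eq_one'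
      rw [frob21_card] at this
      exact congrArg Subtype.val this
    have h2 : g = (g ^ 11) ^ 2 := by
      rw [← pow_mul, show 11 * 2 = 21 + 1 from rfl, pow_succ, h1, one_mul]
    rw [h2]
    exact Subgroup.sq_mem_of_index_two hH _
  exact (Subgroup.eq_of_le_of_card_ge hsq (by rw [hc, frob21_card])).symm

/-! Let A be the adjacency matrix. From A² = 12I − A + 2J its eigenvalues are 14, 3 and −4. If an
automorphism g fixes n vertices and sends a vertices to neighbours, its character on an eigenspace
is an integer, which gives a + 4n ≡ 4 mod 7 (`trace_mod_seven`); rationality of the character gives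
a further congruence mod 17. Local counts of fixed neighbours then show that a nontrivial g of odd
order fixes nothing, one vertex or a triangle (`odd_cases`), so the odd primes dividing |G| are
among 3, 7 and 11. An involution fixes a single vertex x and sends to neighbours exactly the
neighbours of x (`involution_structure`). Such a reflection is determined by x, commutes with the
stabilizer of x, and is an odd permutation.

Suppose |G| is even. The even permutations form a subgroup of odd order and index 2, and a Frattini
argument makes some reflection normalize a Sylow p-subgroup for each odd p. It therefore centralizes
or inverts an element of order p. For p = 11, centralizing contradicts freeness and inverting
contradicts the trace congruence. For p = 7, inverting is impossible, and centralizing yields a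
cyclic group of order 14, whose 6 × 6 orbit matrix is excluded by parity and trace
(`no_order_fourteen`, `no_six_matrix`). If 9 divides |G|, a reflection normalizes an abelian group R
of order 9. Burnside counts on vertices and triangles show that R acts freely and is inverted, and
the 5 × 5 orbit matrix of the group of order 18 so obtained does not exist
(`not_normalizes_order_nine`, `no_five_matrix`). Only orders 2 and 6 survive.

Suppose 7 divides |G|. Then |G| is odd and divides 3³·7·11. Sylow counting excludes 11 and makes the
Sylow 7-subgroup normal, so all of G fixes its unique fixed vertex, and a vertex stabilizer has
order prime to 9. An element of order 3 cannot commute with one of order 7, so order 21 forces the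
Frobenius group. -/

set_option linter.unusedSectionVars false

section

open scoped Classical

/-! ### Automorphisms acting on vertices. -/

section Basics

variable {V : Type*} [Fintype V] {Γ : SimpleGraph V}

/-- A strongly regular graph with parameters `(99, 14, 1, 2)`, in terms of counting filters. -/
structure IsConway99 (Γ : SimpleGraph V) : Prop where
  card : Fintype.card V = 99
  deg : ∀ x, (Finset.univ.filter fun v => Γ.Adj x v).card = 14
  adj : ∀ x y, Γ.Adj x y → (Finset.univ.filter fun v => Γ.Adj x v ∧ Γ.Adj y v).card = 1
  nonadj : ∀ x y, x ≠ y → ¬ Γ.Adj x y →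
    (Finset.univ.filter fun v => Γ.Adj x v ∧ Γ.Adj y v).card = 2

theorem SimpleGraph.IsSRGWith.isConway99 [DecidableRel Γ.Adj] (h : Γ.IsSRGWith 99 14 1 2) :
    IsConway99 Γ where
  card := h.card
  deg x := by
    rw [← h.regular x, ← SimpleGraph.card_neighborFinset_eq_degree]
    congr 1; ext v; simp
  adj x y hxy := by
    rw [← h.of_adj x y hxy, Fintype.card_subtype]
    congr 1; ext v; simp [SimpleGraph.mem_commonNeighbors]
  nonadj x y hne hxy := by
    rw [← h.of_not_adj hne hxy, Fintype.card_subtype]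
    congr 1; ext v; simp [SimpleGraph.mem_commonNeighbors]

instance : Finite (Γ ≃g Γ) := DFunLike.finite _

noncomputable instance : Fintype (Γ ≃g Γ) := Fintype.ofFinite _

/-- The vertices fixed by an automorphism. -/
noncomputable def fixedSet (g : Γ ≃g Γ) : Finset V := Finset.univ.filter fun v => g v = v

/-- The vertices adjacent to their image under an automorphism. -/
noncomputable def movedToNbr (g : Γ ≃g Γ) : Finset V := Finset.univ.filter fun v => Γ.Adj v (g v)

@[simp] theorem mem_fixedSet {g : Γ ≃g Γ} {v : V} : v ∈ fixedSet g ↔ g v = v := by simp [fixedSet]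

@[simp] theorem mem_movedToNbr {g : Γ ≃g Γ} {v : V} : v ∈ movedToNbr g ↔ Γ.Adj v (g v) := by
  simp [movedToNbr]

theorem aut_mul_apply (g h : Γ ≃g Γ) (v : V) : (g * h) v = g (h v) := rfl

theorem aut_one_apply (v : V) : (1 : Γ ≃g Γ) v = v := rfl

theorem aut_inv_apply_self (g : Γ ≃g Γ) (v : V) : g⁻¹ (g v) = v := by
  rw [← aut_mul_apply, inv_mul_cancel, aut_one_apply]

theorem aut_apply_inv_self (g : Γ ≃g Γ) (v : V) : g (g⁻¹ v) = v := by
  rw [← aut_mul_apply, mul_inv_cancel, aut_one_apply]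

theorem aut_adj (g : Γ ≃g Γ) {v w : V} : Γ.Adj (g v) (g w) ↔ Γ.Adj v w := g.map_rel_iff

theorem aut_pow_fixed {g : Γ ≃g Γ} {v : V} (h : g v = v) (n : ℕ) : (g ^ n) v = v := by
  induction n with
  | zero => rfl
  | succ n ih => rw [pow_succ, aut_mul_apply, h, ih]

theorem aut_inv_eq_iff {g : Γ ≃g Γ} {v w : V} : g⁻¹ v = w ↔ v = g w := by
  constructor
  · rintro rfl; rw [aut_apply_inv_self]
  · rintro rfl; rw [aut_inv_apply_self]

theorem aut_adj_inv {g : Γ ≃g Γ} {v w : V} : Γ.Adj v (g w) ↔ Γ.Adj (g⁻¹ v) w := by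
  rw [← aut_adj g (v := g⁻¹ v), aut_apply_inv_self]

/-- An automorphism of odd order which fixes a set of two points fixes both. -/
theorem aut_fixed_of_sq_fixed {g : Γ ≃g Γ} {m : ℕ} (hm : Odd m) (hg : g ^ m = 1) {v : V}
    (h : g (g v) = v) : g v = v := by
  obtain ⟨k, rfl⟩ := hm
  have h2 : (g ^ 2) v = v := by rw [pow_two, aut_mul_apply, h]
  have h3 : (g ^ (2 * k + 1)) v = g v := by
    rw [pow_succ', aut_mul_apply, pow_mul, aut_pow_fixed h2]
  rw [← h3, hg, aut_one_apply]

end Basics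

/-! ### Trace congruences modulo 7 and 17. -/

section Traces

variable {V : Type*} [Fintype V] {Γ : SimpleGraph V}

open Matrix

/-- The invariance hypothesis says that M commutes with the permutation, so the permutation factors
out of each power. -/
theorem submatrix_perm_pow {R : Type*} [CommRing R] (M : Matrix V V R) (g : V ≃ V)
    (hM : ∀ i j, M (g i) (g j) = M i j) (n : ℕ) :
    (M.submatrix g id) ^ n = (M ^ n).submatrix ((g : Equiv.Perm V) ^ n : Equiv.Perm V) id := by
  have hMn : ∀ n i j, (M ^ n) (g i) (g j) = (M ^ n) i j := by
    intro n
    induction n with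
    | zero => intro i j; simp [Matrix.one_apply]
    | succ n ih =>
      intro i j
      rw [pow_succ, Matrix.mul_apply, Matrix.mul_apply, ← Equiv.sum_comp g]
      simp only [hM, ih]
  induction n with
  | zero => ext i j; rfl
  | succ n ih =>
    rw [pow_succ, ih]
    ext i j
    rw [Matrix.mul_apply, pow_succ M, Matrix.submatrix_apply, Matrix.mul_apply,
      ← Equiv.sum_comp g fun k => (M ^ n) (((g : Equiv.Perm V) ^ (n + 1) : Equiv.Perm V) i) k * M k (id j)]
    refine Finset.sum_congr rfl fun k _ => ?_
    simp only [Matrix.submatrix_apply, id, pow_succ', Equiv.Perm.mul_apply, hMn]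

/-- The adjacency matrix, with classical decidability. -/
noncomputable def adjMat (Γ : SimpleGraph V) (R : Type*) [CommRing R] : Matrix V V R :=
  Matrix.of fun i j => if Γ.Adj i j then 1 else 0

/-- The all-ones matrix. -/
def onesMat (V R : Type*) [CommRing R] : Matrix V V R := Matrix.of fun _ _ => 1

variable {R : Type*} [CommRing R]

theorem IsConway99.adjMat_sq (hΓ : IsConway99 Γ) :
    adjMat Γ R * adjMat Γ R = (12 : R) • 1 - adjMat Γ R + (2 : R) • onesMat V R := by
  ext i j
  have h1 : (adjMat Γ R * adjMat Γ R) i j =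
      ((Finset.univ.filter fun v => Γ.Adj i v ∧ Γ.Adj j v).card : R) := by
    rw [Matrix.mul_apply, Finset.card_filter]
    push_cast
    refine Finset.sum_congr rfl fun k _ => ?_
    by_cases h1 : Γ.Adj i k <;> by_cases h2 : Γ.Adj k j <;>
      simp [adjMat, h1, h2, Γ.adj_comm j k]
  rw [h1]
  by_cases hij : i = j
  · subst hij
    simp only [and_self, hΓ.deg]
    simp [adjMat, onesMat]; norm_num
  · by_cases ha : Γ.Adj i j
    · rw [hΓ.adj i j ha]; simp [adjMat, onesMat, hij, ha]; norm_num
    · rw [hΓ.nonadj i j hij ha]; simp [adjMat, onesMat, hij, ha]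

theorem IsConway99.adjMat_mul_ones (hΓ : IsConway99 Γ) :
    adjMat Γ R * onesMat V R = (14 : R) • onesMat V R := by
  ext i j
  rw [Matrix.mul_apply]
  simp only [adjMat, onesMat, Matrix.of_apply, mul_one, Matrix.smul_apply]
  rw [Finset.sum_boole, hΓ.deg]; simp

theorem IsConway99.ones_mul_adjMat (hΓ : IsConway99 Γ) :
    onesMat V R * adjMat Γ R = (14 : R) • onesMat V R := by
  ext i j
  rw [Matrix.mul_apply]
  simp only [adjMat, onesMat, Matrix.of_apply, one_mul, Matrix.smul_apply]
  simp only [fun x => Γ.adj_comm x j]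
  rw [Finset.sum_boole, hΓ.deg]; simp

theorem IsConway99.ones_mul_ones (hΓ : IsConway99 Γ) :
    onesMat V R * onesMat V R = (99 : R) • onesMat V R := by
  ext i j
  rw [Matrix.mul_apply]
  simp [onesMat, hΓ.card]

/-- After the rows are permuted by g, the diagonals of A, I and J count the vertices sent to
neighbours, the fixed vertices, and all 99 vertices. -/
theorem trace_submatrix_comb (hΓ : IsConway99 Γ) (g : Γ ≃g Γ) (a b c : R) :
    ((a • adjMat Γ R + b • 1 + c • onesMat V R).submatrix g.toEquiv id).trace =
      a * ((movedToNbr g).card : R) + b * ((fixedSet g).card : R) + c * 99 := by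
  have h1 : ((movedToNbr g).card : R) = ∑ i, if Γ.Adj (g i) i then 1 else 0 := by
    rw [movedToNbr, Finset.sum_boole]; simp only [Γ.adj_comm]
  have h2 : ((fixedSet g).card : R) = ∑ i, if g i = i then 1 else 0 := by
    rw [fixedSet, Finset.sum_boole]
  have h3 : (99 : R) = ∑ i : V, (1 : R) := by simp [hΓ.card]
  rw [h1, h2, h3, Finset.mul_sum, Finset.mul_sum, Finset.mul_sum, ← Finset.sum_add_distrib,
    ← Finset.sum_add_distrib, Matrix.trace]
  refine Finset.sum_congr rfl fun i _ => ?_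
  simp [adjMat, onesMat, Matrix.one_apply]

theorem comb_invariant (g : Γ ≃g Γ) (a b c : R) (i j : V) :
    (a • adjMat Γ R + b • 1 + c • onesMat V R) (g.toEquiv i) (g.toEquiv j) =
      (a • adjMat Γ R + b • 1 + c • onesMat V R) i j := by
  have h : g.toEquiv i = g.toEquiv j ↔ i = j := g.toEquiv.injective.eq_iff
  have h' : Γ.Adj (g.toEquiv i) (g.toEquiv j) ↔ Γ.Adj i j := aut_adj g
  simp only [adjMat, onesMat, Matrix.add_apply, Matrix.smul_apply, Matrix.of_apply,
    Matrix.one_apply, h, h']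

/-- The span of A, I and J is an algebra; these structure constants reduce nilpotency and
idempotency to arithmetic in the coefficients. -/
theorem comb_mul_self (hΓ : IsConway99 Γ) (a b c : R) :
    (a • adjMat Γ R + b • 1 + c • onesMat V R) * (a • adjMat Γ R + b • 1 + c • onesMat V R) =
      (2 * a * b - a ^ 2) • adjMat Γ R + (12 * a ^ 2 + b ^ 2) • 1 +
        (2 * a ^ 2 + 28 * a * c + 2 * b * c + 99 * c ^ 2) • onesMat V R := by
  simp only [add_mul, mul_add, smul_mul_assoc, mul_smul_comm, one_mul, mul_one, hΓ.adjMat_sq,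
    hΓ.adjMat_mul_ones, hΓ.ones_mul_adjMat, hΓ.ones_mul_ones]
  ext i j
  simp only [Matrix.add_apply, Matrix.smul_apply, Matrix.sub_apply, smul_eq_mul]
  ring

theorem aut_toEquiv_pow (g : Γ ≃g Γ) (n : ℕ) :
    ((g.toEquiv : Equiv.Perm V) ^ n : Equiv.Perm V) = (g ^ n).toEquiv := by
  induction n with
  | zero => rfl
  | succ n ih => rw [pow_succ, pow_succ, ih]; rfl

/-- The character of the automorphism group on an eigenspace is integral. -/
theorem IsConway99.trace_mod_seven (hΓ : IsConway99 Γ) (g : Γ ≃g Γ) :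
    ((movedToNbr g).card + 4 * (fixedSet g).card) % 7 = 4 := by
  -- Modulo 7 the eigenvalues 3 and −4 coincide, so A + 4I squares to zero off the all-ones vector;
  -- the term 3J kills that vector too, since 14 + 4 + 3·99 is divisible by 7.
  set M : Matrix V V (ZMod 7) :=
    (1 : ZMod 7) • adjMat Γ (ZMod 7) + (4 : ZMod 7) • 1 + (3 : ZMod 7) • onesMat V (ZMod 7) with hM
  have hMM : M * M = 0 := by
    rw [hM, comb_mul_self hΓ]
    have e1 : (2 * 1 * 4 - 1 ^ 2 : ZMod 7) = 0 := by decide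
    have e2 : (12 * 1 ^ 2 + 4 ^ 2 : ZMod 7) = 0 := by decide
    have e3 : (2 * 1 ^ 2 + 28 * 1 * 3 + 2 * 4 * 3 + 99 * 3 ^ 2 : ZMod 7) = 0 := by decide
    rw [e1, e2, e3]; simp
  have hnil : IsNilpotent (M.submatrix g.toEquiv id) := by
    refine ⟨2, ?_⟩
    rw [submatrix_perm_pow M g.toEquiv (comb_invariant g 1 4 3), pow_two M, hMM]
    rfl
  have : Fact (Nat.Prime 7) := ⟨by norm_num⟩
  have htr := (Matrix.isNilpotent_trace_of_isNilpotent hnil).eq_zero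
  rw [hM, trace_submatrix_comb hΓ] at htr
  have h0 : (((movedToNbr g).card + 4 * (fixedSet g).card + 3 * 99 : ℕ) : ZMod 7) = 0 := by
    push_cast
    rw [← htr]; ring
  rw [ZMod.natCast_eq_zero_iff] at h0
  omega

/-- The character of the automorphism group on an eigenspace is rational. -/
theorem IsConway99.trace_pow_seventeen (hΓ : IsConway99 Γ) (g : Γ ≃g Γ) :
    (5 * (movedToNbr (g ^ 17)).card + 3 * (fixedSet (g ^ 17)).card) ≡
      (5 * (movedToNbr g).card + 3 * (fixedSet g).card) [MOD 17] := by
  have e1 : (2 * 5 * 3 - 5 ^ 2 : ZMod 17) = 5 := by decide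
  have e2 : (12 * 5 ^ 2 + 3 ^ 2 : ZMod 17) = 3 := by decide
  have e3 : (2 * 5 ^ 2 + 28 * 5 * 13 + 2 * 3 * 13 + 99 * 13 ^ 2 : ZMod 17) = 13 := by decide
  have : Fact (Nat.Prime 17) := ⟨by norm_num⟩
  -- This is the reduction of the projection onto the eigenspace of 3: (A + 4I)/7 with 1/7 = 5,
  -- corrected by 13J so as to annihilate the all-ones vector.
  set M : Matrix V V (ZMod 17) :=
    (5 : ZMod 17) • adjMat Γ (ZMod 17) + (3 : ZMod 17) • 1 + (13 : ZMod 17) • onesMat V (ZMod 17)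
    with hM
  have hMM : IsIdempotentElem M := by
    rw [IsIdempotentElem, hM, comb_mul_self hΓ]
    rw [e1, e2, e3]
  -- Over the field with 17 elements the trace of X ^ 17 is (tr X) ^ 17 = tr X, and the 17th power
  -- of gM is g ^ 17 M.
  have h := ZMod.trace_pow_card (p := 17) (M.submatrix g.toEquiv id)
  rw [submatrix_perm_pow M g.toEquiv (comb_invariant g 5 3 13), hMM.pow_eq (by norm_num),
    aut_toEquiv_pow, hM, trace_submatrix_comb hΓ, trace_submatrix_comb hΓ, ZMod.pow_card] at h
  have h' := add_right_cancel h
  rw [← ZMod.natCast_eq_natCast_iff]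
  push_cast
  exact h'

end Traces

end

section

open scoped Classical

/-! ### Fixed-point congruences and Burnside's lemma. -/

section Counting

/-- A map of prime power order on a finite set has as many fixed points as the set has elements,
modulo the prime. -/
theorem Finset.card_modEq_card_filter_fixed {X : Type*} (p n : ℕ) [Fact p.Prime] (f : X → X)
    (B : Finset X) (hB : ∀ v ∈ B, f v ∈ B) (hf : ∀ v ∈ B, f^[p ^ n] v = v) :
    B.card ≡ (B.filter fun v => f v = v).card [MOD p] := by
  let F : Function.End B := fun v => ⟨f v, hB v v.2⟩
  have hF : ∀ (k : ℕ) (v : B), ((F ^ k) v : X) = f^[k] v := by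
    intro k
    induction k with
    | zero => intro v; rfl
    | succ k ih =>
      intro v
      rw [pow_succ', Function.iterate_succ_apply', ← ih]
      rfl
  have h1 : F ^ p ^ n = 1 := by
    funext v
    apply Subtype.ext
    rw [hF, hf v v.2]; rfl
  have h := Equiv.Perm.card_fixedPoints_modEq h1
  rw [Fintype.card_coe] at h
  refine h.trans (congrArg (· % p) ?_)
  rw [Fintype.card_subtype]
  refine Finset.card_bij (fun v _ => (v : X)) ?_ ?_ ?_
  · intro v hv
    simp only [Finset.mem_filter, Finset.mem_univ, true_and] at hv ⊢
    exact ⟨v.2, congrArg Subtype.val hv⟩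
  · intro v _ w _ h; exact Subtype.ext h
  · intro v hv
    rw [Finset.mem_filter] at hv
    refine ⟨⟨v, hv.1⟩, ?_, rfl⟩
    simp only [Finset.mem_filter, Finset.mem_univ, true_and]
    exact Subtype.ext hv.2

/-- A version of Burnside's lemma on an invariant finite set. -/
theorem Finset.card_group_dvd_sum_card_fixed {H X : Type*} [Group H] [Fintype H] [MulAction H X]
    (B : Finset X) (hB : ∀ h : H, ∀ v ∈ B, h • v ∈ B) :
    Fintype.card H ∣ ∑ h : H, (B.filter fun v => h • v = v).card := by
  let S : SubMulAction H X := ⟨{v | v ∈ B}, fun h {v} hv => hB h v hv⟩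
  have : Fintype S := Fintype.subtype B (fun v => Iff.rfl)
  have h := MulAction.sum_card_fixedBy_eq_card_orbits_mul_card_group H S
  have h2 : ∀ a : H, Fintype.card (MulAction.fixedBy S a) =
      (B.filter fun v => a • v = v).card := by
    intro a
    rw [← Fintype.card_coe]
    refine Fintype.card_congr ⟨fun v => ⟨v.1.1, ?_⟩, fun v => ⟨⟨v.1, ?_⟩, ?_⟩, ?_, ?_⟩
    · exact Finset.mem_filter.2 ⟨v.1.2, congrArg Subtype.val v.2⟩
    · exact (Finset.mem_filter.1 v.2).1
    · exact Subtype.ext (Finset.mem_filter.1 v.2).2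
    · intro v; rfl
    · intro v; rfl
  simp only [h2] at h
  rw [h]
  exact dvd_mul_left _ _

end Counting

/-! ### Local structure of the fixed vertices. -/

section FixedPoints

variable {V : Type*} [Fintype V] {Γ : SimpleGraph V}

/-- The neighbours of a vertex. -/
noncomputable def nbrs (Γ : SimpleGraph V) (x : V) : Finset V :=
  Finset.univ.filter fun v => Γ.Adj x v

@[simp] theorem mem_nbrs {x v : V} : v ∈ nbrs Γ x ↔ Γ.Adj x v := by simp [nbrs]

/-- The neighbours of a vertex which are fixed by an automorphism. -/
noncomputable def fixNbrs (g : Γ ≃g Γ) (x : V) : Finset V := (nbrs Γ x).filter fun v => g v = v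

@[simp] theorem mem_fixNbrs {g : Γ ≃g Γ} {x v : V} : v ∈ fixNbrs g x ↔ Γ.Adj x v ∧ g v = v := by
  simp [fixNbrs]

theorem aut_pow_iterate (g : Γ ≃g Γ) (n : ℕ) (v : V) : g^[n] v = (g ^ n) v := by
  induction n with
  | zero => rfl
  | succ n ih => rw [Function.iterate_succ_apply', ih, pow_succ', aut_mul_apply]

theorem aut_card_modEq {p n : ℕ} [Fact p.Prime] {g : Γ ≃g Γ} (hg : g ^ p ^ n = 1) (B : Finset V)
    (hB : ∀ v ∈ B, g v ∈ B) : B.card ≡ (B.filter fun v => g v = v).card [MOD p] :=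
  Finset.card_modEq_card_filter_fixed p n g B hB fun v _ => by
    rw [aut_pow_iterate, hg, aut_one_apply]

namespace IsConway99

theorem card_nbrs (hΓ : IsConway99 Γ) (x : V) : (nbrs Γ x).card = 14 := hΓ.deg x

theorem exists_common (hΓ : IsConway99 Γ) {x y : V} (h : Γ.Adj x y) :
    ∃ u, Γ.Adj x u ∧ Γ.Adj y u := by
  obtain ⟨u, hu⟩ := Finset.card_eq_one.1 (hΓ.adj x y h)
  exact ⟨u, by simpa using (Finset.ext_iff.1 hu u).2 (by simp)⟩

theorem common_unique (hΓ : IsConway99 Γ) {x y u w : V} (h : Γ.Adj x y) (h1 : Γ.Adj x u)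
    (h2 : Γ.Adj y u) (h3 : Γ.Adj x w) (h4 : Γ.Adj y w) : u = w :=
  Finset.card_le_one.1 (hΓ.adj x y h).le u (by simp [h1, h2]) w (by simp [h3, h4])

theorem exists_common_ne (hΓ : IsConway99 Γ) {x y u : V} (hxy : x ≠ y) (h : ¬ Γ.Adj x y) :
    ∃ w, w ≠ u ∧ Γ.Adj x w ∧ Γ.Adj y w := by
  obtain ⟨w, hw, hne⟩ := Finset.exists_mem_ne
    (by rw [hΓ.nonadj x y hxy h]; norm_num :
      1 < (Finset.univ.filter fun v => Γ.Adj x v ∧ Γ.Adj y v).card) u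
  exact ⟨w, hne, by simpa using hw⟩

theorem common_cases (hΓ : IsConway99 Γ) {x y u w v : V} (hxy : x ≠ y) (h : ¬ Γ.Adj x y)
    (huw : u ≠ w) (h1 : Γ.Adj x u) (h2 : Γ.Adj y u) (h3 : Γ.Adj x w) (h4 : Γ.Adj y w)
    (h5 : Γ.Adj x v) (h6 : Γ.Adj y v) : v = u ∨ v = w := by
  have hsub : ({u, w} : Finset V) ⊆ Finset.univ.filter fun v => Γ.Adj x v ∧ Γ.Adj y v := by
    intro a ha
    simp only [Finset.mem_insert, Finset.mem_singleton] at ha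
    rcases ha with rfl | rfl <;> simp [*]
  have heq := Finset.eq_of_subset_of_card_le hsub
    (by rw [hΓ.nonadj x y hxy h, Finset.card_pair huw])
  have : v ∈ ({u, w} : Finset V) := by rw [heq]; simp [h5, h6]
  simpa using this

/-- The third vertex of a triangle with two fixed vertices is fixed. -/
theorem fixed_of_triangle (hΓ : IsConway99 Γ) {g : Γ ≃g Γ} {x y u : V} (hx : g x = x)
    (hy : g y = y) (h : Γ.Adj x y) (h1 : Γ.Adj x u) (h2 : Γ.Adj y u) : g u = u := by
  refine hΓ.common_unique h ?_ ?_ h1 h2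
  · rw [← hx]; exact (aut_adj g).2 h1
  · rw [← hy]; exact (aut_adj g).2 h2

/-- If one of the two common neighbours of two nonadjacent fixed vertices is fixed, so is the
other. -/
theorem fixed_of_quad (hΓ : IsConway99 Γ) {g : Γ ≃g Γ} {x y u w : V} (hx : g x = x)
    (hy : g y = y) (hxy : x ≠ y) (h : ¬ Γ.Adj x y) (huw : u ≠ w) (h1 : Γ.Adj x u)
    (h2 : Γ.Adj y u) (h3 : Γ.Adj x w) (h4 : Γ.Adj y w) (hu : g u = u) : g w = w := by
  have h5 : Γ.Adj x (g w) := by rw [← hx]; exact (aut_adj g).2 h3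
  have h6 : Γ.Adj y (g w) := by rw [← hy]; exact (aut_adj g).2 h4
  rcases hΓ.common_cases hxy h huw h1 h2 h3 h4 h5 h6 with h7 | h7
  · exact absurd (g.injective (h7.trans hu.symm)) huw.symm
  · exact h7

/-- Let b complete the triangle on x and a. A fixed neighbour v of a other than x and b is
nonadjacent to x, and the common neighbour c of x and v other than a is again fixed. The assignment
v ↦ c is injective, because v is the common neighbour of a and c other than x. -/
theorem card_fixNbrs_le (hΓ : IsConway99 Γ) {g : Γ ≃g Γ} {x a : V} (hx : g x = x)
    (ha : g a = a) (h : Γ.Adj x a) : (fixNbrs g a).card ≤ (fixNbrs g x).card := by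
  obtain ⟨b, hxb, hab⟩ := hΓ.exists_common h
  have hb : g b = b := hΓ.fixed_of_triangle hx ha h hxb hab
  have e1 : (fixNbrs g a).card = ((fixNbrs g a) \ {x, b}).card + 2 := by
    rw [← Finset.card_pair hxb.ne, Finset.card_sdiff_add_card_eq_card]
    intro c hc
    simp only [Finset.mem_insert, Finset.mem_singleton] at hc
    rcases hc with rfl | rfl <;> simp [*, h.symm]
  have e2 : (fixNbrs g x).card = ((fixNbrs g x) \ {a, b}).card + 2 := by
    rw [← Finset.card_pair hab.ne, Finset.card_sdiff_add_card_eq_card]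
    intro c hc
    simp only [Finset.mem_insert, Finset.mem_singleton] at hc
    rcases hc with rfl | rfl <;> simp [*]
  rw [e1, e2, Nat.add_le_add_iff_right]
  have key : ∀ v, Γ.Adj a v → v ≠ b → ¬ Γ.Adj x v := fun v h1 h2 h3 =>
    h2 (hΓ.common_unique h h3 h1 hxb hab)
  have key' : ∀ v, Γ.Adj x v → v ≠ b → ¬ Γ.Adj a v := fun v h1 h2 h3 =>
    h2 (hΓ.common_unique h h1 h3 hxb hab)
  refine Finset.card_le_card_of_forall_subsingleton (fun v c => Γ.Adj v c) ?_ ?_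
  · intro v hv
    simp only [Finset.mem_sdiff, mem_fixNbrs, Finset.mem_insert, Finset.mem_singleton,
      not_or] at hv
    obtain ⟨⟨hav, hgv⟩, hvx, hvb⟩ := hv
    have hxv := key v hav hvb
    obtain ⟨c, hca, hxc, hvc⟩ := hΓ.exists_common_ne (u := a) (Ne.symm hvx) hxv
    refine ⟨c, ?_, hvc⟩
    have hgc : g c = c :=
      hΓ.fixed_of_quad hx hgv (Ne.symm hvx) hxv (Ne.symm hca) h hav.symm hxc hvc ha
    simp only [Finset.mem_sdiff, mem_fixNbrs, Finset.mem_insert, Finset.mem_singleton, not_or]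
    refine ⟨⟨hxc, hgc⟩, hca, ?_⟩
    rintro rfl
    exact hvx (hΓ.common_unique hab hav hvc.symm h.symm hxb.symm)
  · intro c hc v hv w hw
    simp only [Finset.mem_sdiff, mem_fixNbrs, Finset.mem_insert, Finset.mem_singleton,
      not_or, Set.mem_ofPred_eq] at hc hv hw
    have hac := key' c hc.1.1 hc.2.2
    rcases hΓ.common_cases (Ne.symm hc.2.1) hac hv.1.2.1 hv.1.1.1 hv.2.symm h.symm hc.1.1.symm
      hw.1.1.1 hw.2.symm with h7 | h7
    · exact h7.symm
    · exact absurd h7 hw.1.2.1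

theorem card_fixNbrs_eq (hΓ : IsConway99 Γ) {g : Γ ≃g Γ} {x a : V} (hx : g x = x)
    (ha : g a = a) (h : Γ.Adj x a) : (fixNbrs g a).card = (fixNbrs g x).card :=
  le_antisymm (hΓ.card_fixNbrs_le hx ha h) (hΓ.card_fixNbrs_le ha hx h.symm)

/-- Count pairs of a neighbour w of x and a fixed vertex v adjacent to w: there are 14 for v = x, 1
for v adjacent to x, and 2 otherwise. -/
theorem sum_fixed_adj (hΓ : IsConway99 Γ) {g : Γ ≃g Γ} {x : V} (hx : g x = x) :
    (∑ w ∈ nbrs Γ x, (fixNbrs g w).card) + (fixNbrs g x).card = 12 + 2 * (fixedSet g).card := by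
  have h1 : ∑ w ∈ nbrs Γ x, (fixNbrs g w).card =
      ∑ v ∈ fixedSet g, (Finset.univ.filter fun w => Γ.Adj x w ∧ Γ.Adj v w).card := by
    have := Finset.sum_card_bipartiteAbove_eq_sum_card_bipartiteBelow
      (s := nbrs Γ x) (t := fixedSet g) (fun w v => Γ.Adj w v)
    convert this using 2 with w _ v _
    · congr 1; ext v; simp [Finset.bipartiteAbove, and_comm]
    · congr 1; ext w; simp [Finset.bipartiteBelow, Γ.adj_comm v w]
  have h2 : ∀ v ∈ fixedSet g,
      (Finset.univ.filter fun w => Γ.Adj x w ∧ Γ.Adj v w).card + (if Γ.Adj x v then 1 else 0) =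
        2 + if v = x then 12 else 0 := by
    intro v _
    by_cases hv : v = x
    · subst hv; simp only [and_self, hΓ.deg]; simp
    · by_cases ha : Γ.Adj x v
      · rw [hΓ.adj x v ha]; simp [ha, hv]
      · rw [hΓ.nonadj x v (Ne.symm hv) ha]; simp [ha, hv]
  have h3 := Finset.sum_congr rfl h2
  rw [Finset.sum_add_distrib, Finset.sum_add_distrib, ← h1] at h3
  rw [Finset.sum_ite_eq' , if_pos (by simpa using hx), Finset.sum_const, smul_eq_mul,
    ← Finset.card_filter] at h3
  have h4 : (fixedSet g).filter (fun v => Γ.Adj x v) = fixNbrs g x := by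
    ext v; simp [and_comm]
  rw [h4] at h3
  omega

/-- All fixed neighbours of x have the same number of fixed neighbours as x, so together they
contribute a square to the double count. -/
theorem sum_fixNbrs_split (hΓ : IsConway99 Γ) {g : Γ ≃g Γ} {x : V} (hx : g x = x) :
    (fixNbrs g x).card ^ 2 + (∑ w ∈ (nbrs Γ x).filter (fun v => g v ≠ v), (fixNbrs g w).card)
      + (fixNbrs g x).card = 12 + 2 * (fixedSet g).card := by
  rw [← hΓ.sum_fixed_adj hx, ← Finset.sum_filter_add_sum_filter_not (nbrs Γ x) (fun v => g v = v)]
  congr 2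
  rw [pow_two, ← smul_eq_mul, ← Finset.sum_const]
  refine Finset.sum_congr rfl fun w hw => ?_
  rw [Finset.mem_filter, mem_nbrs] at hw
  exact (hΓ.card_fixNbrs_eq hx hw.2 hw.1).symm

theorem card_nonfixed_nbrs (hΓ : IsConway99 Γ) (g : Γ ≃g Γ) (x : V) :
    ((nbrs Γ x).filter (fun v => g v ≠ v)).card + (fixNbrs g x).card = 14 := by
  rw [← hΓ.card_nbrs x, add_comm]
  exact Finset.card_filter_add_card_filter_not (s := nbrs Γ x) (fun v => g v = v)

end IsConway99

end FixedPoints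

end

section

open scoped Classical

/-! ### Automorphisms of odd order. -/

section OddOrder

variable {V : Type*} [Fintype V] {Γ : SimpleGraph V}

theorem aut_eq_one_of_forall {g : Γ ≃g Γ} (h : ∀ v, g v = v) : g = 1 := RelIso.ext h

namespace IsConway99

theorem card_fixedSet_lt (hΓ : IsConway99 Γ) {g : Γ ≃g Γ} (hg : g ≠ 1) :
    (fixedSet g).card < 99 := by
  rw [← hΓ.card]
  by_contra h
  apply hg
  have h2 : fixedSet g = Finset.univ :=
    Finset.eq_univ_of_card _ (le_antisymm (Finset.card_le_univ _) (not_lt.1 h))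
  refine aut_eq_one_of_forall fun v => ?_
  rw [← mem_fixedSet, h2]
  exact Finset.mem_univ v

section

variable (hΓ : IsConway99 Γ) {g : Γ ≃g Γ} {m : ℕ} (hm : Odd m) (hg : g ^ m = 1)

include hΓ hm hg

/-- Two adjacent fixed neighbours would force the third vertex w of their triangle to be fixed. Two
nonadjacent ones would have w among their two common neighbours, which an automorphism of odd order
cannot swap. -/
theorem odd_fixed_nbr_unique {w x v : V} (hw : g w ≠ w) (hx : g x = x) (hv : g v = v)
    (h1 : Γ.Adj w x) (h2 : Γ.Adj w v) : x = v := by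
  by_contra hne
  by_cases ha : Γ.Adj x v
  · exact hw (hΓ.fixed_of_triangle hx hv ha h1.symm h2.symm)
  · obtain ⟨w', hw', h3, h4⟩ := hΓ.exists_common_ne (u := w) hne ha
    have himg : ∀ u, Γ.Adj x u → Γ.Adj v u → g u = w ∨ g u = w' := by
      intro u h5 h6
      refine hΓ.common_cases hne ha hw'.symm h1.symm h2.symm h3 h4 ?_ ?_
      · rw [← hx]; exact (aut_adj g).2 h5
      · rw [← hv]; exact (aut_adj g).2 h6
    have e1 : g w = w' := (himg w h1.symm h2.symm).resolve_left hw
    have e2 : g w' = w := (himg w' h3 h4).resolve_right fun h =>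
      hw' (g.injective (h.trans e1.symm))
    exact hw (aut_fixed_of_sq_fixed hm hg (by rw [e1, e2]))

/-- Otherwise x, y, g y and x, g y, g (g y) are triangles on a common edge, so g (g y) = y, against
odd order. -/
theorem odd_not_adj_image {x y : V} (hx : g x = x) (h : Γ.Adj x y) : ¬ Γ.Adj y (g y) := by
  intro h2
  have h3 : Γ.Adj x (g y) := by rw [← hx]; exact (aut_adj g).2 h
  have h4 : Γ.Adj x (g (g y)) := by rw [← hx]; exact (aut_adj g).2 h3
  have h5 : Γ.Adj (g y) (g (g y)) := (aut_adj g).2 h2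
  have h6 : g (g y) = y := hΓ.common_unique h3 h4 h5 h h2.symm
  exact h2.ne (aut_fixed_of_sq_fixed hm hg h6).symm

/-- Each nonfixed neighbour of x has x as its only fixed neighbour, so the remaining sum in
`sum_fixNbrs_split` is 14 − d. -/
theorem odd_fixNbrs_sq {x : V} (hx : g x = x) :
    (fixNbrs g x).card ^ 2 + 2 = 2 * (fixedSet g).card := by
  have h1 := hΓ.sum_fixNbrs_split hx
  have h2 : ∑ w ∈ (nbrs Γ x).filter (fun v => g v ≠ v), (fixNbrs g w).card =
      ((nbrs Γ x).filter (fun v => g v ≠ v)).card := by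
    rw [Finset.card_eq_sum_ones]
    refine Finset.sum_congr rfl fun w hw => ?_
    rw [Finset.mem_filter, mem_nbrs] at hw
    refine Finset.card_eq_one.2 ⟨x, ?_⟩
    ext v
    rw [mem_fixNbrs, Finset.mem_singleton]
    constructor
    · rintro ⟨h3, h4⟩
      exact (hΓ.odd_fixed_nbr_unique hm hg hw.2 hx h4 hw.1.symm h3).symm
    · rintro rfl; exact ⟨hw.1.symm, hx⟩
  have h3 := hΓ.card_nonfixed_nbrs g x
  omega

/-- The vertices sent to neighbours, the fixed vertices, and the nonfixed neighbours of each fixed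
vertex are pairwise disjoint sets. -/
theorem odd_count {D : ℕ} (hD : ∀ x ∈ fixedSet g, (fixNbrs g x).card + D = 14) :
    (movedToNbr g).card + (fixedSet g).card + (fixedSet g).card * D ≤ 99 := by
  set U := (fixedSet g).biUnion fun x => (nbrs Γ x).filter fun v => g v ≠ v with hU
  have hUc : U.card = (fixedSet g).card * D := by
    rw [hU, Finset.card_biUnion, ← smul_eq_mul, ← Finset.sum_const]
    · refine Finset.sum_congr rfl fun x hx => ?_
      have h1 := hD x hx
      have h2 := hΓ.card_nonfixed_nbrs g x
      omega
    · intro x hx y hy hxy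
      rw [Function.onFun, Finset.disjoint_left]
      intro w hw hw'
      simp only [Finset.mem_filter, mem_nbrs] at hw hw'
      exact hxy (hΓ.odd_fixed_nbr_unique hm hg hw.2 (mem_fixedSet.1 hx) (mem_fixedSet.1 hy)
        hw.1.symm hw'.1.symm)
  rw [← hUc, ← hΓ.card, ← Finset.card_union_of_disjoint, ← Finset.card_union_of_disjoint]
  · exact Finset.card_le_univ _
  · rw [Finset.disjoint_left]
    intro w hw hw'
    simp only [hU, Finset.mem_biUnion, Finset.mem_filter, mem_nbrs, mem_fixedSet] at hw'
    obtain ⟨x, hx, hxw, hgw⟩ := hw'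
    rw [Finset.mem_union, mem_movedToNbr, mem_fixedSet] at hw
    rcases hw with hw | hw
    · exact hΓ.odd_not_adj_image hm hg hx hxw hw
    · exact hgw hw
  · rw [Finset.disjoint_left]
    intro w hw hw'
    rw [mem_movedToNbr] at hw
    rw [mem_fixedSet] at hw'
    exact hw.ne hw'.symm

/-- A nontrivial automorphism of odd order fixes nothing, a vertex, or a triangle. -/
theorem odd_cases (h1 : g ≠ 1) :
    (fixedSet g).card = 0 ∨ (fixedSet g).card = 1 ∨ ((fixedSet g).card = 3 ∧
      (movedToNbr g).card ≤ 60 ∧ ∀ x, g x = x → (fixNbrs g x).card = 2) := by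
  rcases (fixedSet g).eq_empty_or_nonempty with h0 | ⟨x, hx⟩
  · left; rw [h0]; rfl
  right
  have hd := hΓ.odd_fixNbrs_sq hm hg (mem_fixedSet.1 hx)
  have hlt := hΓ.card_fixedSet_lt h1
  have hle : (fixNbrs g x).card ≤ 14 := by
    have := hΓ.card_nonfixed_nbrs g x; omega
  have hall : ∀ y, g y = y → (fixNbrs g y).card = (fixNbrs g x).card := by
    intro y hy
    have := hΓ.odd_fixNbrs_sq hm hg hy
    exact Nat.pow_left_injective (n := 2) (by norm_num) (by simp only; omega)
  have hc := hΓ.odd_count hm hg (D := 14 - (fixNbrs g x).card) (fun y hy => by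
    rw [hall y (mem_fixedSet.1 hy)]; omega)
  have ht := hΓ.trace_mod_seven g
  generalize (fixNbrs g x).card = d at *
  generalize (fixedSet g).card = n at *
  generalize (movedToNbr g).card = a at *
  -- Here n = (d² + 2)/2, so d is even. For d = 4 the count is tight and forces a = 0, against the
  -- congruence mod 7; d from 6 to 12 overfills the 99 vertices, and d = 14 gives n = 99.
  interval_cases d
  · left; omega
  · omega
  · right
    exact ⟨by omega, by omega, hall⟩
  · omega
  · have : n = 9 := by omega
    subst this; omega
  all_goals omega

end

end IsConway99

end OddOrder

/-! ### Involutions fix exactly one vertex. -/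

section Involutions

variable {V : Type*} [Fintype V] {Γ : SimpleGraph V}

namespace IsConway99

/-- Each even d confines 2n to the window from d² + 2 to d² − d + 16; from 20 upwards these windows
are disjoint. -/
theorem involution_arith {d e n : ℕ} (h : 10 ≤ n) (hd : d ≤ 14) (he : e ≤ 14) (hd2 : d % 2 = 0)
    (he2 : e % 2 = 0) (h1 : d ^ 2 + 2 ≤ 2 * n) (h2 : 2 * n + d ≤ d ^ 2 + 16)
    (h3 : e ^ 2 + 2 ≤ 2 * n) (h4 : 2 * n + e ≤ e ^ 2 + 16) : d = e := by
  obtain ⟨a, rfl⟩ : ∃ a, d = 2 * a := ⟨d / 2, by omega⟩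
  obtain ⟨b, rfl⟩ : ∃ b, e = 2 * b := ⟨e / 2, by omega⟩
  have ha : a ≤ 7 := by omega
  have hb : b ≤ 7 := by omega
  clear hd he hd2 he2
  interval_cases a <;> interval_cases b <;> omega

variable (hΓ : IsConway99 Γ) {t : Γ ≃g Γ} (ht : t ^ 2 = 1) (ht1 : t ≠ 1)

include hΓ ht

theorem involution_apply (v : V) : t (t v) = v := by
  rw [← aut_mul_apply, ← pow_two, ht, aut_one_apply]

theorem involution_card_modEq (B : Finset V) (hB : ∀ v ∈ B, t v ∈ B) :
    B.card ≡ (B.filter fun v => t v = v).card [MOD 2] :=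
  aut_card_modEq (p := 2) (n := 1) (by simpa using ht) B hB

theorem involution_fixed_odd : (fixedSet t).card % 2 = 1 := by
  have := hΓ.involution_card_modEq ht Finset.univ (by simp)
  rw [Finset.card_univ, hΓ.card] at this
  exact this.symm

theorem involution_fixNbrs_even {x : V} (hx : t x = x) : (fixNbrs t x).card % 2 = 0 := by
  have := hΓ.involution_card_modEq ht (nbrs Γ x) (fun v hv => by
    rw [mem_nbrs] at hv ⊢
    rw [← hx]; exact (aut_adj t).2 hv)
  rw [hΓ.card_nbrs] at this
  exact this.symm

/-- The neighbours of a fixed vertex which are swapped with the third vertex of their triangle. -/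
theorem involution_sum {x : V} (hx : t x = x) :
    (fixNbrs t x).card ^ 2 + 16 =
      ((nbrs Γ x).filter fun v => Γ.Adj v (t v)).card + 2 * (fixedSet t).card
        + (fixNbrs t x).card := by
  have h1 := hΓ.sum_fixNbrs_split hx
  have h2 : ∀ w ∈ (nbrs Γ x).filter (fun v => t v ≠ v),
      (fixNbrs t w).card + (if Γ.Adj w (t w) then 1 else 0) = 2 := by
    intro w hw
    rw [Finset.mem_filter, mem_nbrs] at hw
    have hxtw : Γ.Adj x (t w) := by rw [← hx]; exact (aut_adj t).2 hw.1
    have hcard : ∀ v, t v = v → Γ.Adj w v → Γ.Adj (t w) v := by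
      intro v hv h; rw [← hv]; exact (aut_adj t).2 h
    have hne : w ≠ t w := fun h => hw.2 h.symm
    -- The fixed neighbours of w are the fixed common neighbours of w and t w, and x is one. It is
    -- the only one if w and t w are adjacent; otherwise the second common neighbour is fixed too.
    by_cases ha : Γ.Adj w (t w)
    · rw [if_pos ha, show (2 : ℕ) = 1 + 1 from rfl, Nat.add_left_inj]
      refine Finset.card_eq_one.2 ⟨x, ?_⟩
      ext v
      rw [mem_fixNbrs, Finset.mem_singleton]
      constructor
      · rintro ⟨h3, h4⟩
        exact hΓ.common_unique ha h3 (hcard v h4 h3) hw.1.symm hxtw.symm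
      · rintro rfl; exact ⟨hw.1.symm, hx⟩
    · rw [if_neg ha, add_zero]
      obtain ⟨v, hvx, hwv, htv⟩ := hΓ.exists_common_ne (u := x) hne ha
      have htt := hΓ.involution_apply ht
      have hv : t v = v := by
        have h3 : Γ.Adj w (t v) := by rw [← htt w]; exact (aut_adj t).2 htv
        have h4 : Γ.Adj (t w) (t v) := (aut_adj t).2 hwv
        refine (hΓ.common_cases hne ha hvx.symm hw.1.symm hxtw.symm hwv htv h3 h4).resolve_left ?_
        intro h5
        exact hvx (t.injective (h5.trans hx.symm))
      rw [← Finset.card_pair hvx]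
      congr 1
      ext u
      rw [mem_fixNbrs, Finset.mem_insert, Finset.mem_singleton]
      constructor
      · rintro ⟨h3, h4⟩
        exact hΓ.common_cases hne ha hvx hwv htv hw.1.symm hxtw.symm h3 (hcard u h4 h3)
      · rintro (rfl | rfl)
        · exact ⟨hwv, hv⟩
        · exact ⟨hw.1.symm, hx⟩
  have h3 := Finset.sum_congr rfl h2
  rw [Finset.sum_add_distrib, Finset.sum_const, smul_eq_mul, ← Finset.card_filter,
    Finset.filter_filter] at h3
  have h4 : (nbrs Γ x).filter (fun v => t v ≠ v ∧ Γ.Adj v (t v)) =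
      (nbrs Γ x).filter fun v => Γ.Adj v (t v) := by
    refine Finset.filter_congr fun v _ => ⟨fun h => h.2, fun h => ⟨h.ne.symm, h⟩⟩
  rw [h4] at h3
  have h5 := hΓ.card_nonfixed_nbrs t x
  omega

theorem involution_sum_le {x : V} :
    ((nbrs Γ x).filter fun v => Γ.Adj v (t v)).card + (fixNbrs t x).card ≤ 14 := by
  rw [← hΓ.card_nonfixed_nbrs t x, Nat.add_le_add_iff_right]
  refine Finset.card_le_card fun v hv => ?_
  rw [Finset.mem_filter] at hv ⊢
  exact ⟨hv.1, hv.2.ne.symm⟩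

/-- An edge from v to t v is preserved by t, so the third vertex of its triangle is fixed; it is the
unique fixed vertex to which v is charged. -/
theorem involution_card_moved : (movedToNbr t).card =
    ∑ x ∈ fixedSet t, ((nbrs Γ x).filter fun v => Γ.Adj v (t v)).card := by
  have htt := hΓ.involution_apply ht
  rw [← Finset.card_biUnion]
  · congr 1
    ext v
    simp only [mem_movedToNbr, Finset.mem_biUnion, Finset.mem_filter, mem_nbrs, mem_fixedSet]
    constructor
    · intro h
      obtain ⟨x, h1, h2⟩ := hΓ.exists_common h
      refine ⟨x, ?_, h1.symm, h⟩
      refine hΓ.common_unique h ?_ ((aut_adj t).2 h1) h1 h2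
      rw [← htt v]; exact (aut_adj t).2 h2
    · rintro ⟨x, _, _, h⟩; exact h
  · intro x hx y hy hxy
    rw [Function.onFun, Finset.disjoint_left]
    intro w hw hw'
    simp only [Finset.mem_filter, mem_nbrs] at hw hw'
    apply hxy
    refine hΓ.common_unique hw.2 hw.1.symm ?_ hw'.1.symm ?_
    · rw [← mem_fixedSet.1 hx]; exact (aut_adj t).2 hw.1.symm
    · rw [← mem_fixedSet.1 hy]; exact (aut_adj t).2 hw'.1.symm

theorem involution_card_add_le : (movedToNbr t).card + (fixedSet t).card ≤ 99 := by
  rw [← hΓ.card, ← Finset.card_union_of_disjoint]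
  · exact Finset.card_le_univ _
  · rw [Finset.disjoint_left]
    intro w hw hw'
    rw [mem_movedToNbr] at hw
    rw [mem_fixedSet] at hw'
    exact hw.ne hw'.symm

/-- The fixed vertices with exactly `d` fixed neighbours form a set which is empty or has more than
`d` elements. -/
theorem lt_card_degree_class {d : ℕ} {x : V} (hx : t x = x) (hd : (fixNbrs t x).card = d) :
    d < ((fixedSet t).filter fun v => (fixNbrs t v).card = d).card := by
  rw [← Nat.succ_le_iff, ← hd, Nat.succ_eq_add_one,
    ← Finset.card_insert_of_notMem (a := x) (s := fixNbrs t x) (by simp)]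
  refine Finset.card_le_card fun v hv => ?_
  rw [Finset.mem_insert, mem_fixNbrs] at hv
  rw [Finset.mem_filter, mem_fixedSet]
  rcases hv with rfl | hv
  · exact ⟨hx, rfl⟩
  · exact ⟨hv.2, hΓ.card_fixNbrs_eq hx hv.2 hv.1⟩

/-- A graph with five vertices, regular of degree two, is not a union of disjoint triangles. -/
theorem exists_degree_ne_two (h5 : (fixedSet t).card = 5) :
    ∃ x, t x = x ∧ (fixNbrs t x).card ≠ 2 := by
  by_contra! hcon
  obtain ⟨x, hx⟩ : (fixedSet t).Nonempty := by
    rw [← Finset.card_pos, h5]; norm_num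
  rw [mem_fixedSet] at hx
  set T := insert x (fixNbrs t x) with hT
  have hTS : T ⊆ fixedSet t := by
    intro v hv
    rw [hT, Finset.mem_insert, mem_fixNbrs] at hv
    rw [mem_fixedSet]
    rcases hv with rfl | hv
    exacts [hx, hv.2]
  have hTc : T.card = 3 := by
    rw [hT, Finset.card_insert_of_notMem (by simp), hcon x hx]
  -- The three vertices of T form a triangle that uses up all their fixed neighbours, which leaves
  -- two fixed vertices unable to have degree 2.
  have hTcl : ∀ v ∈ T, fixNbrs t v ⊆ T := by
    intro v hv
    rw [hT, Finset.mem_insert, mem_fixNbrs] at hv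
    rcases hv with rfl | ⟨hv, hgv⟩
    · exact Finset.subset_insert _ _
    · obtain ⟨u, hxu, hvu⟩ := hΓ.exists_common hv
      have hu := hΓ.fixed_of_triangle hx hgv hv hxu hvu
      have h1 : ({x, u} : Finset V) ⊆ fixNbrs t v := by
        intro w hw
        rw [Finset.mem_insert, Finset.mem_singleton] at hw
        rw [mem_fixNbrs]
        rcases hw with rfl | rfl
        exacts [⟨hv.symm, hx⟩, ⟨hvu, hu⟩]
      have h2 := Finset.eq_of_subset_of_card_le h1 (by rw [Finset.card_pair hxu.ne, hcon v hgv])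
      rw [← h2]
      intro w hw
      rw [Finset.mem_insert, Finset.mem_singleton] at hw
      rw [hT, Finset.mem_insert, mem_fixNbrs]
      rcases hw with rfl | rfl
      exacts [Or.inl rfl, Or.inr ⟨hxu, hu⟩]
  have hc2 : (fixedSet t \ T).card = 2 := by
    rw [Finset.card_sdiff_of_subset hTS, h5, hTc]
  obtain ⟨y, hy⟩ : (fixedSet t \ T).Nonempty := by
    rw [← Finset.card_pos, hc2]; norm_num
  have hy' := Finset.mem_sdiff.1 hy
  have hsub : fixNbrs t y ⊆ (fixedSet t \ T).erase y := by
    intro w hw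
    rw [mem_fixNbrs] at hw
    rw [Finset.mem_erase, Finset.mem_sdiff, mem_fixedSet]
    refine ⟨hw.1.ne.symm, hw.2, fun hwT => hy'.2 (hTcl w hwT ?_)⟩
    rw [mem_fixNbrs]
    exact ⟨hw.1.symm, mem_fixedSet.1 hy'.1⟩
  have := Finset.card_le_card hsub
  rw [Finset.card_erase_of_mem hy, hc2, hcon y (mem_fixedSet.1 hy'.1)] at this
  omega

/-- Sorting the fixed vertices by their number of fixed neighbours evaluates the sum for the moved
vertices. The size bounds on the classes, from `lt_card_degree_class`, are what rule out small
solutions of the congruence. -/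
theorem involution_moved_of_degrees (s : ℕ → ℕ) {d e : ℕ} (hde : d ≠ e)
    (h : ∀ x ∈ fixedSet t, (fixNbrs t x).card = d ∨ (fixNbrs t x).card = e)
    (hs : ∀ x ∈ fixedSet t,
      ((nbrs Γ x).filter fun v => Γ.Adj v (t v)).card = s (fixNbrs t x).card) :
    ∃ k l, k + l = (fixedSet t).card ∧ (movedToNbr t).card = k * s d + l * s e ∧
      (k ≠ 0 → d < k) ∧ (l ≠ 0 → e < l) ∧ (l = 0 → ∀ x, t x = x → (fixNbrs t x).card = d) := by
  refine ⟨((fixedSet t).filter fun v => (fixNbrs t v).card = d).card,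
    ((fixedSet t).filter fun v => (fixNbrs t v).card = e).card, ?_, ?_, ?_, ?_, ?_⟩
  · rw [← Finset.card_union_of_disjoint, ← Finset.filter_or, Finset.filter_true_of_mem h]
    rw [Finset.disjoint_filter]
    intro x _ h1 h2
    exact hde (h1.symm.trans h2)
  · rw [hΓ.involution_card_moved ht, ← smul_eq_mul, ← smul_eq_mul, ← Finset.sum_const,
      ← Finset.sum_const, ← Finset.sum_filter_add_sum_filter_not _
        (fun v => (fixNbrs t v).card = d)]
    congr 1
    · refine Finset.sum_congr rfl fun x hx => ?_
      rw [Finset.mem_filter] at hx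
      rw [hs x hx.1, hx.2]
    · refine Finset.sum_congr ?_ fun x hx => ?_
      · refine Finset.filter_congr fun x hx => ⟨fun h1 => (h x hx).resolve_left h1, ?_⟩
        intro h1 h2
        exact hde (h2.symm.trans h1)
      · rw [Finset.mem_filter] at hx
        rw [hs x hx.1, hx.2]
  · intro h0
    obtain ⟨x, hx⟩ := Finset.card_pos.1 (Nat.pos_of_ne_zero h0)
    rw [Finset.mem_filter, mem_fixedSet] at hx
    exact hΓ.lt_card_degree_class ht hx.1 hx.2
  · intro h0
    obtain ⟨x, hx⟩ := Finset.card_pos.1 (Nat.pos_of_ne_zero h0)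
    rw [Finset.mem_filter, mem_fixedSet] at hx
    exact hΓ.lt_card_degree_class ht hx.1 hx.2
  · intro h0 x hx
    refine (h x (mem_fixedSet.2 hx)).resolve_right fun h1 => ?_
    rw [Finset.card_eq_zero, Finset.filter_eq_empty_iff] at h0
    exact h0 (mem_fixedSet.2 hx) h1

include ht1

/-- Let n be the number of fixed vertices and d the number of fixed neighbours of one of them; n is
odd and d is even. By `involution_sum`, 2n lies between d² + 2 and d² − d + 16, and d² + 16 − 2n − d
neighbours of that vertex are sent to neighbours. Summing determines a from the degrees; the
congruence mod 7, the bound a + n ≤ 99 and the class sizes then exclude every n > 1 except n = 5. -/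
theorem involution_card_fixedSet : (fixedSet t).card = 1 := by
  have hodd := hΓ.involution_fixed_odd ht
  have hlt := hΓ.card_fixedSet_lt ht1
  have htr := hΓ.trace_mod_seven t
  have hle := hΓ.involution_card_add_le ht
  have hx := fun x (hx : x ∈ fixedSet t) => hΓ.involution_sum ht (mem_fixedSet.1 hx)
  have hx2 := fun x (hx : x ∈ fixedSet t) => hΓ.involution_fixNbrs_even ht (mem_fixedSet.1 hx)
  have hx3 := fun x => hΓ.involution_sum_le ht (x := x)
  have h5 := hΓ.exists_degree_ne_two ht
  have hmv := fun d e => hΓ.involution_moved_of_degrees ht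
    (fun d => d ^ 2 + 16 - 2 * (fixedSet t).card - d) (d := d) (e := e)
  have hs : ∀ x ∈ fixedSet t, ((nbrs Γ x).filter fun v => Γ.Adj v (t v)).card =
      (fixNbrs t x).card ^ 2 + 16 - 2 * (fixedSet t).card - (fixNbrs t x).card := by
    intro x hxx; have := hx x hxx; omega
  obtain ⟨x, hxS⟩ : (fixedSet t).Nonempty := by
    rw [← Finset.card_pos]; omega
  have hsmall : ∀ y ∈ fixedSet t, (fixNbrs t y).card ^ 2 + 2 ≤ 2 * (fixedSet t).card ∧
      2 * (fixedSet t).card + (fixNbrs t y).card ≤ (fixNbrs t y).card ^ 2 + 16 ∧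
      (fixNbrs t y).card ≤ 14 := by
    intro y hy
    have h1 := hx y hy
    have h2 := hx3 y
    omega
  rcases Nat.lt_or_ge (fixedSet t).card 10 with h10 | h10
  · have hcases : (fixedSet t).card = 1 ∨ (fixedSet t).card = 3 ∨ (fixedSet t).card = 5 ∨
      (fixedSet t).card = 7 ∨ (fixedSet t).card = 9 := by omega
    have hdeg : ∀ y ∈ fixedSet t, (fixNbrs t y).card = 0 ∨ (fixNbrs t y).card = 2 ∨
        ((fixNbrs t y).card = 4 ∧ (fixedSet t).card = 9) := by
      intro y hy
      obtain ⟨h1, h2, h3⟩ := hsmall y hy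
      have h4 := hx2 y hy
      generalize (fixNbrs t y).card = d at *
      have : d ≤ 4 := by nlinarith
      interval_cases d <;> omega
    rcases hcases with h | h | h | h | h
    · exact h
    all_goals exfalso
    rotate_right
    -- For n = 9 the degrees are 2 and 4, and the congruence asks for 1 or 8 vertices of degree 4;
    -- either way one class is too small.
    · obtain ⟨k, l, h1, h2, h3, h4, -⟩ := hmv 2 4 (by norm_num) (fun y hy => by
        have := hdeg y hy
        have := (hsmall y hy).2.1
        rw [h] at this
        by_cases h0 : (fixNbrs t y).card = 0
        · rw [h0] at this; omega
        · omega) hs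
      rw [h] at h1 h2 htr
      omega
    all_goals
      obtain ⟨l, k, h1, h2, h3, h4, h6⟩ := hmv 2 0 (by norm_num) (fun y hy => by
        have := hdeg y hy; omega) hs
      rw [h] at h1 h2 htr
    · omega
    -- For n = 5 the congruence allows only degree 2 throughout, which `exists_degree_ne_two`
    -- excludes.
    · have hk : k = 0 := by omega
      obtain ⟨y, hy, hy'⟩ := h5 h
      exact hy' (h6 hk y hy)
    · omega
  · exfalso
    have hconst : ∀ y ∈ fixedSet t, (fixNbrs t y).card = (fixNbrs t x).card := by
      intro y hy
      obtain ⟨h1, h2, h3⟩ := hsmall y hy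
      obtain ⟨h4, h5, h6⟩ := hsmall x hxS
      exact involution_arith h10 h3 h6 (hx2 y hy) (hx2 x hxS) h1 h2 h4 h5
    have hmoved : (movedToNbr t).card = (fixedSet t).card *
        ((fixNbrs t x).card ^ 2 + 16 - 2 * (fixedSet t).card - (fixNbrs t x).card) := by
      rw [hΓ.involution_card_moved ht, ← smul_eq_mul, ← Finset.sum_const]
      refine Finset.sum_congr rfl fun y hy => ?_
      rw [hs y hy, hconst y hy]
    obtain ⟨h4, h6, h7⟩ := hsmall x hxS
    have h8 := hx2 x hxS
    generalize (fixNbrs t x).card = d at *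
    generalize (movedToNbr t).card = a at *
    generalize (fixedSet t).card = n at *
    clear hx hx2 hx3 h5 hmv hs hsmall hconst
    obtain ⟨f, rfl⟩ : ∃ f, d = 2 * f := ⟨d / 2, by omega⟩
    have hf : f ≤ 7 := by omega
    -- These are the odd n ≥ 10 in the windows of d = 4, 6, 8, 10, 12; the window of d = 14 contains
    -- only n = 99.
    have hn : n = 11 ∨ n = 13 ∨ n = 19 ∨ n = 21 ∨ n = 23 ∨ n = 33 ∨ n = 35 ∨ n = 51 ∨ n = 53 ∨
        n = 73 := by
      interval_cases f <;> omega
    rcases hn with rfl | rfl | rfl | rfl | rfl | rfl | rfl | rfl | rfl | rfl <;>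
      interval_cases f <;> omega

/-- An involution fixes exactly one vertex, and interchanges the two other vertices of each of the
triangles through it. -/
theorem involution_structure : ∃ x, (∀ v, t v = v ↔ v = x) ∧
    ∀ v, Γ.Adj v (t v) ↔ Γ.Adj x v := by
  have h1 := hΓ.involution_card_fixedSet ht ht1
  obtain ⟨x, hx⟩ := Finset.card_eq_one.1 h1
  have hfix : ∀ v, t v = v ↔ v = x := by
    intro v; rw [← mem_fixedSet, hx, Finset.mem_singleton]
  have hd : (fixNbrs t x).card = 0 := by
    rw [Finset.card_eq_zero, Finset.eq_empty_iff_forall_notMem]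
    intro v hv
    rw [mem_fixNbrs, hfix] at hv
    exact hv.1.ne hv.2.symm
  have h2 := hΓ.involution_sum ht ((hfix x).2 rfl)
  rw [h1, hd] at h2
  have h3 : (nbrs Γ x).filter (fun v => Γ.Adj v (t v)) = nbrs Γ x := by
    refine Finset.eq_of_subset_of_card_le (Finset.filter_subset _ _) ?_
    rw [hΓ.card_nbrs]; omega
  refine ⟨x, hfix, fun v => ⟨fun h => ?_, fun h => ?_⟩⟩
  · obtain ⟨u, h4, h5⟩ := hΓ.exists_common h
    have htt := hΓ.involution_apply ht
    have : t u = u := by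
      refine hΓ.common_unique h ?_ ((aut_adj t).2 h4) h4 h5
      rw [← htt v]; exact (aut_adj t).2 h5
    rw [hfix] at this
    rw [← this]; exact h4.symm
  · rw [← mem_nbrs, ← h3, Finset.mem_filter] at h
    exact h.2

end IsConway99

end Involutions

end

section

open scoped Classical

/-! ### Involutive automorphisms of p-groups. -/

section PGroups

/-- An involutive automorphism of a nontrivial `p`-group fixes or inverts a central element of
order `p`. -/
theorem IsPGroup.exists_central_fixed_or_inverted {p : ℕ} [Fact p.Prime] {P : Type*} [Group P]
    [Finite P] [Nontrivial P] (hP : IsPGroup p P) (σ : P ≃* P) (hσ : ∀ x, σ (σ x) = x) :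
    ∃ z : P, orderOf z = p ∧ (∀ x, x * z = z * x) ∧ (σ z = z ∨ σ z = z⁻¹) := by
  have hnt := hP.center_nontrivial
  have hdvd : p ∣ Nat.card (Subgroup.center P) := by
    obtain ⟨n, hn, h⟩ := ((hP.to_subgroup (Subgroup.center P)).nontrivial_iff_card).1 hnt
    rw [h]; exact dvd_pow_self p hn.ne'
  obtain ⟨⟨z, hz⟩, hzo⟩ := exists_prime_orderOf_dvd_card' p hdvd
  rw [Subgroup.orderOf_mk] at hzo
  have hcen : ∀ y ∈ Subgroup.center P, ∀ x, x * y = y * x := fun y hy x =>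
    Subgroup.mem_center_iff.1 hy x
  have hσz : ∀ x, x * σ z = σ z * x := by
    intro x
    have := congrArg σ (hcen z hz (σ x))
    rwa [map_mul, map_mul, hσ] at this
  -- The product of the commuting central elements z and σ z is fixed by σ and has order dividing p;
  -- if it is trivial, z is inverted.
  by_cases hw : z * σ z = 1
  · exact ⟨z, hzo, hcen z hz, Or.inr (eq_inv_of_mul_eq_one_right hw)⟩
  · refine ⟨z * σ z, ?_, ?_, Or.inl ?_⟩
    · refine orderOf_eq_prime ?_ hw
      have hc : Commute z (σ z) := hσz z
      rw [hc.mul_pow, ← map_pow, ← hzo, pow_orderOf_eq_one, map_one, mul_one]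
    · intro x
      rw [← mul_assoc, hcen z hz x, mul_assoc, hσz, mul_assoc]
    · rw [map_mul, hσ, ← hσz]

/-- A `p`-group of order at least `p ^ 2` with an involutive automorphism has an invariant
subgroup of order `p ^ 2`. -/
theorem IsPGroup.exists_invariant_card_sq {p : ℕ} [Fact p.Prime] {P : Type*} [Group P] [Finite P]
    (hP : IsPGroup p P) (σ : P ≃* P) (hσ : ∀ x, σ (σ x) = x) (hc : p ^ 2 ∣ Nat.card P) :
    ∃ R : Subgroup P, Nat.card R = p ^ 2 ∧ ∀ x ∈ R, σ x ∈ R := by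
  have hp : p.Prime := Fact.out
  have hpos : 0 < Nat.card P := Nat.card_pos
  have hlt : 1 < Nat.card P :=
    lt_of_lt_of_le (Nat.one_lt_pow (by norm_num) hp.one_lt) (Nat.le_of_dvd hpos hc)
  have hnt : Nontrivial P := Finite.one_lt_card_iff_nontrivial.1 hlt
  obtain ⟨z, hzo, hzc, hzσ⟩ := hP.exists_central_fixed_or_inverted σ hσ
  set H := Subgroup.zpowers z with hH
  have hHc : Nat.card H = p := by rw [hH, Nat.card_zpowers, hzo]
  have hnorm : H.Normal := by
    refine ⟨fun n hn g => ?_⟩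
    obtain ⟨k, rfl⟩ := Subgroup.mem_zpowers_iff.1 hn
    have : Commute g z := hzc g
    rw [(this.zpow_right k).eq, mul_inv_cancel_right]
    exact hn
  have hmap : H.map (σ : P →* P) = H := by
    rw [hH, MonoidHom.map_zpowers]
    rcases hzσ with h | h
    · rw [MonoidHom.coe_coe, h]
    · rw [MonoidHom.coe_coe, h, Subgroup.zpowers_inv]
  -- The subgroup generated by z is invariant, so the same lemma applies to the quotient; the
  -- preimage of the resulting group of order p has order p².
  let τ := QuotientGroup.congr H H σ hmap
  have hτ : ∀ x : P, τ (x : P ⧸ H) = ((σ x : P) : P ⧸ H) := fun x => rfl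
  have hcq : Nat.card P = Nat.card (P ⧸ H) * p := by
    rw [Subgroup.card_eq_card_quotient_mul_card_subgroup H, hHc]
  have hpq : p ∣ Nat.card (P ⧸ H) := by
    rw [hcq, pow_two] at hc
    exact Nat.dvd_of_mul_dvd_mul_right hp.pos hc
  have hntq : Nontrivial (P ⧸ H) :=
    Finite.one_lt_card_iff_nontrivial.1 (lt_of_lt_of_le hp.one_lt (Nat.le_of_dvd Nat.card_pos hpq))
  obtain ⟨y, hyo, -, hyσ⟩ := (hP.to_quotient H).exists_central_fixed_or_inverted τ (by
    intro q
    induction q using QuotientGroup.induction_on with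
    | H x => rw [hτ, hτ, hσ])
  refine ⟨(Subgroup.zpowers y).comap (QuotientGroup.mk' H), ?_, ?_⟩
  · have h1 := Subgroup.card_mul_index ((Subgroup.zpowers y).comap (QuotientGroup.mk' H))
    rw [Subgroup.index_comap_of_surjective _ (QuotientGroup.mk'_surjective H)] at h1
    have h2 := Subgroup.card_mul_index (Subgroup.zpowers y)
    rw [Nat.card_zpowers, hyo] at h2
    have h3 : 0 < (Subgroup.zpowers y).index :=
      Nat.pos_of_ne_zero Subgroup.index_ne_zero_of_finite
    rw [hcq, ← h2] at h1
    refine Nat.eq_of_mul_eq_mul_right h3 (h1.trans ?_)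
    ring
  · intro x hx
    rw [Subgroup.mem_comap, QuotientGroup.mk'_apply] at hx ⊢
    rw [← hτ]
    obtain ⟨k, hk⟩ := Subgroup.mem_zpowers_iff.1 hx
    rw [← hk, map_zpow]
    apply Subgroup.zpow_mem
    rcases hyσ with h | h
    · rw [h]; exact Subgroup.mem_zpowers y
    · rw [h]; exact Subgroup.inv_mem _ (Subgroup.mem_zpowers y)

end PGroups

/-! ### Reflections, the sign, and possible prime orders. -/

section Reflections

variable {V : Type*} [Fintype V] {Γ : SimpleGraph V}

/-- An involution which fixes only the vertex `x`, and which interchanges the two other vertices of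
each triangle through `x`. -/
structure IsReflection (t : Γ ≃g Γ) (x : V) : Prop where
  sq : t * t = 1
  fix : ∀ v, t v = v ↔ v = x
  moved : ∀ v, Γ.Adj v (t v) ↔ Γ.Adj x v

namespace IsReflection

variable {t : Γ ≃g Γ} {x : V} (h : IsReflection t x)

include h

theorem apply_self : t x = x := (h.fix x).2 rfl

theorem inv_eq : t⁻¹ = t := inv_eq_of_mul_eq_one_left h.sq

theorem apply_apply (v : V) : t (t v) = v := by
  rw [← aut_mul_apply, h.sq, aut_one_apply]

theorem mul_mul_cancel (g : Γ ≃g Γ) : t * (t * g * t) * t = g := by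
  rw [← mul_assoc, ← mul_assoc, h.sq, one_mul, mul_assoc, h.sq, mul_one]

theorem conj (g : Γ ≃g Γ) : IsReflection (g * t * g⁻¹) (g x) where
  sq := by
    calc g * t * g⁻¹ * (g * t * g⁻¹) = g * (t * t) * g⁻¹ := by group
      _ = 1 := by rw [h.sq, mul_one, mul_inv_cancel]
  fix v := by
    rw [aut_mul_apply, aut_mul_apply, ← aut_inv_eq_iff (g := g), ← h.fix, eq_comm,
      ← aut_inv_eq_iff, eq_comm]
  moved v := by
    rw [aut_mul_apply, aut_mul_apply, aut_adj_inv, h.moved, ← aut_adj g, aut_apply_inv_self]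

end IsReflection

namespace IsConway99

variable (hΓ : IsConway99 Γ)

include hΓ

theorem exists_isReflection {t : Γ ≃g Γ} (ht : t * t = 1) (ht1 : t ≠ 1) :
    ∃ x, IsReflection t x := by
  obtain ⟨x, h1, h2⟩ := hΓ.involution_structure (by rw [pow_two, ht]) ht1
  exact ⟨x, ht, h1, h2⟩

theorem exists_adj (x : V) : ∃ y, Γ.Adj x y := by
  have : (nbrs Γ x).Nonempty := by rw [← Finset.card_pos, hΓ.card_nbrs]; norm_num
  obtain ⟨y, hy⟩ := this
  exact ⟨y, mem_nbrs.1 hy⟩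

theorem IsReflection.ne_one {t : Γ ≃g Γ} {x : V} (h : IsReflection t x) : t ≠ 1 := by
  rintro rfl
  obtain ⟨y, hy⟩ := hΓ.exists_adj x
  exact hy.ne ((h.fix y).1 rfl).symm

/-- An automorphism which fixes a vertex and all its neighbours is trivial. -/
theorem eq_one_of_fix_nbrs {h : Γ ≃g Γ} {x : V} (hx : h x = x) (hn : ∀ y, Γ.Adj x y → h y = y) :
    h = 1 := by
  refine aut_eq_one_of_forall fun v => ?_
  by_cases hv : v = x
  · rw [hv, hx]
  by_cases ha : Γ.Adj x v
  · exact hn v ha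
  -- A vertex v not adjacent to x is the common neighbour other than x of two nonadjacent neighbours
  -- a, b of x, all of which are fixed.
  obtain ⟨a, -, hxa, hva⟩ := hΓ.exists_common_ne (u := x) (Ne.symm hv) ha
  obtain ⟨b, hba, hxb, hvb⟩ := hΓ.exists_common_ne (u := a) (Ne.symm hv) ha
  have hab : ¬ Γ.Adj a b := fun hab =>
    hv (hΓ.common_unique hab hva.symm hvb.symm hxa.symm hxb.symm)
  have h1 : Γ.Adj a (h v) := by rw [← hn a hxa]; exact (aut_adj h).2 hva.symm
  have h2 : Γ.Adj b (h v) := by rw [← hn b hxb]; exact (aut_adj h).2 hvb.symm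
  refine (hΓ.common_cases hba.symm hab (Ne.symm hv) hxa.symm hxb.symm hva.symm hvb.symm
    h1 h2).resolve_left fun h3 => hv (h.injective (h3.trans hx.symm))

/-- Both swap the two further vertices of every triangle through x, so t * s fixes x and all its
neighbours. -/
theorem reflection_unique {t s : Γ ≃g Γ} {x : V} (ht : IsReflection t x) (hs : IsReflection s x) :
    t = s := by
  have h1 : t * s = 1 := by
    refine hΓ.eq_one_of_fix_nbrs (x := x) ?_ fun y hy => ?_
    · rw [aut_mul_apply, hs.apply_self, ht.apply_self]
    · have h2 : s y = t y := by
        refine hΓ.common_unique hy ?_ ((hs.moved y).2 hy) ?_ ((ht.moved y).2 hy)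
        · conv_lhs => rw [← hs.apply_self]
          exact (aut_adj s).2 hy
        · conv_lhs => rw [← ht.apply_self]
          exact (aut_adj t).2 hy
      rw [aut_mul_apply, h2, ht.apply_apply]
  rw [← hs.inv_eq]
  exact eq_inv_of_mul_eq_one_left h1

/-- A reflection is central in the stabilizer of its vertex. -/
theorem reflection_commute {t g : Γ ≃g Γ} {x : V} (ht : IsReflection t x) (hg : g x = x) :
    g * t = t * g := by
  have h1 := ht.conj g
  rw [hg] at h1
  have h2 := hΓ.reflection_unique h1 ht
  exact mul_inv_eq_iff_eq_mul.1 h2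

omit hΓ in
theorem fixed_of_reflection_commute {t g : Γ ≃g Γ} {x : V} (ht : IsReflection t x)
    (hg : g * t = t * g) : g x = x := by
  rw [← ht.fix, ← aut_mul_apply, ← hg, aut_mul_apply, ht.apply_self]

/-- If a reflection normalizes a set of vertices of odd size, this contains its fixed vertex. -/
theorem reflection_mem_of_odd {t : Γ ≃g Γ} {x : V} (ht : IsReflection t x) {B : Finset V}
    (hB : ∀ v ∈ B, t v ∈ B) : B.card % 2 = if x ∈ B then 1 else 0 := by
  have h := hΓ.involution_card_modEq (t := t) (by rw [pow_two, ht.sq]) B hB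
  have h2 : (B.filter fun v => t v = v) = if x ∈ B then {x} else ∅ := by
    ext v
    rw [Finset.mem_filter, ht.fix]
    split_ifs with hx
    · rw [Finset.mem_singleton]
      exact ⟨fun h => h.2, fun h => ⟨h ▸ hx, h⟩⟩
    · simp only [Finset.notMem_empty, iff_false, not_and]
      rintro h1 rfl; exact hx h1
  rw [h2] at h
  rw [h]
  split_ifs <;> simp

end IsConway99

/-- Automorphisms as permutations. -/
def autToPerm (Γ : SimpleGraph V) : (Γ ≃g Γ) →* Equiv.Perm V where
  toFun g := g.toEquiv
  map_one' := rfl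
  map_mul' _ _ := rfl

/-- The sign of an automorphism. -/
noncomputable def autSign (Γ : SimpleGraph V) : (Γ ≃g Γ) →* ℤˣ :=
  Equiv.Perm.sign.comp (autToPerm Γ)

namespace IsConway99

variable (hΓ : IsConway99 Γ)

include hΓ

/-- One fixed vertex out of 99 leaves 49 transpositions, an odd number. -/
theorem autSign_reflection {t : Γ ≃g Γ} {x : V} (ht : IsReflection t x) : autSign Γ t = -1 := by
  have h1 : autToPerm Γ t ^ 2 = 1 := by rw [← map_pow, pow_two, ht.sq, map_one]
  have h2 : Fintype.card (Function.fixedPoints (autToPerm Γ t)) = 1 := by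
    rw [Fintype.card_eq_one_iff]
    refine ⟨⟨x, ht.apply_self⟩, fun y => Subtype.ext ?_⟩
    exact (ht.fix y).1 y.2
  rw [autSign, MonoidHom.comp_apply, Equiv.Perm.sign_of_pow_two_eq_one h1, hΓ.card, h2]
  decide

omit hΓ in
theorem autSign_of_odd {g : Γ ≃g Γ} {m : ℕ} (hm : Odd m) (hg : g ^ m = 1) : autSign Γ g = 1 := by
  rcases Int.units_eq_one_or (autSign Γ g) with h | h
  · exact h
  · have h2 := congrArg (autSign Γ) hg
    rw [map_pow, h, hm.neg_one_pow, map_one] at h2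
    exact absurd h2 (by decide)

/-- By Cauchy, even order would give an involution in the kernel; it would be a reflection, hence an
odd permutation. -/
theorem card_ker_autSign_odd : Odd (Nat.card (autSign Γ).ker) := by
  rw [← Nat.not_even_iff_odd, even_iff_two_dvd]
  intro h
  have : Fact (Nat.Prime 2) := ⟨Nat.prime_two⟩
  obtain ⟨⟨s, hs⟩, hso⟩ := exists_prime_orderOf_dvd_card' 2 h
  rw [Subgroup.orderOf_mk] at hso
  obtain ⟨x, hx⟩ := hΓ.exists_isReflection (t := s)
    (by rw [← pow_two, ← hso, pow_orderOf_eq_one])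
    (by rintro rfl; rw [orderOf_one] at hso; omega)
  have := hΓ.autSign_reflection hx
  rw [MonoidHom.mem_ker] at hs
  rw [hs] at this
  exact absurd this (by decide)

theorem card_aut_eq {t : Γ ≃g Γ} {x : V} (ht : IsReflection t x) :
    Nat.card (Γ ≃g Γ) = 2 * Nat.card (autSign Γ).ker := by
  rw [← (autSign Γ).ker.card_mul_index, mul_comm]
  congr 1
  rw [Subgroup.index_ker, MonoidHom.range_eq_top.2, Subgroup.card_top, Nat.card_eq_fintype_card,
    Fintype.card_units_int]
  intro u
  rcases Int.units_eq_one_or u with rfl | rfl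
  · exact ⟨1, map_one _⟩
  · exact ⟨t, hΓ.autSign_reflection ht⟩

/-- Each Sylow subgroup for an odd prime is normalized by a reflection. -/
theorem exists_reflection_normalizing {t₀ : Γ ≃g Γ} {x₀ : V} (ht₀ : IsReflection t₀ x₀) {p : ℕ}
    [Fact p.Prime] (hp : p ≠ 2) (P : Sylow p (Γ ≃g Γ)) :
    ∃ t x, IsReflection t x ∧ ∀ q ∈ P, t * q * t ∈ P := by
  have hpo : Odd p := (Fact.out : p.Prime).odd_of_ne_two hp
  have hPK : (P : Subgroup (Γ ≃g Γ)) ≤ (autSign Γ).ker := by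
    intro q hq
    obtain ⟨k, hk⟩ := P.2 ⟨q, hq⟩
    rw [MonoidHom.mem_ker]
    exact autSign_of_odd (hpo.pow (n := k)) (congrArg Subtype.val hk)
  -- Frattini argument: the normalizer of P and the kernel generate the whole group, so the
  -- normalizer contains an odd permutation.
  have hsup := P.normalizer_sup_eq_top' hPK
  obtain ⟨n, hn, hnK⟩ : ∃ n ∈ Subgroup.normalizer (P : Set (Γ ≃g Γ)), n ∉ (autSign Γ).ker := by
    by_contra! hcon
    have : (autSign Γ).ker = ⊤ := by
      rw [← hsup]; exact (sup_eq_right.2 hcon).symm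
    have h1 : t₀ ∈ (autSign Γ).ker := by rw [this]; trivial
    rw [MonoidHom.mem_ker, hΓ.autSign_reflection ht₀] at h1
    exact absurd h1 (by decide)
  have hsn : autSign Γ n = -1 := (Int.units_eq_one_or _).resolve_left hnK
  have hodd := hΓ.card_ker_autSign_odd
  -- Since m is odd and the group has order 2m, n ^ m is an odd permutation with trivial square,
  -- hence a reflection normalizing P.
  set m := Nat.card (autSign Γ).ker with hm
  obtain ⟨x, hx⟩ := hΓ.exists_isReflection (t := n ^ m) (by
    rw [← pow_add, ← two_mul, hm, ← hΓ.card_aut_eq ht₀, pow_card_eq_one']) (by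
    intro h1
    have h2 := congrArg (autSign Γ) h1
    rw [map_pow, hsn, hodd.neg_one_pow, map_one] at h2
    exact absurd h2 (by decide))
  refine ⟨n ^ m, x, hx, fun q hq => ?_⟩
  have h1 : n ^ m ∈ Subgroup.normalizer (P : Set (Γ ≃g Γ)) := Subgroup.pow_mem _ hn m
  have h2 := (Subgroup.mem_normalizer_iff.1 h1 q).1 hq
  rwa [hx.inv_eq] at h2

/-- The fixed points of an automorphism of prime power order. -/
theorem card_fixedSet_modEq {p n : ℕ} [Fact p.Prime] {g : Γ ≃g Γ} (hg : g ^ p ^ n = 1) :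
    99 ≡ (fixedSet g).card [MOD p] := by
  have h := aut_card_modEq hg Finset.univ (by simp)
  rwa [Finset.card_univ, hΓ.card] at h

/-- The number of fixed vertices is 0, 1 or 3 and is congruent to 99 mod p, so p divides 99, 98 or
96. -/
theorem prime_order_cases {p : ℕ} (hp : p.Prime) (hp2 : p ≠ 2) {g : Γ ≃g Γ}
    (hg : orderOf g = p) : p = 3 ∨ p = 7 ∨ p = 11 := by
  have : Fact p.Prime := ⟨hp⟩
  have hgp : g ^ p = 1 := by rw [← hg, pow_orderOf_eq_one]
  have hg1 : g ≠ 1 := by rintro rfl; rw [orderOf_one] at hg; exact hp.one_lt.ne hg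
  have h1 := hΓ.card_fixedSet_modEq (p := p) (n := 1) (g := g) (by rwa [pow_one])
  have key : p ∣ 99 ∨ p ∣ 98 ∨ p ∣ 96 := by
    rcases hΓ.odd_cases (hp.odd_of_ne_two hp2) hgp hg1 with h | h | h
    · left; rw [h] at h1; exact (Nat.modEq_zero_iff_dvd).1 h1
    · right; left; rw [h] at h1; exact (Nat.modEq_iff_dvd' (by norm_num)).1 h1.symm
    · right; right; rw [h.1] at h1; exact (Nat.modEq_iff_dvd' (by norm_num)).1 h1.symm
  rcases key with h | h | h
  · have : p ∈ Nat.primeFactors 99 := by rw [Nat.mem_primeFactors]; exact ⟨hp, h, by norm_num⟩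
    rw [show (99 : ℕ) = 3 ^ 2 * 11 from rfl, Nat.primeFactors_mul (by norm_num) (by norm_num),
      Nat.primeFactors_prime_pow (by norm_num) (by norm_num),
      Nat.Prime.primeFactors (by norm_num)] at this
    simp at this; omega
  · have : p ∈ Nat.primeFactors 98 := by rw [Nat.mem_primeFactors]; exact ⟨hp, h, by norm_num⟩
    rw [show (98 : ℕ) = 7 ^ 2 * 2 from rfl, Nat.primeFactors_mul (by norm_num) (by norm_num),
      Nat.primeFactors_prime_pow (by norm_num) (by norm_num),
      Nat.Prime.primeFactors (by norm_num)] at this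
    simp at this; omega
  · have : p ∈ Nat.primeFactors 96 := by rw [Nat.mem_primeFactors]; exact ⟨hp, h, by norm_num⟩
    rw [show (96 : ℕ) = 2 ^ 5 * 3 from rfl, Nat.primeFactors_mul (by norm_num) (by norm_num),
      Nat.primeFactors_prime_pow (by norm_num) (by norm_num),
      Nat.Prime.primeFactors (by norm_num)] at this
    simp at this; omega

end IsConway99

end Reflections

end

section

open scoped Classical

/-! ### Elements inverted by a reflection; the prime 11. -/

section Inverted

variable {V : Type*} [Fintype V] {Γ : SimpleGraph V}

theorem IsReflection.apply_inverted {t z : Γ ≃g Γ} {x : V} (ht : IsReflection t x)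
    (hz : t * z * t = z⁻¹) (v : V) : t (z v) = z⁻¹ (t v) := by
  rw [← aut_mul_apply, ← aut_mul_apply, ← hz, mul_assoc, ht.sq, mul_one]

theorem IsReflection.pow_inverted {t z : Γ ≃g Γ} {x : V} (ht : IsReflection t x)
    (hz : t * z * t = z⁻¹) (n : ℕ) : t * z ^ n * t = (z ^ n)⁻¹ := by
  have h1 : ∀ g, t * g * t = MulAut.conj t g := fun g => by
    rw [MulAut.conj_apply, ht.inv_eq]
  rw [h1, map_pow, ← h1, hz, inv_pow]

namespace IsConway99

variable (hΓ : IsConway99 Γ)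

include hΓ

/-- Both y and z (z (z y)) are common neighbours of the adjacent vertices z y and z (z y). -/
theorem pow_three_fixed {z : Γ ≃g Γ} {y : V} (h1 : Γ.Adj y (z y)) (h2 : Γ.Adj y (z (z y))) :
    z (z (z y)) = y :=
  hΓ.common_unique ((aut_adj z).2 h1) ((aut_adj z).2 h2) ((aut_adj z).2 ((aut_adj z).2 h1))
    h1.symm h2.symm

/-- The reflection preserves the set of vertices that z sends to neighbours, and its only fixed
vertex is x. -/
theorem inverted_moved_mod_two {t z : Γ ≃g Γ} {x : V} (ht : IsReflection t x)
    (hz : t * z * t = z⁻¹) : (movedToNbr z).card % 2 = if Γ.Adj x (z x) then 1 else 0 := by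
  rw [hΓ.reflection_mem_of_odd ht (B := movedToNbr z)]
  · simp only [mem_movedToNbr]
  · intro v hv
    rw [mem_movedToNbr] at hv ⊢
    have h := (aut_adj t).2 hv
    rw [ht.apply_inverted hz, aut_adj_inv, inv_inv] at h
    exact h.symm

/-- The reflection sends the neighbour z x of x to z⁻¹ x, and these two are adjacent; applying z
makes x adjacent to z (z x). -/
theorem inverted_pow_three {t z : Γ ≃g Γ} {x : V} (ht : IsReflection t x)
    (hz : t * z * t = z⁻¹) (h : Γ.Adj x (z x)) : z (z (z x)) = x := by
  refine hΓ.pow_three_fixed h ?_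
  have h1 := (ht.moved (z x)).2 h
  rw [ht.apply_inverted hz, ht.apply_self, aut_adj_inv, inv_inv] at h1
  exact h1.symm

theorem card_fixedSet_eq_zero_of_eleven {z : Γ ≃g Γ} (hz : z ^ 11 = 1) (hz1 : z ≠ 1) :
    (fixedSet z).card = 0 := by
  have : Fact (Nat.Prime 11) := ⟨by norm_num⟩
  have h1 := hΓ.card_fixedSet_modEq (p := 11) (n := 1) (by rwa [pow_one])
  rcases hΓ.odd_cases (by decide) hz hz1 with h | h | h
  · exact h
  · rw [h] at h1; exact absurd h1 (by decide)
  · rw [h.1] at h1; exact absurd h1 (by decide)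

theorem ne_of_fixedSet_card_zero {z : Γ ≃g Γ} (h : (fixedSet z).card = 0) (v : V) : z v ≠ v := by
  intro h1
  rw [Finset.card_eq_zero] at h
  have := mem_fixedSet.2 h1
  rw [h] at this
  exact absurd this (Finset.notMem_empty v)

/-- The number a is a multiple of 11 since z acts freely, and is 4 mod 7, so it is 11 or 88. It is
even: if x were adjacent to z x, then z ^ 3, hence z ^ 12 = z, would fix x. -/
theorem eleven_inverted_moved {t z : Γ ≃g Γ} {x : V} (ht : IsReflection t x) (hz : z ^ 11 = 1)
    (hz1 : z ≠ 1) (hi : t * z * t = z⁻¹) : (movedToNbr z).card = 88 := by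
  have : Fact (Nat.Prime 11) := ⟨by norm_num⟩
  have h0 := hΓ.card_fixedSet_eq_zero_of_eleven hz hz1
  have h1 := aut_card_modEq (p := 11) (n := 1) (g := z) (by rwa [pow_one]) (movedToNbr z)
    (fun v hv => by rw [mem_movedToNbr] at hv ⊢; exact (aut_adj z).2 hv)
  rw [Finset.filter_false_of_mem fun v _ => hΓ.ne_of_fixedSet_card_zero h0 v,
    Finset.card_empty] at h1
  have h2 := hΓ.trace_mod_seven z
  rw [h0] at h2
  have h3 := hΓ.inverted_moved_mod_two ht hi
  rw [if_neg] at h3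
  · have h4 : (movedToNbr z).card ≤ 99 := by rw [← hΓ.card]; exact Finset.card_le_univ _
    have h5 : (movedToNbr z).card % 11 = 0 := h1
    omega
  · intro h
    have h4 := hΓ.inverted_pow_three ht hi h
    have h5 : (z ^ 3) x = x := h4
    have h6 : (z ^ 12) x = x := by
      rw [show 12 = 3 * 4 from rfl, pow_mul]; exact aut_pow_fixed h5 4
    rw [pow_succ, hz, one_mul] at h6
    exact h.ne h6.symm

/-- Both z and z ^ 2 send 88 of the 99 vertices to neighbours, so some y is adjacent to z y and to z
(z y). Then z ^ 3, and with it z, fixes y. -/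
theorem not_eleven_inverted {t z : Γ ≃g Γ} {x : V} (ht : IsReflection t x) (hz : z ^ 11 = 1)
    (hz1 : z ≠ 1) : t * z * t ≠ z⁻¹ := by
  intro hi
  have h1 := hΓ.eleven_inverted_moved ht hz hz1 hi
  have hz2 : (z ^ 2) ^ 11 = 1 := by rw [← pow_mul, mul_comm, pow_mul, hz, one_pow]
  have h2 := hΓ.eleven_inverted_moved (z := z ^ 2) ht hz2
    (by
      intro h
      apply hz1
      have : z ^ 11 = (z ^ 2) ^ 5 * z := by rw [← pow_mul, ← pow_succ]
      rw [h, one_pow, one_mul, hz] at this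
      exact this.symm)
    (ht.pow_inverted hi 2)
  have h3 : (movedToNbr z ∩ movedToNbr (z ^ 2)).Nonempty := by
    rw [← Finset.card_pos]
    have h4 := Finset.card_union_add_card_inter (movedToNbr z) (movedToNbr (z ^ 2))
    have h5 : (movedToNbr z ∪ movedToNbr (z ^ 2)).card ≤ 99 := by
      rw [← hΓ.card]; exact Finset.card_le_univ _
    omega
  obtain ⟨y, hy⟩ := h3
  rw [Finset.mem_inter, mem_movedToNbr, mem_movedToNbr] at hy
  have h5 : (z ^ 3) y = y := hΓ.pow_three_fixed hy.1 hy.2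
  have h6 : (z ^ 12) y = y := by
    rw [show 12 = 3 * 4 from rfl, pow_mul]; exact aut_pow_fixed h5 4
  rw [pow_succ, hz, one_mul] at h6
  exact hy.1.ne h6.symm

end IsConway99

end Inverted

/-! ### Orbit matrices of a group of automorphisms. -/

section OrbitCounts

variable {V : Type*} [Fintype V] {Γ : SimpleGraph V}

/-- The number of elements of `D` which move `z` to a neighbour of `y`. -/
noncomputable def orbitAdj (D : Subgroup (Γ ≃g Γ)) (y z : V) : ℕ :=
  (Finset.univ.filter fun d : D => Γ.Adj y ((d : Γ ≃g Γ) z)).card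

/-- The number of elements of `D` which move `z` to `y`. -/
noncomputable def orbitEq (D : Subgroup (Γ ≃g Γ)) (y z : V) : ℕ :=
  (Finset.univ.filter fun d : D => y = (d : Γ ≃g Γ) z).card

variable (D : Subgroup (Γ ≃g Γ))

theorem orbitAdj_eq_sum (y z : V) :
    orbitAdj D y z = ∑ d : D, if Γ.Adj y ((d : Γ ≃g Γ) z) then 1 else 0 := by
  rw [orbitAdj, Finset.card_filter]

theorem orbitAdj_comm (y z : V) : orbitAdj D y z = orbitAdj D z y := by
  rw [orbitAdj_eq_sum, orbitAdj_eq_sum, ← Equiv.sum_comp (Equiv.inv D)]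
  refine Finset.sum_congr rfl fun d _ => ?_
  have : Γ.Adj y ((d : Γ ≃g Γ)⁻¹ z) ↔ Γ.Adj z ((d : Γ ≃g Γ) y) := by
    rw [aut_adj_inv, inv_inv, Γ.adj_comm]
  simp only [Equiv.inv_apply, InvMemClass.coe_inv, this]

theorem orbitAdj_apply_right (y z : V) {d : Γ ≃g Γ} (hd : d ∈ D) :
    orbitAdj D y (d z) = orbitAdj D y z := by
  rw [orbitAdj_eq_sum, orbitAdj_eq_sum, ← Equiv.sum_comp (Equiv.mulRight (⟨d, hd⟩ : D))
    (fun e : D => if Γ.Adj y ((e : Γ ≃g Γ) z) then 1 else 0)]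
  refine Finset.sum_congr rfl fun e _ => ?_
  rfl

namespace IsConway99

theorem sum_orbitAdj_filter (S : Finset V) (hS : ∀ d ∈ D, ∀ v ∈ S, d v ∈ S) (y : V) :
    ∑ w ∈ S, orbitAdj D y w = Fintype.card D * ((nbrs Γ y).filter (· ∈ S)).card := by
  simp only [orbitAdj_eq_sum]
  rw [Finset.sum_comm]
  have : ∀ d : D, ∑ w ∈ S, (if Γ.Adj y ((d : Γ ≃g Γ) w) then 1 else 0) =
      ((nbrs Γ y).filter (· ∈ S)).card := by
    intro d
    rw [← Finset.card_filter]
    refine Finset.card_bij (fun w _ => (d : Γ ≃g Γ) w) ?_ ?_ ?_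
    · intro w hw
      rw [Finset.mem_filter] at hw
      rw [Finset.mem_filter, mem_nbrs]
      exact ⟨hw.2, hS d d.2 w hw.1⟩
    · intro a _ b _ hab; exact (d : Γ ≃g Γ).injective hab
    · intro b hb
      rw [Finset.mem_filter, mem_nbrs] at hb
      refine ⟨(d : Γ ≃g Γ)⁻¹ b, ?_, aut_apply_inv_self _ _⟩
      rw [Finset.mem_filter, aut_apply_inv_self]
      exact ⟨hS _ (D.inv_mem d.2) b hb.2, hb.1⟩
  rw [Finset.sum_congr rfl fun d _ => this d, Finset.sum_const, smul_eq_mul, Finset.card_univ]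

variable (hΓ : IsConway99 Γ)

include hΓ

theorem sum_orbitAdj (y : V) : ∑ w, orbitAdj D y w = Fintype.card D * 14 := by
  rw [sum_orbitAdj_filter D Finset.univ (by simp) y, ← hΓ.card_nbrs y]
  simp

/-- This is A² + A = 12I + 2J averaged over D. Summing over all vertices w, and not over orbits,
keeps it valid for orbits with nontrivial stabilizers. -/
theorem sum_orbitAdj_mul (y z : V) :
    ∑ w, orbitAdj D y w * orbitAdj D z w + Fintype.card D * orbitAdj D y z =
      Fintype.card D * (2 * Fintype.card D + 12 * orbitEq D y z) := by
  have h1 : ∀ v, (∑ w, if Γ.Adj y w ∧ Γ.Adj v w then 1 else 0) + (if Γ.Adj y v then 1 else 0) =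
      2 + 12 * if y = v then 1 else 0 := by
    intro v
    rw [← Finset.card_filter]
    by_cases hv : y = v
    · subst hv; simp only [and_self, hΓ.deg]; simp
    · by_cases ha : Γ.Adj y v
      · rw [hΓ.adj y v ha]; simp [ha, hv]
      · rw [hΓ.nonadj y v hv ha]; simp [ha, hv]
  have h2 : ∀ d : D, ∑ w, ∑ e : D, (if Γ.Adj y ((d : Γ ≃g Γ) w) then 1 else 0) *
      (if Γ.Adj z ((e : Γ ≃g Γ) w) then 1 else 0) =
      ∑ f : D, ∑ w, if Γ.Adj y w ∧ Γ.Adj ((f : Γ ≃g Γ) z) w then 1 else 0 := by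
    intro d
    rw [Finset.sum_comm]
    -- Substitute f = d e⁻¹ and replace w by d w.
    refine Fintype.sum_equiv ((Equiv.inv D).trans (Equiv.mulLeft d)) _ _ fun e => ?_
    refine Fintype.sum_equiv (d : Γ ≃g Γ).toEquiv _ _ fun w => ?_
    have : Γ.Adj (((d * e⁻¹ : D) : Γ ≃g Γ) z) ((d : Γ ≃g Γ) w) ↔ Γ.Adj z ((e : Γ ≃g Γ) w) := by
      rw [Subgroup.coe_mul, aut_mul_apply, aut_adj, InvMemClass.coe_inv, ← aut_adj_inv (w := w)]
    simp only [Equiv.trans_apply, Equiv.inv_apply, Equiv.coe_mulLeft, RelIso.coe_fn_toEquiv, this]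
    by_cases h3 : Γ.Adj y ((d : Γ ≃g Γ) w) <;> by_cases h4 : Γ.Adj z ((e : Γ ≃g Γ) w) <;>
      simp [h3, h4]
  have h3 : ∑ w, orbitAdj D y w * orbitAdj D z w = Fintype.card D *
      ∑ f : D, ∑ w, if Γ.Adj y w ∧ Γ.Adj ((f : Γ ≃g Γ) z) w then 1 else 0 := by
    simp only [orbitAdj_eq_sum, Finset.sum_mul_sum]
    rw [Finset.sum_comm, Finset.sum_congr rfl fun d _ => h2 d, Finset.sum_const, smul_eq_mul,
      Finset.card_univ]
  rw [h3, ← mul_add, orbitAdj_eq_sum, ← Finset.sum_add_distrib,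
    Finset.sum_congr rfl fun (f : D) _ => h1 ((f : Γ ≃g Γ) z), Finset.sum_add_distrib,
    ← Finset.mul_sum, ← Finset.card_filter, Finset.sum_const, smul_eq_mul, Finset.card_univ,
    mul_comm _ 2]
  rfl

end IsConway99

/-- Representatives of the orbits of a group acting freely on an invariant set. -/
theorem exists_orbit_representatives (k : ℕ) : ∀ (S : Finset V),
    (∀ d ∈ D, ∀ v ∈ S, d v ∈ S) → (∀ d ∈ D, ∀ v ∈ S, d v = v → d = 1) →
    S.card = k * Fintype.card D →
    ∃ r : Fin k → V, (∀ i, r i ∈ S) ∧ (∀ i j, ∀ d ∈ D, r i = d (r j) → i = j) ∧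
      ∀ f : V → ℕ, (∀ d ∈ D, ∀ v, f (d v) = f v) →
        ∑ v ∈ S, f v = Fintype.card D * ∑ i, f (r i) := by
  have hD : 0 < Fintype.card D := Fintype.card_pos
  induction k with
  | zero =>
    intro S _ _ hc
    rw [zero_mul, Finset.card_eq_zero] at hc
    subst hc
    exact ⟨fun i => i.elim0, fun i => i.elim0, fun i => i.elim0, fun f _ => by simp⟩
  | succ k ih =>
    intro S hinv hfree hc
    obtain ⟨v₀, hv₀⟩ : S.Nonempty := by
      rw [← Finset.card_pos, hc]; positivity
    set O := Finset.univ.image fun d : D => (d : Γ ≃g Γ) v₀ with hO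
    have hinj : Function.Injective fun d : D => (d : Γ ≃g Γ) v₀ := by
      intro d e hde
      have h1 : ((e : Γ ≃g Γ)⁻¹ * d) v₀ = v₀ := by
        rw [aut_mul_apply]; simp only at hde; rw [hde, aut_inv_apply_self]
      have h2 := hfree _ (D.mul_mem (D.inv_mem e.2) d.2) v₀ hv₀ h1
      exact Subtype.ext (inv_mul_eq_one.1 h2).symm
    have hOc : O.card = Fintype.card D := by
      rw [hO, Finset.card_image_of_injective _ hinj, Finset.card_univ]
    have hOS : O ⊆ S := by
      intro v hv
      obtain ⟨d, -, rfl⟩ := Finset.mem_image.1 hv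
      exact hinv d d.2 v₀ hv₀
    have hmem : ∀ v, v ∈ O ↔ ∃ d ∈ D, d v₀ = v := by
      intro v; simp [hO]
    have hOinv : ∀ d ∈ D, ∀ v, d v ∈ O → v ∈ O := by
      intro d hd v hv
      obtain ⟨e, he, h⟩ := (hmem _).1 hv
      refine (hmem _).2 ⟨d⁻¹ * e, D.mul_mem (D.inv_mem hd) he, ?_⟩
      rw [aut_mul_apply, h, aut_inv_apply_self]
    obtain ⟨r, h1, h2, h3⟩ := ih (S \ O) (fun d hd v hv => by
        rw [Finset.mem_sdiff] at hv ⊢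
        exact ⟨hinv d hd v hv.1, fun h => hv.2 (hOinv d hd v h)⟩)
      (fun d hd v hv => hfree d hd v (Finset.mem_sdiff.1 hv).1)
      (by rw [Finset.card_sdiff_of_subset hOS, hc, hOc, add_one_mul, Nat.add_sub_cancel])
    have hr : ∀ i, r i ∉ O := fun i => (Finset.mem_sdiff.1 (h1 i)).2
    refine ⟨Fin.cons v₀ r, ?_, ?_, ?_⟩
    · intro i
      refine Fin.cases ?_ (fun i => ?_) i
      · exact hv₀
      · exact (Finset.mem_sdiff.1 (h1 i)).1
    · intro i j
      refine Fin.cases ?_ (fun i => ?_) i <;> refine Fin.cases ?_ (fun j => ?_) j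
      · intros; rfl
      · intro d hd h
        simp only [Fin.cons_zero, Fin.cons_succ] at h
        refine absurd (hOinv d hd (r j) ?_) (hr j)
        rw [← h]; exact (hmem _).2 ⟨1, D.one_mem, rfl⟩
      · intro d hd h
        simp only [Fin.cons_zero, Fin.cons_succ] at h
        exact absurd ((hmem _).2 ⟨d, hd, h.symm⟩) (hr i)
      · intro d hd h
        simp only [Fin.cons_succ] at h
        rw [h2 i j d hd h]
    · intro f hf
      rw [← Finset.sum_sdiff hOS, h3 f hf, hO, Finset.sum_image fun a _ b _ h => hinj h,
        Finset.sum_congr rfl fun (d : D) _ => hf d d.2 v₀, Finset.sum_const, smul_eq_mul,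
        Finset.card_univ, ← mul_add, Fin.sum_univ_succ]
      simp only [Fin.cons_zero, Fin.cons_succ]
      rw [add_comm]

end OrbitCounts

end

/-! ### Nonexistence of the 6 × 6 orbit matrix. -/

/-- The number of true entries among five. -/
def weightFive (a b c d e : Bool) : ℕ := a.toNat + b.toNat + c.toNat + d.toNat + e.toNat

/-- The indicator of an equality. -/
def eqInd (m n : ℕ) : ℕ := if m = n then 1 else 0

set_option synthInstance.maxSize 2000 in
set_option synthInstance.maxHeartbeats 400000 in
/-- Symmetric idempotent matrices of size six over the field with two elements, with zero diagonal:
the number of rows of weight two is even, or there are enough rows of weight at most two. -/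
theorem six_idempotent_bool :
    ∀ a b c d e : Bool, (a ^^ b ^^ c ^^ d ^^ e) = false →
    ∀ f g h i : Bool, (a ^^ f ^^ g ^^ h ^^ i) = false →
    ((b && f) ^^ (c && g) ^^ (d && h) ^^ (e && i) ^^ a) = false →
    ∀ j k l : Bool, (b ^^ f ^^ j ^^ k ^^ l) = false →
    ((a && f) ^^ (c && j) ^^ (d && k) ^^ (e && l) ^^ b) = false →
    ((a && b) ^^ (g && j) ^^ (h && k) ^^ (i && l) ^^ f) = false →
    ∀ m n : Bool, (c ^^ g ^^ j ^^ m ^^ n) = false →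
    ((a && g) ^^ (b && j) ^^ (d && m) ^^ (e && n) ^^ c) = false →
    ((a && c) ^^ (f && j) ^^ (h && m) ^^ (i && n) ^^ g) = false →
    ((b && c) ^^ (f && g) ^^ (k && m) ^^ (l && n) ^^ j) = false →
    ∀ o : Bool, (d ^^ h ^^ k ^^ m ^^ o) = false →
    ((a && h) ^^ (b && k) ^^ (c && m) ^^ (e && o) ^^ d) = false →
    ((a && d) ^^ (f && k) ^^ (g && m) ^^ (i && o) ^^ h) = false →
    ((b && d) ^^ (f && h) ^^ (j && m) ^^ (l && o) ^^ k) = false →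
    ((c && d) ^^ (g && h) ^^ (j && k) ^^ (n && o) ^^ m) = false →
    (e ^^ i ^^ l ^^ n ^^ o) = false →
    ((a && i) ^^ (b && l) ^^ (c && n) ^^ (d && o) ^^ e) = false →
    ((a && e) ^^ (f && l) ^^ (g && n) ^^ (h && o) ^^ i) = false →
    ((b && e) ^^ (f && i) ^^ (j && n) ^^ (k && o) ^^ l) = false →
    ((c && e) ^^ (g && i) ^^ (j && l) ^^ (m && o) ^^ n) = false →
    ((d && e) ^^ (h && i) ^^ (k && l) ^^ (m && n) ^^ o) = false →
    (4 ≤ 2 * (eqInd (weightFive a b c d e) 0 + eqInd (weightFive a f g h i) 0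
       + eqInd (weightFive b f j k l) 0 + eqInd (weightFive c g j m n) 0
       + eqInd (weightFive d h k m o) 0 + eqInd (weightFive e i l n o) 0) +
      eqInd (weightFive a b c d e) 2 + eqInd (weightFive a f g h i) 2
       + eqInd (weightFive b f j k l) 2 + eqInd (weightFive c g j m n) 2
       + eqInd (weightFive d h k m o) 2 + eqInd (weightFive e i l n o) 2 ∨
      (eqInd (weightFive a b c d e) 2 + eqInd (weightFive a f g h i) 2
       + eqInd (weightFive b f j k l) 2 + eqInd (weightFive c g j m n) 2
       + eqInd (weightFive d h k m o) 2 + eqInd (weightFive e i l n o) 2) % 2 = 0) := by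
  -- Each constraint is stated as soon as its entries are quantified, which lets the enumeration
  -- prune early.
  decide +kernel

section

open scoped Classical

section SixMatrix

theorem bodd_toNat_eq_sq_mod_four (n : ℕ) : (n * n) % 4 = n.bodd.toNat := by
  have h := Nat.bodd_add_div2 n
  cases hb : n.bodd
  · rw [hb] at h
    simp only [Bool.toNat_false, zero_add] at h
    rw [← h, Bool.toNat_false, show 2 * n.div2 * (2 * n.div2) = 4 * (n.div2 * n.div2) by ring]
    omega
  · rw [hb] at h
    simp only [Bool.toNat_true] at h
    rw [← h, Bool.toNat_true, show (1 + 2 * n.div2) * (1 + 2 * n.div2) =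
      4 * (n.div2 * n.div2 + n.div2) + 1 by ring]
    omega

/-- The argument of `trace_mod_seven` again: off the all-ones vector the eigenvalues of E are 3 and
−4, equal mod 7, and E + 4I + 2J also kills that vector because 12 + 4 + 12 = 28. -/
theorem six_trace_mod_seven (E : Fin 6 → Fin 6 → ℕ) (hsym : ∀ i j, E i j = E j i)
    (hrow : ∀ i, ∑ k, E i k = 12)
    (hsq : ∀ i j, ∑ k, E i k * E j k + E i j = 24 + 12 * if i = j then 1 else 0) :
    (∑ i, E i i) % 7 = 6 := by
  let M : Matrix (Fin 6) (Fin 6) (ZMod 7) := Matrix.of fun i j => (E i j : ZMod 7)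
  let N : Matrix (Fin 6) (Fin 6) (ZMod 7) :=
    M + (4 : ZMod 7) • 1 + (2 : ZMod 7) • onesMat (Fin 6) (ZMod 7)
  have h1 : M * M = (12 : ZMod 7) • 1 - M + (24 : ZMod 7) • onesMat (Fin 6) (ZMod 7) := by
    ext i j
    have := congrArg (fun n : ℕ => (n : ZMod 7)) (hsq i j)
    simp only [Nat.cast_add, Nat.cast_sum, Nat.cast_mul] at this
    rw [Matrix.mul_apply]
    simp only [M, Matrix.of_apply, Matrix.add_apply, Matrix.sub_apply, Matrix.smul_apply,
      Matrix.one_apply, onesMat]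
    rw [Finset.sum_congr rfl fun k _ => by rw [hsym k j]]
    rw [eq_sub_of_add_eq this]
    push_cast
    simp only [smul_eq_mul]; ring
  have h2 : M * onesMat (Fin 6) (ZMod 7) = (12 : ZMod 7) • onesMat (Fin 6) (ZMod 7) := by
    ext i j
    have := congrArg (fun n : ℕ => (n : ZMod 7)) (hrow i)
    rw [Nat.cast_sum] at this
    rw [Matrix.mul_apply]
    simpa [M, onesMat] using this
  have h3 : onesMat (Fin 6) (ZMod 7) * M = (12 : ZMod 7) • onesMat (Fin 6) (ZMod 7) := by
    ext i j
    have := congrArg (fun n : ℕ => (n : ZMod 7)) (hrow j)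
    rw [Nat.cast_sum] at this
    rw [Matrix.mul_apply]
    simp only [M, onesMat, Matrix.of_apply, one_mul, hsym _ j]
    simpa using this
  have h4 : onesMat (Fin 6) (ZMod 7) * onesMat (Fin 6) (ZMod 7) =
      (6 : ZMod 7) • onesMat (Fin 6) (ZMod 7) := by
    ext i j
    rw [Matrix.mul_apply]
    simp [onesMat]
  have h7 : (7 : ZMod 7) = 0 := by decide
  have hN : N * N = 0 := by
    simp only [N, add_mul, mul_add, smul_mul_assoc, mul_smul_comm, one_mul, mul_one, h1, h2, h3, h4]
    ext i j
    simp only [Matrix.add_apply, Matrix.smul_apply, Matrix.sub_apply, smul_eq_mul,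
      Matrix.zero_apply]
    linear_combination (M i j + 4 * (1 : Matrix (Fin 6) (Fin 6) (ZMod 7)) i j +
      16 * onesMat (Fin 6) (ZMod 7) i j) * h7
  have : Fact (Nat.Prime 7) := ⟨by norm_num⟩
  have htr := (Matrix.isNilpotent_trace_of_isNilpotent ⟨2, by rw [pow_two, hN]⟩ :
    IsNilpotent N.trace).eq_zero
  have h5 : (((∑ i, E i i) + 36 : ℕ) : ZMod 7) = 0 := by
    rw [← htr]
    simp only [N, M, Matrix.trace, Matrix.diag, onesMat, Matrix.add_apply, Matrix.smul_apply,
      Matrix.of_apply, Matrix.one_apply_eq, Finset.sum_add_distrib, Nat.cast_add, Nat.cast_sum,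
      Finset.sum_const, Finset.card_univ, Fintype.card_fin]
    simp only [smul_eq_mul, mul_one, nsmul_eq_mul]
    push_cast; ring
  rw [ZMod.natCast_eq_zero_iff] at h5
  omega

/-- There is no quotient matrix of the required shape of size six. -/
theorem no_six_matrix (E : Fin 6 → Fin 6 → ℕ) (hsym : ∀ i j, E i j = E j i)
    (hrow : ∀ i, ∑ k, E i k = 12)
    (hsq : ∀ i j, ∑ k, E i k * E j k + E i j = 24 + 12 * if i = j then 1 else 0)
    (heven : ∀ i, E i i % 2 = 0) (htr : 6 ∣ ∑ i, E i i) : False := by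
  have h7 := six_trace_mod_seven E hsym hrow hsq
  have hd4 : ∀ i, E i i ≤ 4 := by
    intro i
    have h := hsq i i
    have h2 := Finset.single_le_sum (f := fun k => E i k * E i k) (fun k _ => Nat.zero_le _)
      (Finset.mem_univ i)
    simp only [if_true] at h h2
    have h3 := heven i
    by_contra h4
    have : 6 ≤ E i i := by omega
    have : 6 * 6 ≤ E i i * E i i := Nat.mul_le_mul this this
    omega
  -- The trace is at most 24, divisible by 6, and 6 mod 7.
  have hsum : ∑ i, E i i = 6 := by
    have : ∑ i, E i i ≤ ∑ _i : Fin 6, 4 := Finset.sum_le_sum fun i _ => hd4 i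
    simp only [Finset.sum_const, Finset.card_univ, Fintype.card_fin, smul_eq_mul] at this
    omega
  have hb0 : ∀ i, (E i i).bodd = false := by
    intro i
    have := heven i
    rw [Nat.mod_two_of_bodd] at this
    cases h : (E i i).bodd
    · rfl
    · rw [h] at this; simp at this
  -- Squares mod 4 detect oddness, so the number of odd entries in a row is 36 − E i i mod 4, which
  -- is E i i mod 4 because E i i is even.
  have hdeg : ∀ i, (∑ k, (E i k).bodd.toNat) % 4 = E i i % 4 := by
    intro i
    have h1 : ∀ k, (E i k).bodd.toNat = (E i k * E i k) % 4 := fun k =>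
      (bodd_toNat_eq_sq_mod_four _).symm
    rw [Finset.sum_congr rfl fun k _ => h1 k, ← Finset.sum_nat_mod]
    have h2 := hsq i i
    simp only [if_true] at h2
    have h3 := heven i
    omega
  -- If E i i = 0 and the row is 2m, then ∑ m² = 9 and ∑ m = 6, although ∑ (m² + m) must be even.
  have hdeg0 : ∀ i, (∑ k, (E i k).bodd.toNat) = 0 → 4 ≤ E i i := by
    intro i h
    have h1 := hdeg i
    rw [h] at h1
    by_contra h2
    have h3 : E i i = 0 := by omega
    rw [Finset.sum_eq_zero_iff] at h
    have h4 : ∀ k, ∃ m, E i k = 2 * m := by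
      intro k
      have h5 := h k (Finset.mem_univ k)
      have h6 := Nat.bodd_add_div2 (E i k)
      rw [h5, zero_add] at h6
      exact ⟨_, h6.symm⟩
    choose m hm using h4
    have h5 := hrow i
    have h6 := hsq i i
    rw [h3] at h6
    simp only [hm, if_true] at h5 h6
    have h7 : ∀ k, 2 * m k * (2 * m k) = 4 * (m k * m k) := fun k => by ring
    simp only [h7, ← Finset.mul_sum] at h5 h6
    have h8 : ∑ k, m k * m k = 9 := by omega
    have h9 : ∑ k, m k = 6 := by omega
    have h10 : Even (∑ k, (m k * m k + m k)) :=
      Finset.even_sum _ fun k _ => by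
        rw [show m k * m k + m k = m k * (m k + 1) by ring]; exact Nat.even_mul_succ_self _
    rw [Finset.sum_add_distrib, h8, h9] at h10
    exact absurd h10 (by decide)
  -- Modulo 2 the matrix E is symmetric and idempotent with zero diagonal.
  have hB : ∀ i j, (∑ k, E i k * E j k + E i j).bodd = false := by
    intro i j
    rw [hsq]; split_ifs <;> rfl
  simp only [Fin.sum_univ_six, Nat.bodd_add, Nat.bodd_mul] at hB
  simp only [Fin.sum_univ_six] at hdeg hdeg0 hsum
  have p00 := hB 0 0
  have p11 := hB 1 1
  have p01 := hB 0 1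
  have p22 := hB 2 2
  have p02 := hB 0 2
  have p12 := hB 1 2
  have p33 := hB 3 3
  have p03 := hB 0 3
  have p13 := hB 1 3
  have p23 := hB 2 3
  have p44 := hB 4 4
  have p04 := hB 0 4
  have p14 := hB 1 4
  have p24 := hB 2 4
  have p34 := hB 3 4
  have p55 := hB 5 5
  have p05 := hB 0 5
  have p15 := hB 1 5
  have p25 := hB 2 5
  have p35 := hB 3 5
  have p45 := hB 4 5
  simp only [hsym 1 0, hsym 2 0, hsym 3 0, hsym 4 0, hsym 5 0, hsym 2 1, hsym 3 1, hsym 4 1, hsym 5 1, hsym 3 2, hsym 4 2, hsym 5 2, hsym 4 3, hsym 5 3, hsym 5 4, hb0, Bool.false_and, Bool.and_false, Bool.xor_false,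
    Bool.false_xor, Bool.and_self] at p00 p11 p01 p22 p02 p12 p33 p03 p13 p23 p44 p04 p14 p24 p34 p55 p05 p15 p25 p35 p45
  have key := six_idempotent_bool _ _ _ _ _ p00 _ _ _ _ p11 p01 _ _ _ p22 p02 p12 _ _ p33 p03 p13 p23 _ p44 p04 p14 p24 p34 p55 p05 p15 p25 p35 p45
  have hw : ∀ i w, (E i 0).bodd.toNat + (E i 1).bodd.toNat + (E i 2).bodd.toNat +
      (E i 3).bodd.toNat + (E i 4).bodd.toNat + (E i 5).bodd.toNat = w → w ≤ 5 →
      ∃ m, E i i = 4 * m + 2 * eqInd w 2 ∧ eqInd w 0 ≤ m := by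
    intro i w h h5
    have h1 := hdeg i
    have h2 := hdeg0 i
    have h3 := heven i
    rw [h] at h1 h2
    refine ⟨E i i / 4, ?_, ?_⟩ <;> unfold eqInd <;> split_ifs <;> omega
  have hw5 : ∀ a b c d e : Bool, weightFive a b c d e ≤ 5 := by
    intro a b c d e
    have := fun x : Bool => x.toNat_le
    have h1 := this a; have h2 := this b; have h3 := this c; have h4 := this d; have h5 := this e
    unfold weightFive; omega
  obtain ⟨m0, w0, v0⟩ := hw 0 (weightFive (E 0 1).bodd (E 0 2).bodd (E 0 3).bodd (E 0 4).bodd (E 0 5).bodd)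
    (by simp only [hb0, weightFive, Bool.toNat_false]; omega) (hw5 _ _ _ _ _)
  obtain ⟨m1, w1, v1⟩ := hw 1 (weightFive (E 0 1).bodd (E 1 2).bodd (E 1 3).bodd (E 1 4).bodd (E 1 5).bodd)
    (by simp only [hsym 1 0, hb0, weightFive, Bool.toNat_false]; omega) (hw5 _ _ _ _ _)
  obtain ⟨m2, w2, v2⟩ := hw 2 (weightFive (E 0 2).bodd (E 1 2).bodd (E 2 3).bodd (E 2 4).bodd (E 2 5).bodd)
    (by simp only [hsym 2 0, hsym 2 1, hb0, weightFive, Bool.toNat_false]; omega) (hw5 _ _ _ _ _)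
  obtain ⟨m3, w3, v3⟩ := hw 3 (weightFive (E 0 3).bodd (E 1 3).bodd (E 2 3).bodd (E 3 4).bodd (E 3 5).bodd)
    (by simp only [hsym 3 0, hsym 3 1, hsym 3 2, hb0, weightFive, Bool.toNat_false]; omega) (hw5 _ _ _ _ _)
  obtain ⟨m4, w4, v4⟩ := hw 4 (weightFive (E 0 4).bodd (E 1 4).bodd (E 2 4).bodd (E 3 4).bodd (E 4 5).bodd)
    (by simp only [hsym 4 0, hsym 4 1, hsym 4 2, hsym 4 3, hb0, weightFive, Bool.toNat_false]; omega) (hw5 _ _ _ _ _)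
  obtain ⟨m5, w5, v5⟩ := hw 5 (weightFive (E 0 5).bodd (E 1 5).bodd (E 2 5).bodd (E 3 5).bodd (E 4 5).bodd)
    (by simp only [hsym 5 0, hsym 5 1, hsym 5 2, hsym 5 3, hsym 5 4, hb0, weightFive, Bool.toNat_false]; omega) (hw5 _ _ _ _ _)
  rw [w0, w1, w2, w3, w4, w5] at hsum
  clear w0 w1 w2 w3 w4 w5
  -- The trace 6 is 4 ∑ m plus twice the number of rows of weight 2, and each zero row contributes
  -- at least 4. The first alternative makes the trace at least 8, the second makes it divisible by
  -- 4.
  rcases key with key | key <;> omega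

end SixMatrix

end

section

open scoped Classical

theorem Finset.card_modEq_zero_of_forall_ne {X : Type*} (p n : ℕ) [Fact p.Prime] (f : X → X)
    (B : Finset X) (hB : ∀ v ∈ B, f v ∈ B) (hf : ∀ v ∈ B, f^[p ^ n] v = v)
    (h : ∀ v ∈ B, f v ≠ v) : B.card ≡ 0 [MOD p] := by
  have h1 := Finset.card_modEq_card_filter_fixed p n f B hB hf
  rwa [Finset.filter_false_of_mem h, Finset.card_empty] at h1

/-! ### No automorphism of order 14. -/

section OrderFourteen

variable {V : Type*} [Fintype V] {Γ : SimpleGraph V}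

namespace IsConway99

variable (hΓ : IsConway99 Γ)

include hΓ

theorem seven_card_fixedSet {z : Γ ≃g Γ} (hz : z ^ 7 = 1) (hz1 : z ≠ 1) :
    (fixedSet z).card = 1 := by
  have : Fact (Nat.Prime 7) := ⟨by norm_num⟩
  have h1 := hΓ.card_fixedSet_modEq (p := 7) (n := 1) (by rwa [pow_one])
  rcases hΓ.odd_cases (by decide) hz hz1 with h | h | h
  · rw [h] at h1; exact absurd h1 (by decide)
  · exact h
  · rw [h.1] at h1; exact absurd h1 (by decide)

/-- A nontrivial automorphism of order dividing `14` has at most one fixed vertex. -/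
theorem fixed_unique_of_pow_fourteen {d : Γ ≃g Γ} (hd : d ^ 14 = 1) (hd1 : d ≠ 1) {x v : V}
    (hx : d x = x) (hv : d v = v) : v = x := by
  by_cases h7 : d ^ 7 = 1
  · have h := hΓ.seven_card_fixedSet h7 hd1
    exact Finset.card_le_one.1 h.le v (mem_fixedSet.2 hv) x (mem_fixedSet.2 hx)
  · obtain ⟨y, hy⟩ := hΓ.exists_isReflection (t := d ^ 7) (by rw [← pow_add, hd]) h7
    rw [(hy.fix v).1 (aut_pow_fixed hv 7), (hy.fix x).1 (aut_pow_fixed hx 7)]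

omit hΓ in
theorem nbrs_invariant {d : Γ ≃g Γ} {x : V} (hx : d x = x) {v : V} :
    Γ.Adj x (d v) ↔ Γ.Adj x v := by
  conv_lhs => rw [← hx]
  exact aut_adj d

/-- If `d` fixes `x` and moves a neighbour `v` of `x` to a neighbour of `v`, then `d ^ 2` fixes
`v`. -/
theorem sq_fixed_of_moved_nbr {d : Γ ≃g Γ} {x v : V} (hx : d x = x) (hv : Γ.Adj x v)
    (h : Γ.Adj v (d v)) : d (d v) = v :=
  hΓ.common_unique ((nbrs_invariant hx).2 hv)
    ((nbrs_invariant hx).2 ((nbrs_invariant hx).2 hv)) ((aut_adj d).2 h) hv h.symm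

theorem card_far (x : V) : (Finset.univ.filter fun v => v ≠ x ∧ ¬ Γ.Adj x v).card = 84 := by
  have h1 : Finset.univ.filter (fun v => v ≠ x ∧ ¬ Γ.Adj x v) =
      (insert x (nbrs Γ x))ᶜ := by
    ext v; simp
  rw [h1, Finset.card_compl, hΓ.card, Finset.card_insert_of_notMem (by simp), hΓ.card_nbrs]

/-- The product u = z t generates a cyclic group D of order 14 fixing x and acting freely elsewhere:
the neighbours of x form one orbit, the other 84 vertices six. A far vertex has two neighbours
adjacent to x, so the 6 × 6 orbit matrix E has row sums 12 and E² + E = 12I + 24J. Inversion in D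
makes its diagonal even, rationality makes its trace divisible by 6, and `no_six_matrix` applies. -/
theorem no_order_fourteen {t z : Γ ≃g Γ} {x : V} (ht : IsReflection t x) (hz : z ^ 7 = 1)
    (hz1 : z ≠ 1) (hzt : z * t = t * z) : False := by
  have hzx : z x = x := fixed_of_reflection_commute ht hzt
  have hc : Commute z t := hzt
  obtain ⟨u, hu⟩ : ∃ u, u = z * t := ⟨_, rfl⟩
  have ht2 : t ^ 2 = 1 := by rw [pow_two, ht.sq]
  have hu14 : u ^ 14 = 1 := by
    rw [hu, hc.mul_pow, show 14 = 7 * 2 from rfl, pow_mul z, hz, one_pow, mul_comm, pow_mul t, ht2,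
      one_pow, one_mul]
  have hu7 : u ^ 7 = t := by
    rw [hu, hc.mul_pow, hz, one_mul, show 7 = 2 * 3 + 1 from rfl, pow_succ, pow_mul, ht2, one_pow,
      one_mul]
  have hux : u x = x := by rw [hu, aut_mul_apply, ht.apply_self, hzx]
  have htne : t ≠ 1 := IsReflection.ne_one hΓ ht
  have hz2 : z ^ 2 ≠ 1 := by
    intro h
    apply hz1
    rw [← hz, show 7 = 2 * 3 + 1 from rfl, pow_succ, pow_mul, h, one_pow, one_mul]
  have hord : orderOf u = 14 := by
    refine orderOf_eq_of_pow_and_pow_div_prime (by norm_num) hu14 fun p hp hp14 => ?_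
    have : p ∈ Nat.primeFactors 14 := by
      rw [Nat.mem_primeFactors]; exact ⟨hp, hp14, by norm_num⟩
    rw [show (14 : ℕ) = 2 * 7 from rfl, Nat.primeFactors_mul (by norm_num) (by norm_num),
      Nat.Prime.primeFactors (by norm_num), Nat.Prime.primeFactors (by norm_num)] at this
    simp only [Finset.mem_union, Finset.mem_singleton] at this
    rcases this with rfl | rfl
    · rw [show 14 / 2 = 7 from rfl, hu7]; exact htne
    · rw [show 14 / 7 = 2 from rfl, hu, hc.mul_pow, ht2, mul_one]; exact hz2
  set D := Subgroup.zpowers u with hD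
  have hDc : Fintype.card D = 14 := by
    rw [← Nat.card_eq_fintype_card, hD, Nat.card_zpowers, hord]
  have hDpow : ∀ d ∈ D, ∃ k : ℕ, d = u ^ k := by
    intro d hd
    rw [hD, mem_zpowers_iff_mem_range_orderOf] at hd
    obtain ⟨k, -, hk⟩ := Finset.mem_image.1 hd
    exact ⟨k, hk.symm⟩
  have hD14 : ∀ d ∈ D, d ^ 14 = 1 := by
    intro d hd
    obtain ⟨k, rfl⟩ := hDpow d hd
    rw [← pow_mul, mul_comm, pow_mul, hu14, one_pow]
  have hDx : ∀ d ∈ D, d x = x := by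
    intro d hd
    obtain ⟨k, rfl⟩ := hDpow d hd
    exact aut_pow_fixed hux k
  have hfree : ∀ d ∈ D, ∀ v, v ≠ x → d v = v → d = 1 := by
    intro d hd v hv hdv
    by_contra h1
    exact hv (hΓ.fixed_unique_of_pow_fourteen (hD14 d hd) h1 (hDx d hd) hdv)
  set F := Finset.univ.filter (fun v => v ≠ x ∧ ¬ Γ.Adj x v) with hF
  have hFmem : ∀ v, v ∈ F ↔ v ≠ x ∧ ¬ Γ.Adj x v := by intro v; simp [hF]
  have hNinv : ∀ d ∈ D, ∀ v ∈ nbrs Γ x, d v ∈ nbrs Γ x := by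
    intro d hd v hv
    rw [mem_nbrs] at hv ⊢
    exact (nbrs_invariant (hDx d hd)).2 hv
  have hFinv : ∀ d ∈ D, ∀ v ∈ F, d v ∈ F := by
    intro d hd v hv
    rw [hFmem] at hv ⊢
    refine ⟨fun h => hv.1 (d.injective (h.trans (hDx d hd).symm)), fun h => hv.2 ?_⟩
    exact (nbrs_invariant (hDx d hd)).1 h
  obtain ⟨a, ha, -, haf⟩ := exists_orbit_representatives D 1 (nbrs Γ x) hNinv
    (fun d hd v hv => hfree d hd v (mem_nbrs.1 hv).ne') (by rw [hΓ.card_nbrs, hDc])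
  obtain ⟨r, hr, hrd, hrf⟩ := exists_orbit_representatives D 6 F hFinv
    (fun d hd v hv => hfree d hd v ((hFmem v).1 hv).1) (by rw [hF, hΓ.card_far, hDc])
  rw [hDc] at haf hrf
  have hsplit : ∀ f : V → ℕ, ∑ v, f v = f x + ∑ v ∈ nbrs Γ x, f v + ∑ v ∈ F, f v := by
    intro f
    have h1 : (Finset.univ : Finset V) = insert x (nbrs Γ x) ∪ F := by
      ext v
      simp only [Finset.mem_univ, Finset.mem_union, Finset.mem_insert, mem_nbrs, hFmem, true_iff]
      tauto
    rw [h1, Finset.sum_union, Finset.sum_insert (by simp)]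
    rw [Finset.disjoint_left]
    intro v hv
    rw [Finset.mem_insert, mem_nbrs] at hv
    rw [hFmem]
    tauto
  have hx0 : ∀ v ∈ F, orbitAdj D v x = 0 := by
    intro v hv
    rw [orbitAdj, Finset.card_eq_zero, Finset.filter_eq_empty_iff]
    intro d _ h
    rw [hDx d d.2] at h
    exact ((hFmem v).1 hv).2 h.symm
  have ha2 : ∀ v ∈ F, orbitAdj D v (a 0) = 2 := by
    intro v hv
    have h1 := haf (orbitAdj D v) (fun d hd w => orbitAdj_apply_right D v w hd)
    rw [sum_orbitAdj_filter D _ hNinv, hDc, Fin.sum_univ_one] at h1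
    have h2 : ((nbrs Γ v).filter (· ∈ nbrs Γ x)).card = 2 := by
      rw [← hΓ.nonadj v x ((hFmem v).1 hv).1 fun h => ((hFmem v).1 hv).2 h.symm]
      congr 1; ext w; simp
    rw [h2] at h1
    omega
  have hrow : ∀ i, ∑ k, orbitAdj D (r i) (r k) = 12 := by
    intro i
    have h1 := hΓ.sum_orbitAdj D (r i)
    rw [hsplit, haf _ fun d hd w => orbitAdj_apply_right D _ w hd,
      hrf _ fun d hd w => orbitAdj_apply_right D _ w hd, Fin.sum_univ_one, hx0 _ (hr i),
      ha2 _ (hr i), hDc] at h1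
    omega
  have hsq : ∀ i j, ∑ k, orbitAdj D (r i) (r k) * orbitAdj D (r j) (r k) +
      orbitAdj D (r i) (r j) = 24 + 12 * if i = j then 1 else 0 := by
    intro i j
    have h1 := hΓ.sum_orbitAdj_mul D (r i) (r j)
    have hinv : ∀ d ∈ D, ∀ v, orbitAdj D (r i) (d v) * orbitAdj D (r j) (d v) =
        orbitAdj D (r i) v * orbitAdj D (r j) v := by
      intro d hd v
      rw [orbitAdj_apply_right D _ v hd, orbitAdj_apply_right D _ v hd]
    rw [hsplit, haf _ hinv, hrf _ hinv, Fin.sum_univ_one, hx0 _ (hr i),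
      ha2 _ (hr i), ha2 _ (hr j), hDc] at h1
    have h2 : orbitEq D (r i) (r j) = if i = j then 1 else 0 := by
      rw [orbitEq]
      split_ifs with hij
      · subst hij
        rw [Finset.card_eq_one]
        refine ⟨1, ?_⟩
        ext d
        rw [Finset.mem_filter, Finset.mem_singleton]
        constructor
        · rintro ⟨-, h⟩
          exact Subtype.ext (hfree d d.2 (r i) ((hFmem _).1 (hr i)).1 h.symm)
        · rintro rfl
          exact ⟨Finset.mem_univ _, rfl⟩
      · rw [Finset.card_eq_zero, Finset.filter_eq_empty_iff]
        intro d _ h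
        exact hij (hrd i j d d.2 h)
    rw [h2] at h1
    omega
  -- An involution in D is a reflection at x, which sends only neighbours of x to neighbours.
  have hFt : ∀ d ∈ D, d * d = 1 → ∀ v ∈ F, ¬ Γ.Adj v (d v) := by
    intro d hd hdd v hv hadj
    have hd1 : d ≠ 1 := by
      rintro rfl; exact hadj.ne rfl
    obtain ⟨y, hy⟩ := hΓ.exists_isReflection hdd hd1
    have hyx : x = y := (hy.fix x).1 (hDx d hd)
    rw [hy.moved, ← hyx] at hadj
    exact ((hFmem v).1 hv).2 hadj
  have heven : ∀ i, orbitAdj D (r i) (r i) % 2 = 0 := by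
    intro i
    refine Finset.card_modEq_zero_of_forall_ne 2 1 (fun d : D => d⁻¹)
      (Finset.univ.filter fun d : D => Γ.Adj (r i) ((d : Γ ≃g Γ) (r i))) ?_ ?_ ?_
    · intro d hd
      rw [Finset.mem_filter] at hd ⊢
      refine ⟨Finset.mem_univ _, ?_⟩
      rw [InvMemClass.coe_inv, aut_adj_inv, inv_inv]
      exact hd.2.symm
    · intro d _; simp
    · intro d hd hdi
      rw [Finset.mem_filter] at hd
      exact hFt d d.2 (congrArg Subtype.val (mul_eq_one_iff_eq_inv.2 hdi.symm)) (r i) (hr i) hd.2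
  -- the number of orbits in which an element moves the vertices to neighbours
  set m : (Γ ≃g Γ) → ℕ := fun d => ∑ i, if Γ.Adj (r i) (d (r i)) then 1 else 0 with hm
  have hm6 : ∀ d, m d ≤ 6 := by
    intro d
    have : m d ≤ ∑ _i : Fin 6, 1 := Finset.sum_le_sum fun i _ => by split_ifs <;> simp
    simpa using this
  have hmsq : ∀ d ∈ D, d * d = 1 → m d = 0 := by
    intro d hd hdd
    refine Finset.sum_eq_zero fun i _ => ?_
    rw [if_neg (hFt d hd hdd _ (hr i))]
  have hmoved : ∀ d ∈ D, d * d ≠ 1 → (movedToNbr d).card = 14 * m d := by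
    intro d hd hdd
    rw [hm, ← hrf (fun v => if Γ.Adj v (d v) then 1 else 0)]
    · rw [movedToNbr, Finset.card_filter, hsplit, if_neg (by rw [hDx d hd]; exact Γ.irrefl),
        Finset.sum_eq_zero, zero_add, zero_add]
      intro v hv
      rw [if_neg]
      intro h
      rw [mem_nbrs] at hv
      have h2 := hΓ.sq_fixed_of_moved_nbr (hDx d hd) hv h
      exact hdd (hfree _ (D.mul_mem hd hd) v hv.ne' h2)
    · intro e he v
      have h1 : d * e = e * d := by
        obtain ⟨k, rfl⟩ := hDpow d hd
        obtain ⟨l, rfl⟩ := hDpow e he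
        rw [← pow_add, ← pow_add, add_comm]
      have h2 : d (e v) = e (d v) := by rw [← aut_mul_apply, h1, aut_mul_apply]
      simp only [h2, aut_adj]
  -- Since 17 ≡ 3 mod 14, the congruence mod 17 compares d ^ 3 with d; as both values of m are at
  -- most 6, they are equal.
  have hm3 : ∀ d ∈ D, m (d ^ 3) = m d := by
    intro d hd
    by_cases hdd : d * d = 1
    · have : d ^ 3 = d := by rw [pow_succ, pow_two, hdd, one_mul]
      rw [this]
    · have hd3 : d ^ 3 ∈ D := D.pow_mem hd 3
      have hd17 : d ^ 17 = d ^ 3 := by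
        rw [show 17 = 14 + 3 from rfl, pow_add, hD14 d hd, one_mul]
      have hdd3 : d ^ 3 * d ^ 3 ≠ 1 := by
        intro h
        apply hdd
        have h1 : d * d = (d ^ 3 * d ^ 3) ^ 5 := by
          rw [← pow_add, ← pow_mul, show (3 + 3) * 5 = 14 + 14 + 2 from rfl, pow_add, pow_add,
            hD14 d hd, one_mul, one_mul, pow_two]
        rw [h1, h, one_pow]
      have hf1 : ∀ e ∈ D, e * e ≠ 1 → (fixedSet e).card = 1 := by
        intro e he hee
        rw [Finset.card_eq_one]
        refine ⟨x, ?_⟩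
        ext v
        rw [mem_fixedSet, Finset.mem_singleton]
        constructor
        · intro h
          by_contra hv
          apply hee
          rw [hfree e he v hv h, mul_one]
        · rintro rfl; exact hDx e he
      have h1 := hΓ.trace_pow_seventeen d
      rw [hd17, hmoved _ hd3 hdd3, hmoved _ hd hdd, hf1 _ hd3 hdd3, hf1 _ hd hdd] at h1
      have h2 := hm6 d
      have h3 := hm6 (d ^ 3)
      unfold Nat.ModEq at h1
      omega
  -- As 3 generates the units mod 14, the odd exponents other than 7 share one value of m, and so do
  -- the nonzero even ones, six each; exponents 0 and 7 contribute nothing.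
  have htrace : ∑ i, orbitAdj D (r i) (r i) = 6 * (m u + m (u ^ 2)) := by
    have h1 : ∑ i, orbitAdj D (r i) (r i) = ∑ d : D, m d := by
      rw [hm, Finset.sum_comm]
      exact Finset.sum_congr rfl fun i _ => orbitAdj_eq_sum D _ _
    have h2 : ∑ d : D, m d = ∑ k ∈ Finset.range 14, m (u ^ k) := by
      rw [← hord, ← Fin.sum_univ_eq_sum_range (fun k => m (u ^ k)),
        ← Equiv.sum_comp (finEquivZPowers (isOfFinOrder_of_finite u))]
      refine Finset.sum_congr rfl fun k _ => ?_
      rw [finEquivZPowers_apply]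
    have huD : ∀ k : ℕ, u ^ k ∈ D := fun k => D.pow_mem (Subgroup.mem_zpowers u) k
    have h3 : ∀ k, m (u ^ (3 * k)) = m (u ^ k) := by
      intro k
      rw [mul_comm, pow_mul, hm3 _ (huD k)]
    have h4 : ∀ k, m (u ^ (k + 14)) = m (u ^ k) := by
      intro k
      rw [pow_add, hu14, mul_one]
    have e3 := h3 1
    have e9 := h3 3
    have e13 := (h4 13).symm.trans (h3 9)
    have e11 := (h4 11).symm.trans ((h4 25).symm.trans (h3 13))
    have e5 := (h4 5).symm.trans ((h4 19).symm.trans (h3 11))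
    have e6 := h3 2
    have e4 := (h4 4).symm.trans (h3 6)
    have e12 := h3 4
    have e8 := (h4 8).symm.trans ((h4 22).symm.trans (h3 12))
    have e10 := (h4 10).symm.trans (h3 8)
    have e0 := hmsq _ (huD 0) (by rw [pow_zero, one_mul])
    have e7 := hmsq _ (huD 7) (by rw [← pow_add, hu14])
    rw [h1, h2]
    simp only [Finset.sum_range_succ, Finset.sum_range_zero]
    norm_num at e3 e9 e13 e11 e5 e6 e4 e12 e8 e10 ⊢
    simp only [pow_zero] at e0
    omega
  exact no_six_matrix (fun i j => orbitAdj D (r i) (r j)) (fun i j => orbitAdj_comm D _ _) hrow hsq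
    heven (by rw [htrace]; exact dvd_mul_right _ _)

end IsConway99

end OrderFourteen

end

section

open scoped Classical

theorem Finset.card_group_dvd_sum_card {H X : Type*} [Group H] [Fintype H] [MulAction H X]
    (B : Finset X) (hB : ∀ h : H, ∀ v ∈ B, h • v ∈ B) (F : H → Finset X)
    (hF : ∀ h v, v ∈ F h ↔ v ∈ B ∧ h • v = v) : Fintype.card H ∣ ∑ h, (F h).card := by
  have h := Finset.card_group_dvd_sum_card_fixed B hB
  convert h using 4 with a
  ext v
  rw [hF, Finset.mem_filter]

/-! ### Triangles and those fixed by an element of order 3. -/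

section Triangles

variable {V : Type*} [Fintype V] {Γ : SimpleGraph V}

/-- The triangles of a graph. -/
noncomputable def triangles (Γ : SimpleGraph V) : Finset (Finset V) :=
  Finset.univ.filter fun T => Γ.IsNClique 3 T

theorem mem_triangles {T : Finset V} : T ∈ triangles Γ ↔ Γ.IsNClique 3 T := by
  simp [triangles]

theorem adj_of_mem_triangles {T : Finset V} (hT : T ∈ triangles Γ) {v w : V} (hv : v ∈ T)
    (hw : w ∈ T) (h : v ≠ w) : Γ.Adj v w :=
  (mem_triangles.1 hT).isClique hv hw h

/-- The triangles which are mapped to themselves by an automorphism. -/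
noncomputable def fixedTriangles (g : Γ ≃g Γ) : Finset (Finset V) :=
  (triangles Γ).filter fun T => ∀ v ∈ T, g v ∈ T

theorem mem_fixedTriangles {g : Γ ≃g Γ} {T : Finset V} :
    T ∈ fixedTriangles g ↔ T ∈ triangles Γ ∧ ∀ v ∈ T, g v ∈ T := Finset.mem_filter

theorem image_mem_triangles (g : Γ ≃g Γ) {T : Finset V} (hT : T ∈ triangles Γ) :
    T.image g ∈ triangles Γ := by
  rw [mem_triangles, SimpleGraph.isNClique_iff] at hT ⊢
  refine ⟨?_, by rw [Finset.card_image_of_injective _ g.injective, hT.2]⟩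
  intro a' ha' b' hb' hab
  obtain ⟨a, ha, rfl⟩ := Finset.mem_image.1 (Finset.mem_coe.1 ha')
  obtain ⟨b, hb, rfl⟩ := Finset.mem_image.1 (Finset.mem_coe.1 hb')
  exact (aut_adj g).2 (hT.1 ha hb fun h => hab (congrArg g h))

theorem three_mul_card_triangles (S : Finset (Finset V)) (hS : S ⊆ triangles Γ) :
    3 * S.card = ∑ v, (S.filter fun T => v ∈ T).card := by
  have h := Finset.sum_card_bipartiteAbove_eq_sum_card_bipartiteBelow (s := S)
    (t := (Finset.univ : Finset V)) (fun T v => v ∈ T)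
  have h2 : ∀ T ∈ S, (Finset.univ.bipartiteAbove (fun (T : Finset V) v => v ∈ T) T).card = 3 := by
    intro T hT
    rw [← ((mem_triangles.1 (hS hT)).card_eq)]
    congr 1; ext v; simp [Finset.mem_bipartiteAbove]
  rw [Finset.sum_congr rfl h2, Finset.sum_const, smul_eq_mul, mul_comm] at h
  exact h

/-- Burnside's lemma for the vertices. -/
theorem card_dvd_sum_card_fixed_vertices (R : Subgroup (Γ ≃g Γ)) (B : Finset V)
    (hB : ∀ r ∈ R, ∀ v ∈ B, r v ∈ B) :
    Fintype.card R ∣ ∑ r : R, (B.filter fun v => (r : Γ ≃g Γ) v = v).card :=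
  Finset.card_group_dvd_sum_card_fixed B fun r v hv => hB r r.2 v hv

open scoped Pointwise in
/-- Burnside's lemma for the triangles. -/
theorem card_dvd_sum_card_fixedTriangles (R : Subgroup (Γ ≃g Γ)) :
    Fintype.card R ∣ ∑ r : R, (fixedTriangles (r : Γ ≃g Γ)).card := by
  have h0 : ∀ (r : R) (T : Finset V), r • T = T.image (r : Γ ≃g Γ) := fun r T => rfl
  refine Finset.card_group_dvd_sum_card (H := R) (triangles Γ)
    (fun r T hT => by rw [h0]; exact image_mem_triangles _ hT) _ fun r T => ?_
  rw [mem_fixedTriangles, h0]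
  refine and_congr_right fun _ => ?_
  constructor
  · intro hT
    refine Finset.eq_of_subset_of_card_le (fun v hv => ?_) ?_
    · obtain ⟨w, hw, rfl⟩ := Finset.mem_image.1 hv
      exact hT w hw
    · rw [Finset.card_image_of_injective _ (r : Γ ≃g Γ).injective]
  · intro hT v hv
    rw [← hT]; exact Finset.mem_image_of_mem _ hv

namespace IsConway99

variable (hΓ : IsConway99 Γ)

include hΓ

theorem eq_of_mem_triangles {v w u : V} (h : Γ.Adj v w) (hu : Γ.Adj v u) (hu' : Γ.Adj w u)
    {T : Finset V} (hT : T ∈ triangles Γ) (hv : v ∈ T) (hw : w ∈ T) : T = {v, w, u} := by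
  have hc := (mem_triangles.1 hT).card_eq
  obtain ⟨a, haT, ha⟩ := Finset.exists_mem_notMem_of_card_lt_card (s := {v, w}) (t := T)
    (by rw [hc]; exact (Finset.card_le_two).trans_lt (by norm_num))
  simp only [Finset.mem_insert, Finset.mem_singleton, not_or] at ha
  have hau : a = u := hΓ.common_unique h
    (adj_of_mem_triangles hT hv haT (Ne.symm ha.1)) (adj_of_mem_triangles hT hw haT (Ne.symm ha.2))
    hu hu'
  refine (Finset.eq_of_subset_of_card_le ?_ ?_).symm
  · intro b hb
    simp only [Finset.mem_insert, Finset.mem_singleton] at hb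
    rcases hb with rfl | rfl | rfl
    · exact hv
    · exact hw
    · rwa [← hau]
  · rw [hc, Finset.card_insert_of_notMem, Finset.card_pair hu'.ne]
    simp [h.ne, hu.ne]

omit hΓ in
theorem triple_mem_triangles {v w u : V} (h : Γ.Adj v w) (hu : Γ.Adj v u) (hu' : Γ.Adj w u) :
    ({v, w, u} : Finset V) ∈ triangles Γ :=
  mem_triangles.2 (SimpleGraph.is3Clique_triple_iff.2 ⟨h, hu, hu'⟩)

theorem card_triangles_through_edge {v w : V} (h : Γ.Adj v w) :
    ((triangles Γ).filter fun T => v ∈ T ∧ w ∈ T).card = 1 := by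
  obtain ⟨u, hu, hu'⟩ := hΓ.exists_common h
  rw [Finset.card_eq_one]
  refine ⟨{v, w, u}, ?_⟩
  ext T
  rw [Finset.mem_filter, Finset.mem_singleton]
  constructor
  · rintro ⟨hT, hv, hw⟩; exact hΓ.eq_of_mem_triangles h hu hu' hT hv hw
  · rintro rfl; exact ⟨triple_mem_triangles h hu hu', by simp, by simp⟩

theorem card_triangles_through_vertex (v : V) :
    ((triangles Γ).filter fun T => v ∈ T).card = 7 := by
  have h := Finset.sum_card_bipartiteAbove_eq_sum_card_bipartiteBelow
    (s := (triangles Γ).filter fun T => v ∈ T) (t := nbrs Γ v) (fun T w => w ∈ T)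
  have h2 : ∀ T ∈ (triangles Γ).filter (fun T => v ∈ T),
      ((nbrs Γ v).bipartiteAbove (fun (T : Finset V) v => v ∈ T) T).card = 2 := by
    intro T hT
    rw [Finset.mem_filter] at hT
    have : (nbrs Γ v).bipartiteAbove (fun (T : Finset V) v => v ∈ T) T = T.erase v := by
      ext w
      rw [Finset.mem_bipartiteAbove, Finset.mem_erase, mem_nbrs]
      exact ⟨fun h => ⟨h.1.ne', h.2⟩,
        fun h => ⟨adj_of_mem_triangles hT.1 hT.2 h.2 (Ne.symm h.1), h.2⟩⟩
    rw [this, Finset.card_erase_of_mem hT.2, (mem_triangles.1 hT.1).card_eq]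
  have h3 : ∀ w ∈ nbrs Γ v, (((triangles Γ).filter fun T => v ∈ T).bipartiteBelow
      (fun (T : Finset V) v => v ∈ T) w).card = 1 := by
    intro w hw
    rw [Finset.bipartiteBelow, Finset.filter_filter]
    exact hΓ.card_triangles_through_edge (mem_nbrs.1 hw)
  rw [Finset.sum_congr rfl h2, Finset.sum_congr rfl h3, Finset.sum_const, Finset.sum_const,
    hΓ.card_nbrs] at h
  simp only [smul_eq_mul] at h
  omega

theorem card_triangles : (triangles Γ).card = 231 := by
  have h := three_mul_card_triangles (triangles Γ) subset_rfl
  rw [Finset.sum_congr rfl fun v _ => hΓ.card_triangles_through_vertex v, Finset.sum_const,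
    Finset.card_univ, hΓ.card] at h
  simp only [smul_eq_mul] at h
  omega

theorem card_fixedTriangles_one : (fixedTriangles (1 : Γ ≃g Γ)).card = 231 := by
  rw [← hΓ.card_triangles, fixedTriangles, Finset.filter_true_of_mem]
  intro T _ v hv; exact hv

/-- The fixed vertices of an automorphism of order `3` are either none or the vertices of a
triangle. -/
theorem three_pow_cases {n : ℕ} {g : Γ ≃g Γ} (hg : g ^ 3 ^ n = 1) (h1 : g ≠ 1) :
    (fixedSet g).card = 0 ∨ ((fixedSet g).card = 3 ∧ (movedToNbr g).card ≤ 60 ∧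
      ∀ x, g x = x → (fixNbrs g x).card = 2) := by
  have : Fact (Nat.Prime 3) := ⟨by norm_num⟩
  have h := hΓ.card_fixedSet_modEq hg
  rcases hΓ.odd_cases (Odd.pow (by decide)) hg h1 with h0 | h0 | h0
  · exact Or.inl h0
  · rw [h0] at h; exact absurd h (by decide)
  · exact Or.inr h0

/-- Whenever there is a fixed vertex, there are three, each with two fixed neighbours, so they form
a triangle. -/
theorem eq_or_adj_of_fixed {n : ℕ} {g : Γ ≃g Γ} (hg : g ^ 3 ^ n = 1) (h1 : g ≠ 1) {v w : V}
    (hv : g v = v) (hw : g w = w) : w = v ∨ Γ.Adj v w := by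
  rcases hΓ.three_pow_cases hg h1 with h | ⟨h, -, h2⟩
  · exact absurd hv (hΓ.ne_of_fixedSet_card_zero h v)
  have h3 : insert v (fixNbrs g v) = fixedSet g := by
    refine Finset.eq_of_subset_of_card_le (fun a ha => ?_) ?_
    · rw [Finset.mem_insert, mem_fixNbrs] at ha
      rw [mem_fixedSet]
      rcases ha with rfl | ha
      · exact hv
      · exact ha.2
    · rw [h, Finset.card_insert_of_notMem (by simp), h2 v hv]
  have h4 := mem_fixedSet.2 hw
  rw [← h3, Finset.mem_insert, mem_fixNbrs] at h4
  exact h4.imp id And.left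

/-- Through a fixed v only the triangle of fixed vertices is preserved, by `odd_not_adj_image`.
Through any other v an invariant triangle must contain the edge from v to g v, and it is then v, g
v, g (g v). -/
theorem card_fixedTriangles_through {g : Γ ≃g Γ} (hg : g ^ 3 = 1) (h1 : g ≠ 1) (v : V) :
    ((fixedTriangles g).filter fun T => v ∈ T).card =
      (if g v = v then 1 else 0) + if Γ.Adj v (g v) then 1 else 0 := by
  by_cases hv : g v = v
  · rw [if_pos hv, if_neg (by rw [hv]; exact Γ.irrefl)]
    rcases hΓ.three_pow_cases (n := 1) (by simpa using hg) h1 with h | ⟨h, -, h2⟩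
    · exact absurd hv (hΓ.ne_of_fixedSet_card_zero h v)
    rw [add_zero, Finset.card_eq_one]
    refine ⟨fixedSet g, ?_⟩
    ext T
    rw [Finset.mem_filter, Finset.mem_singleton, mem_fixedTriangles]
    constructor
    · rintro ⟨⟨hT, hgT⟩, hvT⟩
      refine Finset.eq_of_subset_of_card_le (fun w hw => ?_)
        (by rw [h, (mem_triangles.1 hT).card_eq])
      rw [mem_fixedSet]
      by_contra hgw
      have hwv : v ≠ w := by rintro rfl; exact hgw hv
      exact odd_not_adj_image hΓ (m := 3) (by decide) hg hv
        (adj_of_mem_triangles hT hvT hw hwv)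
        (adj_of_mem_triangles hT hw (hgT w hw) (Ne.symm hgw))
    · rintro rfl
      refine ⟨⟨mem_triangles.2 ((SimpleGraph.isNClique_iff _).2 ⟨?_, h⟩), ?_⟩, mem_fixedSet.2 hv⟩
      · intro a ha b hb hab
        exact (hΓ.eq_or_adj_of_fixed (n := 1) (by simpa using hg) h1 (mem_fixedSet.1 ha)
          (mem_fixedSet.1 hb)).resolve_left (Ne.symm hab)
      · intro w hw
        rw [mem_fixedSet] at hw ⊢
        rw [hw, hw]
  · rw [if_neg hv, zero_add]
    split_ifs with ha
    · rw [← hΓ.card_triangles_through_edge ha]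
      have h3 : g (g (g v)) = v := by
        have : (g ^ 3) v = v := by rw [hg, aut_one_apply]
        exact this
      have ha2 : Γ.Adj (g v) (g (g v)) := (aut_adj g).2 ha
      have ha3 : Γ.Adj v (g (g v)) := by
        have := (aut_adj g).2 ha2
        rw [h3] at this; exact this.symm
      refine congrArg Finset.card ?_
      ext T
      rw [Finset.mem_filter, Finset.mem_filter, mem_fixedTriangles]
      constructor
      · rintro ⟨⟨hT, hgT⟩, hvT⟩; exact ⟨hT, hvT, hgT v hvT⟩
      · rintro ⟨hT, hvT, hgvT⟩
        refine ⟨⟨hT, ?_⟩, hvT⟩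
        rw [hΓ.eq_of_mem_triangles ha ha3 ha2 hT hvT hgvT]
        intro w hw
        simp only [Finset.mem_insert, Finset.mem_singleton] at hw ⊢
        rcases hw with rfl | rfl | rfl
        · right; left; rfl
        · right; right; rfl
        · left; exact h3
    · rw [Finset.card_eq_zero, Finset.filter_eq_empty_iff]
      intro T hT hvT
      rw [mem_fixedTriangles] at hT
      exact ha (adj_of_mem_triangles hT.1 hvT (hT.2 v hvT) (Ne.symm hv))

theorem three_mul_card_fixedTriangles {g : Γ ≃g Γ} (hg : g ^ 3 = 1) (h1 : g ≠ 1) :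
    3 * (fixedTriangles g).card = (fixedSet g).card + (movedToNbr g).card := by
  rw [three_mul_card_triangles (fixedTriangles g) (Finset.filter_subset _ _),
    Finset.sum_congr rfl fun v _ => hΓ.card_fixedTriangles_through hg h1 v,
    Finset.sum_add_distrib, fixedSet, movedToNbr, Finset.card_filter, Finset.card_filter]

end IsConway99

end Triangles

/-! ### Abelian groups of order 9. -/

section OrderNine

variable {V : Type*} [Fintype V] {Γ : SimpleGraph V}

namespace IsConway99

variable (hΓ : IsConway99 Γ) {R : Subgroup (Γ ≃g Γ)} (hR : Fintype.card R = 9)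
  (hc : ∀ r ∈ R, ∀ s ∈ R, r * s = s * r)

include hR in
theorem pow_nine_of_mem {r : Γ ≃g Γ} (hr : r ∈ R) : r ^ 9 = 1 := by
  have : (⟨r, hr⟩ : R) ^ Fintype.card R = 1 := pow_card_eq_one
  rw [hR] at this
  exact congrArg Subtype.val this

include hΓ hR in
theorem nine_dvd_sum_card_fixedSet : 9 ∣ ∑ r : R, (fixedSet (r : Γ ≃g Γ)).card := by
  have h := card_dvd_sum_card_fixed_vertices R Finset.univ (by simp)
  rwa [hR] at h

include hΓ hR hc

/-- If s ≠ 1 in R fixes v, it also fixes r v, so r v is equal or adjacent to v. Hence the invariant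
set of vertices fixed by r or sent by r to neighbours contains all fixed vertices of such s. Its
Burnside sum differs from that of all vertices only at the identity, so its size is congruent to 99
mod 9. -/
theorem card_fixed_add_moved_mod_nine {r : Γ ≃g Γ} (hr : r ∈ R) :
    9 ∣ (fixedSet r).card + (movedToNbr r).card := by
  have hcomm : ∀ s ∈ R, ∀ v, r (s v) = s (r v) := by
    intro s hs v
    rw [← aut_mul_apply, hc r hr s hs, aut_mul_apply]
  have h := card_dvd_sum_card_fixed_vertices R (fixedSet r ∪ movedToNbr r) (by
    intro s hs v hv
    rw [Finset.mem_union, mem_fixedSet, mem_movedToNbr] at hv ⊢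
    rw [hcomm s hs]
    exact hv.imp (fun h => by rw [h]) (aut_adj s).2)
  have h2 := hΓ.nine_dvd_sum_card_fixedSet hR
  rw [hR, ← Finset.add_sum_erase _ _ (Finset.mem_univ 1)] at h
  rw [← Finset.add_sum_erase _ _ (Finset.mem_univ 1)] at h2
  have h3 : ∀ s ∈ Finset.univ.erase (1 : R),
      ((fixedSet r ∪ movedToNbr r).filter fun v => (s : Γ ≃g Γ) v = v).card =
        (fixedSet (s : Γ ≃g Γ)).card := by
    intro s hs
    refine congrArg Finset.card ?_
    ext v
    rw [Finset.mem_filter, mem_fixedSet, Finset.mem_union, mem_fixedSet, mem_movedToNbr]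
    refine ⟨And.right, fun hv => ⟨?_, hv⟩⟩
    refine hΓ.eq_or_adj_of_fixed (n := 2) (g := s) (pow_nine_of_mem hR s.2) ?_ hv ?_
    · intro h1
      exact (Finset.mem_erase.1 hs).1 (Subtype.ext h1)
    · rw [← hcomm s s.2, hv]
  rw [Finset.sum_congr rfl h3] at h
  have h4 : (Finset.filter (fun v => ((1 : R) : Γ ≃g Γ) v = v) (fixedSet r ∪ movedToNbr r)).card =
      (fixedSet r).card + (movedToNbr r).card := by
    rw [OneMemClass.coe_one, Finset.filter_true_of_mem (fun v _ => aut_one_apply v),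
      Finset.card_union_of_disjoint]
    rw [Finset.disjoint_left]
    intro v hv hv2
    rw [mem_fixedSet] at hv
    rw [mem_movedToNbr, hv] at hv2
    exact Γ.irrefl hv2
  have h5 : (fixedSet ((1 : R) : Γ ≃g Γ)).card = 99 := by
    rw [OneMemClass.coe_one, fixedSet,
      Finset.filter_true_of_mem (fun v _ => aut_one_apply v), Finset.card_univ, hΓ.card]
  rw [h4] at h
  rw [h5] at h2
  omega

/-- Combine n + a ≡ 0 mod 9 with a + 4n ≡ 4 mod 7; for n = 3 the bound a ≤ 60 selects 6. Elements of
order 9 are included. -/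
theorem order_three_cases {r : Γ ≃g Γ} (hr : r ∈ R) (h1 : r ≠ 1) :
    ((fixedSet r).card = 0 ∧ ((movedToNbr r).card = 18 ∨ (movedToNbr r).card = 81)) ∨
      ((fixedSet r).card = 3 ∧ (movedToNbr r).card = 6) := by
  have h2 := hΓ.card_fixed_add_moved_mod_nine hR hc hr
  have h3 := hΓ.trace_mod_seven r
  have h4 : (movedToNbr r).card ≤ 99 := by rw [← hΓ.card]; exact Finset.card_le_univ _
  rcases hΓ.three_pow_cases (n := 2) (g := r) (pow_nine_of_mem hR hr) h1 with h | ⟨h, h5, -⟩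
  · rw [h] at h2 h3
    left; refine ⟨h, ?_⟩; omega
  · rw [h] at h2 h3
    right; refine ⟨h, ?_⟩; omega

end IsConway99

end OrderNine

end

section

open scoped Classical

/-! ### No nontrivial element of R fixes the vertex of the reflection. -/

section OrderNineFixing

variable {V : Type*} [Fintype V] {Γ : SimpleGraph V}

theorem mem_fixedSet_inv {g : Γ ≃g Γ} {v : V} : g⁻¹ v = v ↔ g v = v := by
  rw [aut_inv_eq_iff, eq_comm]

theorem card_fixedSet_inv (g : Γ ≃g Γ) : (fixedSet g⁻¹).card = (fixedSet g).card := by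
  refine congrArg Finset.card (Finset.ext fun v => ?_)
  rw [mem_fixedSet, mem_fixedSet, mem_fixedSet_inv]

theorem card_fixedTriangles_inv (g : Γ ≃g Γ) :
    (fixedTriangles g⁻¹).card = (fixedTriangles g).card := by
  have key : ∀ (h : Γ ≃g Γ) (T : Finset V), (∀ v ∈ T, h v ∈ T) → ∀ v ∈ T, h⁻¹ v ∈ T := by
    intro h T hT v hv
    have h1 : T.image h = T := by
      refine Finset.eq_of_subset_of_card_le (fun w hw => ?_) ?_
      · obtain ⟨u, hu, rfl⟩ := Finset.mem_image.1 hw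
        exact hT u hu
      · rw [Finset.card_image_of_injective _ h.injective]
    rw [← h1] at hv
    obtain ⟨w, hw, rfl⟩ := Finset.mem_image.1 hv
    rwa [aut_inv_apply_self]
  refine congrArg Finset.card (Finset.ext fun T => ?_)
  rw [mem_fixedTriangles, mem_fixedTriangles]
  refine and_congr_right fun _ => ⟨fun h => ?_, key g T⟩
  have := key g⁻¹ T h
  rwa [inv_inv] at this

theorem card_fixedSet_conj (t g : Γ ≃g Γ) : (fixedSet (t * g * t⁻¹)).card = (fixedSet g).card := by
  refine (Finset.card_bij (fun v _ => t v) ?_ ?_ ?_).symm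
  · intro v hv
    rw [mem_fixedSet] at hv ⊢
    rw [aut_mul_apply, aut_mul_apply, aut_inv_apply_self, hv]
  · intro v _ w _ h; exact t.injective h
  · intro v hv
    rw [mem_fixedSet, aut_mul_apply, aut_mul_apply] at hv
    refine ⟨t⁻¹ v, mem_fixedSet.2 ?_, aut_apply_inv_self _ _⟩
    exact (aut_inv_eq_iff.2 hv.symm).symm

namespace IsConway99

variable (hΓ : IsConway99 Γ) {R : Subgroup (Γ ≃g Γ)} (hR : Fintype.card R = 9)
  (hc : ∀ r ∈ R, ∀ s ∈ R, r * s = s * r)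

theorem eq_one_of_sq_of_mem {g : Γ ≃g Γ} (hg : g ^ 9 = 1) (h : g * g = 1) : g = 1 := by
  rw [← hg, show 9 = 2 * 4 + 1 from rfl, pow_succ, pow_mul, pow_two, h, one_pow, one_mul]

include hR in
theorem exists_pow_eq_of_pow_three_ne {r s : Γ ≃g Γ} (hr : r ∈ R) (h : r ^ 3 ≠ 1) (hs : s ∈ R) :
    ∃ k : ℕ, s = r ^ k := by
  have : Fact (Nat.Prime 3) := ⟨by norm_num⟩
  have h1 : orderOf r = 3 ^ (1 + 1) :=
    orderOf_eq_prime_pow (by simpa using h) (pow_nine_of_mem hR hr)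
  have h2 : Subgroup.zpowers r = R := by
    refine Subgroup.eq_of_le_of_card_ge (Subgroup.zpowers_le.2 hr) ?_
    rw [Nat.card_zpowers, h1, Nat.card_eq_fintype_card, hR]
    norm_num
  rw [← h2, mem_zpowers_iff_mem_range_orderOf] at hs
  obtain ⟨k, -, hk⟩ := Finset.mem_image.1 hs
  exact ⟨k, hk.symm⟩

include hR hΓ in
-- Otherwise each of the 8 nontrivial elements fixes 3 vertices, and the Burnside sum 99 + 24 is not
-- divisible by 9.
theorem exists_not_fixed (x : V) : ∃ r ∈ R, r x ≠ x := by
  by_contra! hall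
  have h := hΓ.nine_dvd_sum_card_fixedSet hR
  rw [← Finset.add_sum_erase _ _ (Finset.mem_univ 1)] at h
  have h2 : ∀ r ∈ Finset.univ.erase (1 : R), (fixedSet (r : Γ ≃g Γ)).card = 3 := by
    intro r hr
    rcases hΓ.three_pow_cases (n := 2) (g := r) (pow_nine_of_mem hR r.2)
      (fun h1 => (Finset.mem_erase.1 hr).1 (Subtype.ext h1)) with h | h
    · exact absurd (hall r r.2) (hΓ.ne_of_fixedSet_card_zero h x)
    · exact h.1
  have h5 : (fixedSet ((1 : R) : Γ ≃g Γ)).card = 99 := by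
    rw [OneMemClass.coe_one, fixedSet,
      Finset.filter_true_of_mem (fun v _ => aut_one_apply v), Finset.card_univ, hΓ.card]
  rw [Finset.sum_congr rfl h2, h5, Finset.sum_const, Finset.card_erase_of_mem (Finset.mem_univ _),
    Finset.card_univ, hR] at h
  exact absurd h (by decide)

include hR hc in
/-- A sum over a noncyclic group of order nine. -/
theorem sum_order_nine (f : (Γ ≃g Γ) → ℕ) (hf : ∀ g, f g⁻¹ = f g) {a b : Γ ≃g Γ} (ha : a ∈ R)
    (hb : b ∈ R) (ha3 : a ^ 3 = 1) (hb3 : b ^ 3 = 1) {x : V} (ha1 : a ≠ 1) (hax : a x = x)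
    (hbx : b x ≠ x) :
    ∑ r : R, f r = f 1 + 2 * f a + 2 * f b + 2 * f (a * b) + 2 * f (a * b⁻¹) := by
  have hab := hc a ha b hb
  have hbb : b (b x) ≠ x := by
    intro h
    apply hbx
    have : (b ^ 3) x = x := by rw [hb3, aut_one_apply]
    rw [pow_succ', pow_two, aut_mul_apply, aut_mul_apply, h] at this
    exact this
  have haa : a * a ≠ 1 := fun h => ha1 (eq_one_of_sq_of_mem (by
    rw [show 9 = 3 * 3 from rfl, pow_mul, ha3, one_pow]) h)
  -- Since a fixes x and b does not, the image of x reveals the exponent of b.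
  let φ : Fin 3 × Fin 3 → R := fun p => ⟨a ^ (p.1 : ℕ) * b ^ (p.2 : ℕ),
    R.mul_mem (R.pow_mem ha _) (R.pow_mem hb _)⟩
  have hinj : Function.Injective φ := by
    rintro ⟨i, j⟩ ⟨k, l⟩ h
    have h1 : a ^ (i : ℕ) * b ^ (j : ℕ) = a ^ (k : ℕ) * b ^ (l : ℕ) := congrArg Subtype.val h
    have h2 : (b ^ (j : ℕ)) x = (b ^ (l : ℕ)) x := by
      have h3 := congrArg (fun g : Γ ≃g Γ => g x) h1
      have hcm : ∀ m n : ℕ, a ^ m * b ^ n = b ^ n * a ^ m := fun m n =>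
        (Commute.pow_pow (show Commute a b from hab) m n)
      simp only [hcm, aut_mul_apply, aut_pow_fixed hax] at h3
      exact h3
    have hjl : j = l := by
      fin_cases j <;> fin_cases l <;> simp [pow_two, aut_mul_apply, aut_one_apply] at h2 ⊢
      · exact hbx h2.symm
      · exact hbb h2.symm
      · exact hbx h2
      · exact hbx h2.symm
      · exact hbb h2
      · exact hbx h2
    subst hjl
    have h4 : a ^ (i : ℕ) = a ^ (k : ℕ) := mul_right_cancel h1
    have hik : i = k := by
      fin_cases i <;> fin_cases k <;> simp [pow_two] at h4 ⊢
      · exact ha1 h4.symm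
      · exact haa h4.symm
      · exact ha1 h4
      · exact ha1 h4
      · exact haa h4
      · exact ha1 h4
    rw [hik]
  have hbij : Function.Bijective φ :=
    (Fintype.bijective_iff_injective_and_card φ).2 ⟨hinj, by rw [hR]; rfl⟩
  have haI : a * a = a⁻¹ := by
    rw [eq_inv_iff_mul_eq_one, ← pow_two, ← pow_succ]; exact ha3
  have hbI : b * b = b⁻¹ := by
    rw [eq_inv_iff_mul_eq_one, ← pow_two, ← pow_succ]; exact hb3
  have hc2 : a⁻¹ * b⁻¹ = (a * b)⁻¹ := by rw [hab, mul_inv_rev]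
  have hc3 : a⁻¹ * b = (a * b⁻¹)⁻¹ := by
    rw [mul_inv_rev, inv_inv]
    exact ((show Commute a b from hab).inv_left).eq
  rw [← hbij.sum_comp fun r : R => f r, Fintype.sum_prod_type]
  simp only [Fin.sum_univ_three, φ]
  simp only [Fin.val_zero, Fin.val_one, Fin.val_two, pow_zero, pow_one, one_mul, mul_one, pow_two,
    haI, hbI, hc2, hc3, hf]
  ring

include hΓ hR hc in
/-- A group of order nine normalized by a reflection acts freely on the orbit of its vertex. -/
theorem eq_one_of_mem_of_fixed {t : Γ ≃g Γ} {x : V} (ht : IsReflection t x)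
    (hinv : ∀ r ∈ R, t * r * t ∈ R) {a : Γ ≃g Γ} (ha : a ∈ R) (hax : a x = x) : a = 1 := by
  by_contra ha1
  obtain ⟨r, hr, hrx⟩ := hΓ.exists_not_fixed hR x
  have ha3 : a ^ 3 = 1 := by
    by_contra h
    obtain ⟨k, rfl⟩ := exists_pow_eq_of_pow_three_ne hR ha h hr
    exact hrx (aut_pow_fixed hax k)
  have hat := hΓ.reflection_commute ht hax
  -- This commutator is inverted by t, and is nontrivial since r does not commute with t.
  obtain ⟨g, hg⟩ : ∃ g, g = r⁻¹ * (t * r * t) := ⟨_, rfl⟩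
  have hgR : g ∈ R := by rw [hg]; exact R.mul_mem (R.inv_mem hr) (hinv r hr)
  have hgi : t * g * t = g⁻¹ := by
    rw [hg, mul_inv_rev, mul_inv_rev, mul_inv_rev, inv_inv, ht.inv_eq]
    simp only [mul_assoc, ht.sq, mul_one]
  have hg1 : g ≠ 1 := by
    intro h
    rw [hg, inv_mul_eq_one] at h
    refine hrx (fixed_of_reflection_commute ht ?_)
    conv_lhs => rw [h]
    rw [mul_assoc, ht.sq, mul_one]
  have hg9 := pow_nine_of_mem hR hgR
  have hgx : g x ≠ x := by
    intro h
    have h1 := hΓ.reflection_commute ht h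
    rw [← h1, mul_assoc, ht.sq, mul_one] at hgi
    exact hg1 (eq_one_of_sq_of_mem hg9 (mul_eq_one_iff_eq_inv.2 hgi))
  have hg3 : g ^ 3 = 1 := by
    by_contra h
    obtain ⟨k, rfl⟩ := exists_pow_eq_of_pow_three_ne hR hgR h ha
    have h2 := ht.pow_inverted hgi k
    rw [← hat, mul_assoc, ht.sq, mul_one] at h2
    exact ha1 (eq_one_of_sq_of_mem (pow_nine_of_mem hR ha) (mul_eq_one_iff_eq_inv.2 h2))
  -- As a commutes with g it fixes g x, and two distinct fixed vertices of a are adjacent. Parity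
  -- then forces g to send 81 vertices to neighbours.
  have hadj : Γ.Adj x (g x) := by
    refine (hΓ.eq_or_adj_of_fixed (n := 1) (by simpa using ha3) ha1 hax ?_).resolve_left hgx
    rw [← aut_mul_apply, hc a ha g hgR, aut_mul_apply, hax]
  have h1 := hΓ.inverted_moved_mod_two ht hgi
  rw [if_pos hadj] at h1
  have hgc := hΓ.order_three_cases hR hc hgR hg1
  have hac := hΓ.order_three_cases hR hc ha ha1
  have hafix : (fixedSet a).card ≠ 0 := fun h => hΓ.ne_of_fixedSet_card_zero h x hax
  have habR : a * g ∈ R := R.mul_mem ha hgR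
  have hab1 : a * g ≠ 1 := by
    intro h
    have h2 := congrArg (fun k : Γ ≃g Γ => k x) (hc a ha g hgR ▸ h : g * a = 1)
    simp only [aut_mul_apply, hax, aut_one_apply] at h2
    exact hgx h2
  have hab3 : (a * g) ^ 3 = 1 := by
    rw [(show Commute a g from hc a ha g hgR).mul_pow, ha3, hg3, one_mul]
  have habc := hΓ.order_three_cases hR hc habR hab1
  -- Since t commutes with a and inverts g, the elements a g and a g⁻¹ are conjugate and fix equally
  -- many vertices.
  have hconj : a * g⁻¹ = t * (a * g) * t⁻¹ := by
    rw [ht.inv_eq, ← mul_assoc t, ← hat, ← hgi]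
    simp only [mul_assoc]
  have hagI : a * g⁻¹ ∈ R := R.mul_mem ha (R.inv_mem hgR)
  have hagI3 : (a * g⁻¹) ^ 3 = 1 := by
    rw [(show Commute a g⁻¹ from (show Commute a g from hc a ha g hgR).inv_right).mul_pow, ha3,
      inv_pow, hg3, inv_one, one_mul]
  have hagI1 : a * g⁻¹ ≠ 1 := by
    rw [hconj]
    intro h
    rw [conj_eq_one_iff] at h
    exact hab1 h
  have hfe : (fixedSet (a * g⁻¹)).card = (fixedSet (a * g)).card := by
    rw [hconj, card_fixedSet_conj]
  have hagc := hΓ.order_three_cases hR hc hagI hagI1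
  have hV := hΓ.nine_dvd_sum_card_fixedSet hR
  rw [sum_order_nine hR hc (fun g => (fixedSet g).card) card_fixedSet_inv ha hgR ha3 hg3 ha1 hax
    hgx] at hV
  have hT := card_dvd_sum_card_fixedTriangles R
  rw [hR, sum_order_nine hR hc (fun g => (fixedTriangles g).card) card_fixedTriangles_inv ha hgR
    ha3 hg3 ha1 hax hgx] at hT
  have h5 : (fixedSet (1 : Γ ≃g Γ)).card = 99 := by
    rw [fixedSet, Finset.filter_true_of_mem (fun v _ => aut_one_apply v), Finset.card_univ,
      hΓ.card]
  have t1 := hΓ.three_mul_card_fixedTriangles ha3 ha1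
  have t2 := hΓ.three_mul_card_fixedTriangles hg3 hg1
  have t3 := hΓ.three_mul_card_fixedTriangles hab3 hab1
  have t4 := hΓ.three_mul_card_fixedTriangles hagI3 hagI1
  simp only [h5, hfe, hΓ.card_fixedTriangles_one] at hV hT
  rw [hfe] at t4 hagc
  obtain ⟨ha0, ha1⟩ : (fixedSet a).card = 3 ∧ (movedToNbr a).card = 6 :=
    hac.resolve_left fun h => hafix h.1
  obtain ⟨hg0, hg1⟩ : (fixedSet g).card = 0 ∧ (movedToNbr g).card = 81 := by
    rcases hgc with ⟨h, h' | h'⟩ | ⟨h, h'⟩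
    · rw [h'] at h1; exact absurd h1 (by decide)
    · exact ⟨h, h'⟩
    · rw [h'] at h1; exact absurd h1 (by decide)
  rw [ha0, hg0] at hV
  -- Burnside on vertices forces a g to fix 3 vertices. On triangles the sum is then 231 + 2·3 +
  -- 2·27 + 4·3 = 303, not divisible by 9.
  rcases habc with ⟨h, -⟩ | ⟨h, h'⟩
  · rw [h] at hV; exact absurd hV (by decide)
  rcases hagc with ⟨h3, -⟩ | ⟨-, h4⟩
  · omega
  rw [ha0, ha1] at t1
  rw [hg0, hg1] at t2
  rw [h, h'] at t3
  rw [h, h4] at t4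
  omega

end IsConway99

end OrderNineFixing

end

/-! ### Nonexistence of the 5 × 5 orbit matrix. -/

section FiveMatrix

theorem sorted_five {a b c d e : ℕ} (hab : a ≤ b) (hbc : b ≤ c) (hcd : c ≤ d) (hde : d ≤ e)
    (h1 : a + b + c + d + e = 7) (h2 : a * a + b * b + c * c + d * d + e * e = 15) :
    a = 0 ∧ b = 1 ∧ c = 1 ∧ d = 2 ∧ e = 3 := by
  have he : e ≤ 3 := by nlinarith
  interval_cases e <;> interval_cases d <;> interval_cases c <;> interval_cases b <;>
    interval_cases a <;> omega

/-- The row of the orbit which meets the neighbourhood in three vertices. -/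
theorem five_row_three {p q r s u : ℕ} (h3 : 3 + (p + q + r + s + u) = 14)
    (h4 : 0 * p + 1 * q + 1 * r + 2 * s + 3 * u + 3 = 18)
    (h5 : p * p + q * q + r * r + s * s + u * u + 2 * (3 * 3) + u = 48) (h6 : 3 ≤ u)
    (h7 : u % 2 = 3 % 2) : p = 3 := by
  have hu : u ≤ 5 := by nlinarith
  have hp : p = 8 + s + 2 * u - 12 := by omega
  have hs : s ≤ 3 := by omega
  have hq : q ≤ 6 := by omega
  have hr : r = 15 - 2 * s - 3 * u - q := by omega
  by_contra hne
  interval_cases u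
  · interval_cases s <;> norm_num at hp hr hne <;> subst hp <;> interval_cases q <;> subst hr <;> omega
  · omega
  · interval_cases s <;> norm_num at hp hr <;> subst hp <;> interval_cases q <;> subst hr <;> omega

/-- The row of the orbit which does not meet the neighbourhood. -/
theorem five_row_zero {p q r s u : ℕ} (h3 : 0 + (p + q + r + s + u) = 14)
    (h4 : 0 * p + 1 * q + 1 * r + 2 * s + 3 * u + 0 = 18)
    (h5 : p * p + q * q + r * r + s * s + u * u + 2 * (0 * 0) + p = 48)
    (h7 : p % 2 = 0 % 2) : u ≠ 3 := by
  rintro rfl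
  have hp : p = s + 2 := by omega
  have hs : s ≤ 4 := by omega
  have hq : q ≤ 9 := by omega
  have hr : r = 9 - 2 * s - q := by omega
  subst hp
  interval_cases s <;> interval_cases q <;> subst hr <;> omega

/-- The vector b is (0, 1, 1, 2, 3) up to order. The row of the orbit with b = 3 forces the entry
between it and the orbit with b = 0 to be 3, which the row of the latter forbids. -/
theorem no_five_matrix (b : Fin 5 → ℕ) (e : Fin 5 → Fin 5 → ℕ) (hsym : ∀ i j, e i j = e j i)
    (h1 : ∑ i, b i = 7) (h2 : ∑ i, b i * b i = 15) (h3 : ∀ i, b i + ∑ k, e i k = 14)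
    (h4 : ∀ i, ∑ k, b k * e i k + b i = 18)
    (h5 : ∀ i, ∑ k, e i k * e i k + 2 * (b i * b i) + e i i = 48) (h6 : ∀ i, b i ≤ e i i)
    (h7 : ∀ i, e i i % 2 = b i % 2) : False := by
  obtain ⟨σ, hσ⟩ : ∃ σ : Equiv.Perm (Fin 5), Monotone (b ∘ σ) := ⟨_, Tuple.monotone_sort b⟩
  rw [← Equiv.sum_comp σ] at h1 h2
  have h3' : ∀ i, b i + ∑ k, e i (σ k) = 14 := fun i => by
    rw [Equiv.sum_comp σ fun k => e i k, h3]
  have h4' : ∀ i, ∑ k, b (σ k) * e i (σ k) + b i = 18 := fun i => by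
    rw [Equiv.sum_comp σ fun k => b k * e i k, h4]
  have h5' : ∀ i, ∑ k, e i (σ k) * e i (σ k) + 2 * (b i * b i) + e i i = 48 := fun i => by
    rw [Equiv.sum_comp σ fun k => e i k * e i k, h5]
  simp only [Fin.sum_univ_five] at h1 h2 h3' h4' h5'
  obtain ⟨b0, b1, b2, b3, b4⟩ := sorted_five (hσ (show (0 : Fin 5) ≤ 1 by decide))
    (hσ (show (1 : Fin 5) ≤ 2 by decide)) (hσ (show (2 : Fin 5) ≤ 3 by decide))
    (hσ (show (3 : Fin 5) ≤ 4 by decide)) h1 h2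
  simp only [Function.comp_apply] at b0 b1 b2 b3 b4
  simp only [b0, b1, b2, b3, b4] at h4'
  have r3 := five_row_three (by simpa [b4] using h3' (σ 4)) (by simpa [b4] using h4' (σ 4))
    (by simpa [b4] using h5' (σ 4)) (by simpa [b4] using h6 (σ 4))
    (by simpa [b4] using h7 (σ 4))
  refine five_row_zero (by simpa [b0] using h3' (σ 0)) (by simpa [b0] using h4' (σ 0))
    (by simpa [b0] using h5' (σ 0)) (by simpa [b0] using h7 (σ 0)) ?_
  rw [hsym, r3]

end FiveMatrix

section

open scoped Classical

/-! ### Adjoining a reflection to a group it normalizes. -/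

section ReflectionExtension

variable {V : Type*} [Fintype V] {Γ : SimpleGraph V}

/-- The group generated by a group of automorphisms and an involution normalizing it. -/
def reflectionExtension (t : Γ ≃g Γ) (R : Subgroup (Γ ≃g Γ)) (ht : t * t = 1)
    (hinv : ∀ r ∈ R, t * r * t ∈ R) : Subgroup (Γ ≃g Γ) where
  carrier := {d | d ∈ R ∨ t * d ∈ R}
  one_mem' := Or.inl R.one_mem
  mul_mem' := by
    rintro d e (hd | hd) (he | he)
    · exact Or.inl (R.mul_mem hd he)
    · right
      have : t * (d * e) = t * d * t * (t * e) := by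
        simp only [mul_assoc]; rw [← mul_assoc t t, ht, one_mul]
      rw [this]; exact R.mul_mem (hinv d hd) he
    · right; rw [← mul_assoc]; exact R.mul_mem hd he
    · left
      have : d * e = t * (t * d) * t * (t * e) := by
        rw [← mul_assoc t t, ht, one_mul, mul_assoc, ← mul_assoc t t, ht, one_mul]
      rw [this]; exact R.mul_mem (hinv _ hd) he
  inv_mem' := by
    rintro d (hd | hd)
    · exact Or.inl (R.inv_mem hd)
    · right
      have h := hinv _ (R.inv_mem hd)
      rwa [mul_inv_rev, inv_eq_of_mul_eq_one_left ht, mul_assoc, mul_assoc, ht, mul_one] at h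

theorem sum_reflectionExtension {t : Γ ≃g Γ} {R : Subgroup (Γ ≃g Γ)} (ht : t * t = 1)
    (hinv : ∀ r ∈ R, t * r * t ∈ R) (htR : t ∉ R) (f : (Γ ≃g Γ) → ℕ) :
    ∑ d : reflectionExtension t R ht hinv, f d = ∑ r : R, f r + ∑ r : R, f (t * r) := by
  have htt : ∀ g, t * (t * g) = g := fun g => by rw [← mul_assoc, ht, one_mul]
  let φ : R ⊕ R → reflectionExtension t R ht hinv := Sum.elim (fun r => ⟨r, Or.inl r.2⟩)
    fun r => ⟨t * r, Or.inr (by rw [htt]; exact r.2)⟩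
  have hφ : Function.Bijective φ := by
    constructor
    · rintro (a | a) (b | b) h
      · have h1 : (φ (Sum.inl a) : Γ ≃g Γ) = φ (Sum.inl b) := congrArg Subtype.val h
        exact congrArg Sum.inl (Subtype.ext h1)
      · have h1 : (a : Γ ≃g Γ) = t * b := congrArg Subtype.val h
        exact absurd (by rw [← mul_inv_eq_iff_eq_mul.2 h1]; exact R.mul_mem a.2 (R.inv_mem b.2)) htR
      · have h1 : t * (a : Γ ≃g Γ) = b := congrArg Subtype.val h
        exact absurd (by rw [eq_mul_inv_of_mul_eq h1]; exact R.mul_mem b.2 (R.inv_mem a.2)) htR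
      · have h1 : t * (a : Γ ≃g Γ) = t * b := congrArg Subtype.val h
        exact congrArg Sum.inr (Subtype.ext (mul_left_cancel h1))
    · rintro ⟨d, hd | hd⟩
      · exact ⟨Sum.inl ⟨d, hd⟩, rfl⟩
      · exact ⟨Sum.inr ⟨t * d, hd⟩, Subtype.ext (htt d)⟩
  rw [← hφ.sum_comp fun d : reflectionExtension t R ht hinv => f d, Fintype.sum_sum_type]
  rfl

end ReflectionExtension

/-! ### R acts freely and is inverted by the reflection. -/

section OrderNineFree

variable {V : Type*} [Fintype V] {Γ : SimpleGraph V}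

namespace IsConway99

variable (hΓ : IsConway99 Γ) {R : Subgroup (Γ ≃g Γ)} (hR : Fintype.card R = 9)
  (hc : ∀ r ∈ R, ∀ s ∈ R, r * s = s * r) {t : Γ ≃g Γ} {x : V} (ht : IsReflection t x)
  (hinv : ∀ r ∈ R, t * r * t ∈ R)

include hΓ hR hc ht hinv

/-- As R is abelian, r (t r t) commutes with t, so it fixes x and is trivial. -/
theorem reflection_inverts {r : Γ ≃g Γ} (hr : r ∈ R) : t * r * t = r⁻¹ := by
  refine eq_inv_of_mul_eq_one_right (hΓ.eq_one_of_mem_of_fixed hR hc ht hinv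
    (R.mul_mem hr (hinv r hr)) (fixed_of_reflection_commute ht ?_))
  have h1 : t * (r * (t * r * t)) = t * r * t * r * t := by simp only [mul_assoc]
  rw [h1, hc _ (hinv r hr) r hr]

/-- The reflection permutes the fixed vertices of r; three of them would have to include x. -/
theorem order_nine_free {r : Γ ≃g Γ} (hr : r ∈ R) {v : V} (hv : r v = v) : r = 1 := by
  by_contra h1
  rcases hΓ.three_pow_cases (n := 2) (g := r) (pow_nine_of_mem hR hr) h1 with h | ⟨h, -⟩
  · exact hΓ.ne_of_fixedSet_card_zero h v hv
  · have hi := hΓ.reflection_inverts hR hc ht hinv hr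
    have h2 := hΓ.reflection_mem_of_odd ht (B := fixedSet r) (by
      intro w hw
      rw [mem_fixedSet] at hw ⊢
      have h3 := ht.apply_inverted hi w
      rw [hw] at h3
      exact mem_fixedSet_inv.1 h3.symm)
    rw [h] at h2
    split_ifs at h2 with hx
    exact h1 (hΓ.eq_one_of_mem_of_fixed hR hc ht hinv hr (mem_fixedSet.1 hx))

theorem pow_three_of_adj {r : Γ ≃g Γ} (hr : r ∈ R) (h : Γ.Adj x (r x)) : r ^ 3 = 1 :=
  hΓ.order_nine_free hR hc ht hinv (R.pow_mem hr 3)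
    (hΓ.inverted_pow_three ht (hΓ.reflection_inverts hR hc ht hinv hr) h)

/-- By freeness r sends 18 or 81 vertices to neighbours, and parity decides according to whether x
is adjacent to r x. For order 3 this means 6 or 27 triangles; for order 9 an invariant triangle
would give r ^ 3 a fixed vertex. -/
theorem card_fixedTriangles_of_mem {r : Γ ≃g Γ} (hr : r ∈ R) (h1 : r ≠ 1) :
    (fixedTriangles r).card = 6 * (if r ^ 3 = 1 then 1 else 0) +
      21 * if Γ.Adj x (r x) then 1 else 0 := by
  have hfree : ∀ s ∈ R, s ≠ 1 → ∀ v, s v ≠ v := fun s hs hs1 v hv =>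
    hs1 (hΓ.order_nine_free hR hc ht hinv hs hv)
  have h2 : (fixedSet r).card = 0 := by
    rw [Finset.card_eq_zero, Finset.eq_empty_iff_forall_notMem]
    intro v hv
    exact hfree r hr h1 v (mem_fixedSet.1 hv)
  have h3 := hΓ.order_three_cases hR hc hr h1
  have h4 := hΓ.inverted_moved_mod_two ht (hΓ.reflection_inverts hR hc ht hinv hr)
  by_cases hr3 : r ^ 3 = 1
  · have h5 := hΓ.three_mul_card_fixedTriangles hr3 h1
    rw [if_pos hr3]
    split_ifs at h4 ⊢ <;> omega
  · rw [if_neg hr3, if_neg fun h => hr3 (hΓ.pow_three_of_adj hR hc ht hinv hr h), Finset.card_eq_zero,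
      Finset.eq_empty_iff_forall_notMem]
    intro T hT
    rw [mem_fixedTriangles] at hT
    obtain ⟨v, hv⟩ : T.Nonempty := by
      rw [← Finset.card_pos, (mem_triangles.1 hT.1).card_eq]; norm_num
    have hrr : r * r ≠ 1 := fun h => h1 (eq_one_of_sq_of_mem (pow_nine_of_mem hR hr) h)
    refine hfree _ (R.pow_mem hr 3) hr3 v (hΓ.pow_three_fixed
      (adj_of_mem_triangles hT.1 hv (hT.2 v hv) (hfree r hr h1 v).symm)
      (adj_of_mem_triangles hT.1 hv (hT.2 _ (hT.2 v hv)) ?_))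
    rw [← aut_mul_apply]
    exact (hfree _ (R.mul_mem hr hr) hrr v).symm

omit hΓ ht hinv in
-- Translation by an element of order 3 permutes these elements without fixed points.
theorem three_dvd_card_pow_three : 3 ∣ (Finset.univ.filter fun r : R => r ^ 3 = 1).card := by
  have : Fact (Nat.Prime 3) := ⟨by norm_num⟩
  obtain ⟨a, ha⟩ := exists_prime_orderOf_dvd_card (G := R) 3 (by rw [hR]; decide)
  have ha3 : a ^ 3 = 1 := by rw [← ha, pow_orderOf_eq_one]
  have ha1 : a ≠ 1 := by rintro rfl; rw [orderOf_one] at ha; omega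
  refine (Nat.modEq_zero_iff_dvd).1 (Finset.card_modEq_zero_of_forall_ne 3 1 (fun r => a * r) _
    ?_ ?_ ?_)
  · intro r hr
    simp only [Finset.mem_filter, Finset.mem_univ, true_and] at hr ⊢
    rw [(show Commute a r from Subtype.ext (hc a a.2 r r.2)).mul_pow, ha3, hr, one_mul]
  · intro r _
    rw [pow_one, mul_left_iterate]
    simp [ha3]
  · intro r _ h
    exact ha1 (mul_eq_right.1 h)

theorem three_dvd_card_adj : 3 ∣ ∑ r : R, if Γ.Adj x ((r : Γ ≃g Γ) x) then 1 else 0 := by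
  have hT := card_dvd_sum_card_fixedTriangles R
  -- The identity fixes 231 = 225 + 6 triangles. As 225 and 6 times a multiple of 3 vanish mod 9,
  -- Burnside leaves 21 times the wanted number divisible by 9.
  have h1 : ∀ r : R, (fixedTriangles (r : Γ ≃g Γ)).card = 225 * (if r = 1 then 1 else 0) +
      (6 * (if r ^ 3 = 1 then 1 else 0) + 21 * if Γ.Adj x ((r : Γ ≃g Γ) x) then 1 else 0) := by
    intro r
    by_cases hr : r = 1
    · subst hr
      simp [hΓ.card_fixedTriangles_one]
    · have h2 : (r : Γ ≃g Γ) ^ 3 = 1 ↔ r ^ 3 = 1 := by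
        rw [← Subgroup.coe_pow, OneMemClass.coe_eq_one]
      rw [hΓ.card_fixedTriangles_of_mem hR hc ht hinv r.2 fun h => hr (Subtype.ext h), if_neg hr,
        mul_zero, zero_add]
      simp only [h2]
  have h3 := three_dvd_card_pow_three hR hc
  rw [Finset.card_filter] at h3
  rw [hR, Finset.sum_congr rfl fun r _ => h1 r, Finset.sum_add_distrib, Finset.sum_add_distrib,
    ← Finset.mul_sum, ← Finset.mul_sum, ← Finset.mul_sum, Finset.sum_ite_eq' Finset.univ (1 : R),
    if_pos (Finset.mem_univ _)] at hT
  convert_to 3 ∣ ∑ r : R, ite (r ^ 3 = 1) 1 0 at h3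
  omega

omit hΓ hR hc hinv in
-- Inversion gives t s² = s⁻¹ t s. Since squaring is bijective on R, every element of the coset t R
-- is thus a reflection.
theorem isReflection_mul_sq {s : Γ ≃g Γ} (hs : t * s * t = s⁻¹) :
    IsReflection (t * (s * s)) (s⁻¹ x) := by
  have h := ht.conj s⁻¹
  have h1 : s⁻¹ * t * s⁻¹⁻¹ = t * (s * s) := by
    rw [inv_inv, ← hs, mul_assoc (t * s), ht.sq, mul_one, mul_assoc]
  rwa [h1] at h

omit hΓ hc ht hinv in
theorem sq_bijective : Function.Bijective fun s : R => s * s := by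
  refine Function.Injective.bijective_of_finite fun a b h => ?_
  have h1 : ∀ s : R, (s * s) ^ 5 = s := by
    intro s
    have : s ^ 9 = 1 := by rw [← hR]; exact pow_card_eq_one
    rw [← pow_two, ← pow_mul, show 2 * 5 = 9 + 1 from rfl, pow_succ, this, one_mul]
  rw [← h1 a, ← h1 b]
  exact congrArg (· ^ 5) h

end IsConway99

end OrderNineFree

end

section

open scoped Classical

/-! ### Order 9 is excluded through a group of order 18. -/

section OrderNineExclusion

variable {V : Type*} [Fintype V] {Γ : SimpleGraph V}

namespace IsConway99

variable (hΓ : IsConway99 Γ)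

include hΓ

/-- No reflection normalizes an abelian group of nine automorphisms. -/
theorem not_normalizes_order_nine {R : Subgroup (Γ ≃g Γ)} (hR : Fintype.card R = 9)
    (hc : ∀ r ∈ R, ∀ s ∈ R, r * s = s * r) {t : Γ ≃g Γ} {x : V} (ht : IsReflection t x) :
    ¬ ∀ r ∈ R, t * r * t ∈ R := by
  intro hinv
  have hi : ∀ r ∈ R, t * r * t = r⁻¹ := fun r => hΓ.reflection_inverts hR hc ht hinv
  have hfree : ∀ r ∈ R, ∀ v, r v = v → r = 1 := fun r hr v =>
    hΓ.order_nine_free hR hc ht hinv hr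
  have htR : t ∉ R := fun h => IsReflection.ne_one hΓ ht (hfree t h x ht.apply_self)
  set D := reflectionExtension t R ht.sq hinv with hD
  have hsum : ∀ f : (Γ ≃g Γ) → ℕ, ∑ d : D, f d = ∑ r : R, f r + ∑ r : R, f (t * r) :=
    sum_reflectionExtension ht.sq hinv htR
  have hDmem : ∀ d, d ∈ D ↔ d ∈ R ∨ t * d ∈ R := fun d => Iff.rfl
  have hDc : Fintype.card D = 18 := by
    have := hsum fun _ => 1
    simp only [Finset.sum_const, Finset.card_univ, smul_eq_mul, mul_one, hR] at this
    exact this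
  have hRD : ∀ r ∈ R, r ∈ D := fun r hr => (hDmem r).2 (Or.inl hr)
  -- the orbit of the fixed vertex of the reflection
  set O := Finset.univ.image fun r : R => (r : Γ ≃g Γ) x with hO
  have hOmem : ∀ v, v ∈ O ↔ ∃ r ∈ R, r x = v := by intro v; simp [hO]
  have hinj : Function.Injective fun r : R => (r : Γ ≃g Γ) x := by
    intro r s h
    have h1 : ((s : Γ ≃g Γ)⁻¹ * r) x = x := by
      rw [aut_mul_apply]; simp only at h; rw [h, aut_inv_apply_self]
    exact Subtype.ext (inv_mul_eq_one.1 (hfree _ (R.mul_mem (R.inv_mem s.2) r.2) x h1)).symm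
  have hOc : O.card = 9 := by
    rw [hO, Finset.card_image_of_injective _ hinj, Finset.card_univ, hR]
  have hOinv : ∀ d ∈ D, ∀ v ∈ O, d v ∈ O := by
    intro d hd v hv
    obtain ⟨r, hr, rfl⟩ := (hOmem v).1 hv
    rw [hOmem]
    rcases (hDmem _).1 (D.mul_mem hd (hRD r hr)) with h | h
    · exact ⟨_, h, rfl⟩
    · refine ⟨_, R.inv_mem h, ?_⟩
      rw [← hi _ h, ← mul_assoc t, ht.sq, one_mul, aut_mul_apply, ht.apply_self, aut_mul_apply]
  have hSinv : ∀ d ∈ D, ∀ v ∈ Oᶜ, d v ∈ Oᶜ := by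
    intro d hd v hv
    rw [Finset.mem_compl] at hv ⊢
    intro h
    have := hOinv _ (D.inv_mem hd) _ h
    rw [aut_inv_apply_self] at this
    exact hv this
  have hsq : ∀ r ∈ R, ∃ s ∈ R, s * s = r := by
    intro r hr
    obtain ⟨s, hs⟩ := (sq_bijective hR).2 ⟨r, hr⟩
    exact ⟨s, s.2, congrArg Subtype.val hs⟩
  have hDfree : ∀ d ∈ D, ∀ v ∈ Oᶜ, d v = v → d = 1 := by
    intro d hd v hv hdv
    rcases (hDmem d).1 hd with h | h
    · exact hfree d h v hdv
    · obtain ⟨s, hs, hsd⟩ := hsq _ h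
      have h1 := isReflection_mul_sq ht (hi s hs)
      rw [hsd, ← mul_assoc, ht.sq, one_mul] at h1
      rw [Finset.mem_compl] at hv
      exact absurd ((hOmem v).2 ⟨_, R.inv_mem hs, ((h1.fix v).1 hdv).symm⟩) hv
  obtain ⟨w, hw, hwd, hwf⟩ := exists_orbit_representatives D 5 Oᶜ hSinv hDfree
    (by rw [Finset.card_compl, hΓ.card, hOc, hDc])
  have hsplit : ∀ f : V → ℕ, (∀ d ∈ D, ∀ v, f (d v) = f v) →
      ∑ v, f v = 9 * f x + 18 * ∑ i, f (w i) := by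
    intro f hf
    rw [← Finset.sum_add_sum_compl O f, hwf f hf, hDc, hO, Finset.sum_image fun a _ b _ h => hinj h,
      Finset.sum_congr rfl fun (r : R) _ => hf r (hRD r r.2) x, Finset.sum_const, Finset.card_univ,
      hR, smul_eq_mul]
  -- numbers of neighbours of the fixed vertex in the orbits
  set β : V → ℕ := fun v => ∑ r : R, if Γ.Adj x ((r : Γ ≃g Γ) v) then 1 else 0 with hβ
  have hxβ : ∀ v, orbitAdj D x v = 2 * β v := by
    intro v
    rw [orbitAdj_eq_sum, hsum fun d => if Γ.Adj x (d v) then 1 else 0, two_mul]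
    refine congrArg₂ (· + ·) rfl (Finset.sum_congr rfl fun r _ => ?_)
    have : Γ.Adj x ((t * (r : Γ ≃g Γ)) v) ↔ Γ.Adj x ((r : Γ ≃g Γ) v) := by
      rw [aut_mul_apply, aut_adj_inv, ht.inv_eq, ht.apply_self]
    simp only [this]
  -- The part from R is even by pairing r with r⁻¹. In the coset, t s² is the reflection at s⁻¹ x,
  -- which sends v to a neighbour exactly when x is adjacent to s v; this contributes β v.
  have hdiag : ∀ v, ∃ k, orbitAdj D v v = 2 * k + β v := by
    intro v
    have h1 : (∑ r : R, if Γ.Adj v ((r : Γ ≃g Γ) v) then 1 else 0) % 2 = 0 := by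
      rw [← Finset.card_filter]
      refine Finset.card_modEq_zero_of_forall_ne 2 1 (fun r : R => r⁻¹) _ ?_ ?_ ?_
      · intro r hr
        rw [Finset.mem_filter] at hr ⊢
        refine ⟨Finset.mem_univ _, ?_⟩
        rw [InvMemClass.coe_inv, aut_adj_inv, inv_inv]
        exact hr.2.symm
      · intro r _; simp
      · intro r hr hri
        rw [Finset.mem_filter] at hr
        have h2 : (r : Γ ≃g Γ) = 1 := eq_one_of_sq_of_mem (pow_nine_of_mem hR r.2)
          (congrArg Subtype.val (mul_eq_one_iff_eq_inv.2 hri.symm))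
        rw [h2] at hr
        exact Γ.irrefl hr.2
    have h2 : (∑ r : R, if Γ.Adj v ((t * (r : Γ ≃g Γ)) v) then 1 else 0) = β v := by
      rw [← (sq_bijective hR).sum_comp]
      refine Finset.sum_congr rfl fun s _ => ?_
      have : Γ.Adj v ((t * ((s * s : R) : Γ ≃g Γ)) v) ↔ Γ.Adj x ((s : Γ ≃g Γ) v) := by
        rw [Subgroup.coe_mul, (isReflection_mul_sq ht (hi s s.2)).moved]
        exact aut_adj_inv.symm
      simp only [this]
    rw [orbitAdj_eq_sum, hsum fun d => if Γ.Adj v (d v) then 1 else 0, h2]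
    exact ⟨_, congrArg (· + β v) (Nat.two_mul_div_two_of_even (Nat.even_iff.2 h1)).symm⟩
  have hj : 3 ∣ β x := hΓ.three_dvd_card_adj hR hc ht hinv
  have hinvA : ∀ v, ∀ d ∈ D, ∀ u, orbitAdj D v (d u) = orbitAdj D v u := fun v d hd u =>
    orbitAdj_apply_right D v u hd
  have hinvM : ∀ v v', ∀ d ∈ D, ∀ u, orbitAdj D v (d u) * orbitAdj D v' (d u) =
      orbitAdj D v u * orbitAdj D v' u := fun v v' d hd u => by
    rw [hinvA v d hd, hinvA v' d hd]
  have e1 := hΓ.sum_orbitAdj D x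
  have e2 := hΓ.sum_orbitAdj_mul D x x
  have hxx : orbitEq D x x = 2 := by
    rw [orbitEq, Finset.card_filter, hsum fun d => if x = d x then 1 else 0]
    have h1 : ∀ r : R, (if x = (r : Γ ≃g Γ) x then 1 else 0) = if r = 1 then 1 else 0 := by
      intro r
      refine if_congr ⟨fun h => Subtype.ext (hfree r r.2 x h.symm), ?_⟩ rfl rfl
      rintro rfl; rfl
    have h2 : ∀ r : R, (if x = (t * (r : Γ ≃g Γ)) x then 1 else 0) = if r = 1 then 1 else 0 := by
      intro r
      rw [← h1]
      refine if_congr ?_ rfl rfl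
      rw [aut_mul_apply, ← aut_inv_eq_iff, ht.inv_eq, ht.apply_self]
    rw [Finset.sum_congr rfl fun r _ => h1 r, Finset.sum_congr rfl fun r _ => h2 r,
      Finset.sum_ite_eq' Finset.univ (1 : R), if_pos (Finset.mem_univ _)]
  rw [hsplit _ (hinvA x), hDc] at e1
  rw [hsplit _ (hinvM x x), hDc, hxx] at e2
  simp only [hxβ] at e1 e2
  have e3 : ∑ i, 2 * β (w i) * (2 * β (w i)) = 4 * ∑ i, β (w i) * β (w i) := by
    rw [Finset.mul_sum]; exact Finset.sum_congr rfl fun i _ => by ring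
  rw [← Finset.mul_sum] at e1
  rw [e3] at e2
  -- With j = β x the relations read j + 2 ∑ β = 14 and j² + j + 2 ∑ β² = 30, and 3 divides j, so j
  -- = 0. The sums over the five free orbits are then 7 and 15.
  have hx0 : β x = 0 := by
    obtain ⟨k, hk⟩ := hj
    rw [hk] at e1 e2
    have : k < 5 := by omega
    interval_cases k
    · exact hk
    all_goals omega
  rw [hx0] at e1 e2
  have hxw : ∀ i, orbitAdj D (w i) x = 2 * β (w i) := fun i => by rw [orbitAdj_comm, hxβ]
  refine no_five_matrix (fun i => β (w i)) (fun i j => orbitAdj D (w i) (w j))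
    (fun i j => orbitAdj_comm D _ _) (by omega) (by omega) ?_ ?_ ?_ ?_ ?_
  · intro i
    have h := hΓ.sum_orbitAdj D (w i)
    rw [hsplit _ (hinvA _), hDc, hxw] at h
    omega
  · intro i
    have h := hΓ.sum_orbitAdj_mul D x (w i)
    have h1 : orbitEq D x (w i) = 0 := by
      rw [orbitEq, Finset.card_eq_zero, Finset.filter_eq_empty_iff]
      intro d _ hd
      have := hSinv d d.2 _ (hw i)
      rw [← hd, Finset.mem_compl, hOmem] at this
      exact this ⟨1, R.one_mem, rfl⟩
    rw [hsplit _ (hinvM x (w i)), hDc, h1] at h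
    simp only [hxβ, hx0] at h
    simp only [mul_assoc] at h
    rw [← Finset.mul_sum] at h
    omega
  · intro i
    have h := hΓ.sum_orbitAdj_mul D (w i) (w i)
    have h1 : orbitEq D (w i) (w i) = 1 := by
      rw [orbitEq, Finset.card_eq_one]
      refine ⟨1, ?_⟩
      ext d
      rw [Finset.mem_filter, Finset.mem_singleton]
      constructor
      · rintro ⟨-, h⟩
        exact Subtype.ext (hDfree d d.2 (w i) (hw i) h.symm)
      · rintro rfl
        exact ⟨Finset.mem_univ _, rfl⟩
    rw [hsplit _ (hinvM (w i) (w i)), hDc, h1, hxw] at h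
    have h2 : 2 * β (w i) * (2 * β (w i)) = 4 * (β (w i) * β (w i)) := by ring
    rw [h2] at h
    omega
  · intro i
    obtain ⟨k, hk⟩ := hdiag (w i)
    simp only [hk]; omega
  · intro i
    obtain ⟨k, hk⟩ := hdiag (w i)
    simp only [hk]; omega

end IsConway99

end OrderNineExclusion

end

/-! ### Groups of orders 6 and 21. -/

section SmallGroups

/-- If elements of orders 2 and 3 commute, their product generates the group. Otherwise the subgroup
of order 2 has trivial core, and the action on its three cosets is faithful. -/
theorem mulEquiv_of_card_eq_six {G : Type*} [Group G] (h : Nat.card G = 6) :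
    Nonempty (G ≃* Multiplicative (ZMod 6)) ∨ Nonempty (G ≃* Equiv.Perm (Fin 3)) := by
  classical
  have hfin : Finite G := Nat.finite_of_card_ne_zero (by rw [h]; norm_num)
  have : Fact (Nat.Prime 2) := ⟨by norm_num⟩
  have : Fact (Nat.Prime 3) := ⟨by norm_num⟩
  obtain ⟨t, ht⟩ := exists_prime_orderOf_dvd_card' (G := G) 2 (by rw [h]; norm_num)
  obtain ⟨g, hg⟩ := exists_prime_orderOf_dvd_card' (G := G) 3 (by rw [h]; norm_num)
  by_cases hc : t * g = g * t
  · left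
    have h1 : orderOf (t * g) = 6 := by
      rw [(show Commute t g from hc).orderOf_mul_eq_mul_orderOf_of_coprime (by rw [ht, hg]; decide),
        ht, hg]
    have : IsCyclic G := isCyclic_of_orderOf_eq_card (t * g) (by rw [h1, h])
    exact ⟨mulEquivOfCyclicCardEq (by rw [h]; simp)⟩
  · right
    set H := Subgroup.zpowers t with hH
    have hHc : Nat.card H = 2 := by rw [hH, Nat.card_zpowers, ht]
    have hi : Nat.card (G ⧸ H) = 3 := by
      have := Subgroup.card_eq_card_quotient_mul_card_subgroup H
      rw [h, hHc] at this; omega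
    have hcore : H.normalCore = ⊥ := by
      rw [Subgroup.eq_bot_iff_forall]
      by_contra! hcon
      obtain ⟨s, hs, hs1⟩ := hcon
      have hmem : ∀ s ∈ H, s = 1 ∨ s = t := by
        intro s hs
        rw [hH, mem_zpowers_iff_mem_range_orderOf, ht] at hs
        obtain ⟨k, hk, rfl⟩ := Finset.mem_image.1 hs
        have hk2 : k < 2 := Finset.mem_range.1 hk
        interval_cases k <;> simp
      have hst := (hmem s (H.normalCore_le hs)).resolve_left hs1
      subst hst
      have h2 := H.normalCore_le (H.normalCore_normal.conj_mem s hs g)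
      rcases hmem _ h2 with h3 | h3
      · exact hs1 (conj_eq_one_iff.1 h3)
      · exact hc (mul_inv_eq_iff_eq_mul.1 h3).symm
    rw [Subgroup.normalCore_eq_ker, MonoidHom.ker_eq_bot_iff] at hcore
    have hfq : Finite (G ⧸ H) := inferInstance
    obtain ⟨e⟩ : Nonempty (G ⧸ H ≃ Fin 3) := ⟨Finite.equivFinOfCardEq hi⟩
    let φ : G →* Equiv.Perm (Fin 3) :=
      (e.permCongrHom.toMonoidHom).comp (MulAction.toPermHom G (G ⧸ H))
    have hφ : Function.Injective φ := e.permCongrHom.injective.comp hcore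
    refine ⟨MulEquiv.ofBijective φ ((Nat.bijective_iff_injective_and_card φ).2 ⟨hφ, ?_⟩)⟩
    rw [h, Nat.card_perm, Nat.card_eq_fintype_card, Fintype.card_fin]
    rfl

/-- A group of order `21` in which some element of order `3` generates a group acting faithfully
on a normal subgroup of order `7` is the Frobenius group. -/
theorem mulEquiv_frob21 {G : Type*} [Group G] (h : Nat.card G = 21) {z c : G}
    (hz : orderOf z = 7) (hcz : orderOf c = 3) (hn : (Subgroup.zpowers z).Normal)
    (hf : ∀ k ∈ Subgroup.zpowers c, k * z = z * k → k = 1) : Nonempty (G ≃* Frob21) := by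
  have hfin : Finite G := Nat.finite_of_card_ne_zero (by rw [h]; norm_num)
  have : Fact (Nat.Prime 7) := ⟨by norm_num⟩
  set N := Subgroup.zpowers z with hN
  set K := Subgroup.zpowers c with hK
  have hNc : Nat.card N = 7 := by rw [hN, Nat.card_zpowers, hz]
  have hKc : Nat.card K = 3 := by rw [hK, Nat.card_zpowers, hcz]
  have hcomp : N.IsComplement' K :=
    Subgroup.isComplement'_of_coprime (by rw [hNc, hKc, h]) (by rw [hNc, hKc]; decide)
  let e : N ≃* Multiplicative (ZMod 7) := mulEquivOfPrimeCardEq hNc (by simp)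
  let ψ : K →* MulAut N :=
    (N.normalizerMonoidHom).comp (Subgroup.inclusion (N.normalizer_eq_top ▸ le_top))
  have hψ : Function.Injective ψ := by
    rw [injective_iff_map_eq_one]
    intro k hk
    refine Subtype.ext (hf k k.2 ?_)
    have h1 : ψ k ⟨z, Subgroup.mem_zpowers z⟩ = ⟨z, Subgroup.mem_zpowers z⟩ := by
      rw [hk]; rfl
    have h2 : (k : G) * z * (k : G)⁻¹ = z := congrArg Subtype.val h1
    exact mul_inv_eq_iff_eq_mul.1 h2
  let E := SemidirectProduct.mulEquivSubgroup hcomp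
  let F : N ⋊[ψ] K →* HolZ7 := SemidirectProduct.map e.toMonoidHom
    ((MulAut.congr e).toMonoidHom.comp ψ) (by
      intro k
      ext n
      simp)
  have hF : Function.Injective F := by
    intro a b hab
    have h1 := congrArg SemidirectProduct.left hab
    have h2 := congrArg SemidirectProduct.right hab
    simp only [F, SemidirectProduct.map_left, SemidirectProduct.map_right] at h1 h2
    exact SemidirectProduct.ext (e.injective h1) (hψ ((MulAut.congr e).injective h2))
  let Φ : G →* HolZ7 := F.comp E.symm.toMonoidHom
  have hΦ : Function.Injective Φ := hF.comp E.symm.injective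
  have hrange : Φ.range = Frob21 := by
    refine eq_frob21_of_index _ ?_
    have h1 := Φ.range.card_mul_index
    rw [Nat.card_congr (MonoidHom.ofInjective hΦ).symm.toEquiv, h, holZ7_card] at h1
    omega
  exact ⟨(MonoidHom.ofInjective hΦ).trans (MulEquiv.subgroupCongr hrange)⟩

end SmallGroups

section

open scoped Classical

/-! ### Groups of even order. -/

section EvenOrder

variable {V : Type*} [Fintype V] {Γ : SimpleGraph V}

/-- Conjugation by a reflection on a subgroup which it normalizes. -/
theorem IsReflection.exists_conj {t : Γ ≃g Γ} {x : V} (ht : IsReflection t x)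
    {P : Subgroup (Γ ≃g Γ)} (h : ∀ q ∈ P, t * q * t ∈ P) :
    ∃ σ : P ≃* P, (∀ q : P, ((σ q : P) : Γ ≃g Γ) = t * q * t) ∧ ∀ q, σ (σ q) = q := by
  have hs : ∀ q : P, (⟨t * (t * (q : Γ ≃g Γ) * t) * t, h _ (h q q.2)⟩ : P) = q := fun q =>
    Subtype.ext (ht.mul_mul_cancel _)
  refine ⟨{ toFun := fun q => ⟨t * q * t, h q q.2⟩
            invFun := fun q => ⟨t * q * t, h q q.2⟩
            left_inv := hs
            right_inv := hs
            map_mul' := fun a b => Subtype.ext ?_ }, fun q => rfl, hs⟩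
  simp only [Subgroup.coe_mul, mul_assoc]
  rw [← mul_assoc t t, ht.sq, one_mul]

namespace IsConway99

variable (hΓ : IsConway99 Γ)

include hΓ

/-- If an automorphism group of even order has order divisible by `p`, then some reflection
centralizes or inverts an element of order `p`. -/
theorem exists_fixed_or_inverted {t₀ : Γ ≃g Γ} {x₀ : V} (ht₀ : IsReflection t₀ x₀) {p : ℕ}
    (hp : p.Prime) (hp2 : p ≠ 2) (hd : p ∣ Nat.card (Γ ≃g Γ)) :
    ∃ (t : Γ ≃g Γ) (x : V) (z : Γ ≃g Γ), IsReflection t x ∧ orderOf z = p ∧ (z * t = t * z ∨ t * z * t = z⁻¹) := by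
  have : Fact p.Prime := ⟨hp⟩
  obtain ⟨P⟩ : Nonempty (Sylow p (Γ ≃g Γ)) := inferInstance
  obtain ⟨t, x, ht, hP⟩ := hΓ.exists_reflection_normalizing ht₀ hp2 P
  obtain ⟨σ, hσ, hσσ⟩ := ht.exists_conj (P := P) hP
  have hnt : Nontrivial P := by
    refine Finite.one_lt_card_iff_nontrivial.1 (lt_of_lt_of_le hp.one_lt
      (Nat.le_of_dvd Nat.card_pos (P.dvd_card_of_dvd_card hd)))
  obtain ⟨z, hz, -, h⟩ := P.2.exists_central_fixed_or_inverted σ hσσ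
  refine ⟨t, x, z, ht, by rw [Subgroup.orderOf_coe, hz], h.imp (fun h => ?_) fun h => ?_⟩
  · have h1 : t * (z : Γ ≃g Γ) * t = z := by rw [← hσ, h]
    conv_lhs => rw [← h1]
    rw [mul_assoc, ht.sq, mul_one]
  · rw [← hσ, h, InvMemClass.coe_inv]

/-- If t inverts z, it preserves the unique fixed vertex of z, which is therefore x; but then z
commutes with t, so z² = 1. Centralizing is excluded by `no_order_fourteen`. -/
theorem not_seven_dvd_of_reflection {t₀ : Γ ≃g Γ} {x₀ : V} (ht₀ : IsReflection t₀ x₀) :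
    ¬ 7 ∣ Nat.card (Γ ≃g Γ) := by
  intro hd
  obtain ⟨t, x, z, ht, hz, h⟩ := hΓ.exists_fixed_or_inverted ht₀ (by norm_num) (by norm_num) hd
  have hz7 : z ^ 7 = 1 := by rw [← hz, pow_orderOf_eq_one]
  have hz1 : z ≠ 1 := by rintro rfl; rw [orderOf_one] at hz; omega
  refine hΓ.no_order_fourteen ht hz7 hz1 (h.resolve_right fun hi => ?_)
  have h1 := hΓ.reflection_mem_of_odd ht (B := fixedSet z) (by
    intro w hw
    rw [mem_fixedSet] at hw ⊢
    have h3 := ht.apply_inverted hi w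
    rw [hw] at h3
    exact mem_fixedSet_inv.1 h3.symm)
  rw [hΓ.seven_card_fixedSet hz7 hz1] at h1
  split_ifs at h1 with hx
  have h2 := hΓ.reflection_commute ht (mem_fixedSet.1 hx)
  rw [← h2, mul_assoc, ht.sq, mul_one] at hi
  have h3 : z * z = 1 := mul_eq_one_iff_eq_inv.2 hi
  apply hz1
  rw [← hz7, show 7 = 2 * 3 + 1 from rfl, pow_succ, pow_mul, pow_two, h3, one_pow, one_mul]

theorem not_eleven_dvd_of_reflection {t₀ : Γ ≃g Γ} {x₀ : V} (ht₀ : IsReflection t₀ x₀) :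
    ¬ 11 ∣ Nat.card (Γ ≃g Γ) := by
  intro hd
  obtain ⟨t, x, z, ht, hz, h⟩ := hΓ.exists_fixed_or_inverted ht₀ (by norm_num) (by norm_num) hd
  have hz7 : z ^ 11 = 1 := by rw [← hz, pow_orderOf_eq_one]
  have hz1 : z ≠ 1 := by rintro rfl; rw [orderOf_one] at hz; omega
  rcases h with h | h
  · exact hΓ.ne_of_fixedSet_card_zero (hΓ.card_fixedSet_eq_zero_of_eleven hz7 hz1) x
      (fixed_of_reflection_commute ht h)
  · exact hΓ.not_eleven_inverted ht hz7 hz1 h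

/-- A Sylow 3-subgroup normalized by a reflection contains an invariant subgroup of order 9, which
is abelian as a group of order p². -/
theorem not_nine_dvd_of_reflection {t₀ : Γ ≃g Γ} {x₀ : V} (ht₀ : IsReflection t₀ x₀) :
    ¬ 9 ∣ Nat.card (Γ ≃g Γ) := by
  intro hd
  have : Fact (Nat.Prime 3) := ⟨by norm_num⟩
  obtain ⟨P⟩ : Nonempty (Sylow 3 (Γ ≃g Γ)) := inferInstance
  obtain ⟨t, x, ht, hP⟩ := hΓ.exists_reflection_normalizing ht₀ (by norm_num) P
  obtain ⟨σ, hσ, hσσ⟩ := ht.exists_conj (P := P) hP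
  obtain ⟨R, hR, hRσ⟩ := P.2.exists_invariant_card_sq σ hσσ
    (P.pow_dvd_card_of_pow_dvd_card (n := 2) hd)
  have hRc : ∀ a ∈ R, ∀ b ∈ R, a * b = b * a := fun a ha b hb =>
    congrArg Subtype.val ((IsPGroup.isMulCommutative_of_card_eq_prime_sq hR).is_comm.comm
      (⟨a, ha⟩ : R) ⟨b, hb⟩)
  refine hΓ.not_normalizes_order_nine (R := R.map (P : Subgroup (Γ ≃g Γ)).subtype) ?_ ?_ ht ?_
  · rw [← Nat.card_eq_fintype_card, Subgroup.card_map_of_injective (Subgroup.subtype_injective _),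
      hR]
    norm_num
  · rintro _ ⟨a, ha, rfl⟩ _ ⟨b, hb, rfl⟩
    rw [← map_mul, hRc a ha b hb, map_mul]
  · rintro _ ⟨a, ha, rfl⟩
    exact ⟨σ a, hRσ a ha, hσ a⟩

/-- With 7, 11 and 9 excluded, the kernel of the sign, of index 2, is a 3-group of order 1 or 3. -/
theorem card_eq_two_or_six (h2 : 2 ∣ Nat.card (Γ ≃g Γ)) :
    Nat.card (Γ ≃g Γ) = 2 ∨ Nat.card (Γ ≃g Γ) = 6 := by
  have : Fact (Nat.Prime 2) := ⟨by norm_num⟩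
  obtain ⟨t, ht⟩ := exists_prime_orderOf_dvd_card' (G := Γ ≃g Γ) 2 h2
  obtain ⟨x, hx⟩ := hΓ.exists_isReflection (t := t)
    (by rw [← pow_two, ← ht, pow_orderOf_eq_one])
    (by rintro rfl; rw [orderOf_one] at ht; omega)
  have hc := hΓ.card_aut_eq hx
  have hodd := hΓ.card_ker_autSign_odd
  have h7 := hΓ.not_seven_dvd_of_reflection hx
  have h11 := hΓ.not_eleven_dvd_of_reflection hx
  have h9 := hΓ.not_nine_dvd_of_reflection hx
  have hK : Nat.card (autSign Γ).ker ≠ 0 := Nat.card_pos.ne'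
  have h3 := Nat.eq_prime_pow_of_unique_prime_dvd (p := 3) hK fun {d} hd hdvd => by
    have : Fact d.Prime := ⟨hd⟩
    have hd2 : d ≠ 2 := by
      rintro rfl
      exact (Nat.not_even_iff_odd.2 hodd) (even_iff_two_dvd.2 hdvd)
    have hdG : d ∣ Nat.card (Γ ≃g Γ) := by rw [hc]; exact hdvd.mul_left 2
    obtain ⟨g, hg⟩ := exists_prime_orderOf_dvd_card' (G := Γ ≃g Γ) d hdG
    rcases hΓ.prime_order_cases hd hd2 hg with h | h | h
    · exact h
    · exact absurd (h ▸ hdG) h7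
    · exact absurd (h ▸ hdG) h11
  generalize (Nat.card (autSign Γ).ker).primeFactorsList.length = k at h3
  have hk : k < 2 := by
    by_contra hk
    apply h9
    rw [hc, h3]
    exact (pow_dvd_pow 3 (not_lt.1 hk)).mul_left 2
  rw [hc, h3]
  interval_cases k <;> simp

end IsConway99

end EvenOrder

end

section

open scoped Classical

/-! ### Groups of odd order divisible by 7. -/

section OddOrder

variable {V : Type*} [Fintype V] {Γ : SimpleGraph V}

/-- The order of a group of automorphisms which acts freely on a set of vertices divides the size
of the set. -/
theorem card_dvd_of_free (H : Subgroup (Γ ≃g Γ)) (B : Finset V) (hB : ∀ h ∈ H, ∀ v ∈ B, h v ∈ B)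
    (hf : ∀ h ∈ H, h ≠ 1 → ∀ v ∈ B, h v ≠ v) : Nat.card H ∣ B.card := by
  have h := card_dvd_sum_card_fixed_vertices H B hB
  rw [← Finset.add_sum_erase _ _ (Finset.mem_univ 1), OneMemClass.coe_one,
    Finset.filter_true_of_mem (fun v _ => aut_one_apply v), Finset.sum_eq_zero, add_zero] at h
  · rwa [Nat.card_eq_fintype_card]
  · intro g hg
    rw [Finset.card_eq_zero]
    exact Finset.filter_false_of_mem fun v hv =>
      hf g g.2 (fun h1 => (Finset.mem_erase.1 hg).1 (Subtype.ext h1)) v hv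

theorem pow_card_of_mem {H : Subgroup (Γ ≃g Γ)} {n : ℕ} (hH : Nat.card H = n) {g : Γ ≃g Γ}
    (hg : g ∈ H) : g ^ n = 1 := by
  have : (⟨g, hg⟩ : H) ^ Nat.card H = 1 := pow_card_eq_one'
  rw [hH] at this
  exact congrArg Subtype.val this

namespace IsConway99

variable (hΓ : IsConway99 Γ)

include hΓ

/-- Such a group would act freely on the 99 vertices. -/
theorem not_card_eq_121 (H : Subgroup (Γ ≃g Γ)) : Nat.card H ≠ 11 ^ 2 := by
  intro hH
  have : Fact (Nat.Prime 11) := ⟨by norm_num⟩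
  have h := card_dvd_of_free H Finset.univ (by simp) fun g hg h1 v _ => by
    have h2 := pow_card_of_mem hH hg
    have h3 := hΓ.card_fixedSet_modEq h2
    refine hΓ.ne_of_fixedSet_card_zero ?_ v
    rcases hΓ.odd_cases (by decide) h2 h1 with h | h | h
    · exact h
    · rw [h] at h3; exact absurd h3 (by decide)
    · rw [h.1] at h3; exact absurd h3 (by decide)
  rw [hH, Finset.card_univ, hΓ.card] at h
  exact absurd h (by decide)

/-- As 7 does not divide 99, such a group fixes a vertex; it would act freely on its 14 neighbours.
-/
theorem not_card_eq_49 (H : Subgroup (Γ ≃g Γ)) : Nat.card H ≠ 7 ^ 2 := by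
  intro hH
  have : Fact (Nat.Prime 7) := ⟨by norm_num⟩
  have hP : IsPGroup 7 H := IsPGroup.of_card hH
  obtain ⟨x, hx⟩ := hP.nonempty_fixed_point_of_prime_not_dvd_card V
    (by rw [Nat.card_eq_fintype_card, hΓ.card]; decide)
  have hfix : ∀ g ∈ H, g x = x := fun g hg => hx ⟨g, hg⟩
  have h := card_dvd_of_free H (nbrs Γ x)
    (fun g hg v hv => by
      rw [mem_nbrs] at hv ⊢
      exact (nbrs_invariant (hfix g hg)).2 hv) fun g hg h1 v hv hgv => by
    have h2 := pow_card_of_mem hH hg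
    have h3 := hΓ.card_fixedSet_modEq h2
    have h4 : (fixedSet g).card = 1 := by
      rcases hΓ.odd_cases (by decide) h2 h1 with h | h | h
      · rw [h] at h3; exact absurd h3 (by decide)
      · exact h
      · rw [h.1] at h3; exact absurd h3 (by decide)
    rw [mem_nbrs] at hv
    exact hv.ne (Finset.card_le_one.1 h4.le x (mem_fixedSet.2 (hfix g hg)) v (mem_fixedSet.2 hgv))
  rw [hH, hΓ.card_nbrs] at h
  exact absurd h (by decide)

/-- A group of automorphisms which fixes a vertex has no subgroup of order `9`. -/
theorem not_nine_dvd_of_fixed (H : Subgroup (Γ ≃g Γ)) {x : V} (hx : ∀ h ∈ H, h x = x) :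
    ¬ 3 ^ 2 ∣ Nat.card H := by
  intro hd
  have : Fact (Nat.Prime 3) := ⟨by norm_num⟩
  obtain ⟨R, hR⟩ := Sylow.exists_subgroup_card_pow_prime 3 hd
  obtain ⟨r, ⟨s, -, rfl⟩, hr⟩ := hΓ.exists_not_fixed (R := R.map H.subtype) (by
    rw [← Nat.card_eq_fintype_card, Subgroup.card_map_of_injective (Subgroup.subtype_injective _),
      hR]
    norm_num) x
  exact hr (hx s s.2)

/-- Vertex stabilizers have order 1 or 3, so all orbit lengths, and hence 99, would be divisible by
27. -/
theorem not_card_eq_81 (H : Subgroup (Γ ≃g Γ)) : Nat.card H ≠ 3 ^ 4 := by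
  intro hH
  have : Fact (Nat.Prime 3) := ⟨by norm_num⟩
  have hs : ∀ v : V, Nat.card (MulAction.stabilizer H v) ∣ 3 := by
    intro v
    have h1 : Nat.card (MulAction.stabilizer H v) ∣ 3 ^ 4 := by
      rw [← hH]; exact Subgroup.card_subgroup_dvd_card _
    obtain ⟨k, -, hk⟩ := (Nat.dvd_prime_pow Nat.prime_three).1 h1
    rw [hk]
    have hk2 : k < 2 := by
      by_contra hk2
      refine hΓ.not_nine_dvd_of_fixed ((MulAction.stabilizer H v).map H.subtype) (x := v) ?_ ?_
      · rintro _ ⟨g, hg, rfl⟩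
        exact MulAction.mem_stabilizer_iff.1 hg
      · rw [Subgroup.card_map_of_injective (Subgroup.subtype_injective _), hk]
        exact pow_dvd_pow 3 (not_lt.1 hk2)
    exact pow_dvd_pow 3 (Nat.lt_succ_iff.1 hk2) |>.trans (by norm_num)
  have h := MulAction.card_eq_sum_card_group_div_card_stabilizer H V
  have h27 : 27 ∣ Fintype.card V := by
    rw [h]
    refine Finset.dvd_sum fun ω _ => ?_
    rw [← Nat.card_eq_fintype_card, ← Nat.card_eq_fintype_card, hH]
    rcases (Nat.dvd_prime Nat.prime_three).1 (hs ω.out) with h | h <;> rw [h] <;> decide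
  rw [hΓ.card] at h27
  exact absurd h27 (by decide)

theorem card_dvd_of_odd (h2 : ¬ 2 ∣ Nat.card (Γ ≃g Γ)) : Nat.card (Γ ≃g Γ) ∣ 3 ^ 3 * 7 * 11 := by
  rw [Nat.dvd_iff_prime_pow_dvd_dvd]
  intro p k hp hk
  have : Fact p.Prime := ⟨hp⟩
  rcases Nat.eq_zero_or_pos k with rfl | hk0
  · exact one_dvd _
  have hpG : p ∣ Nat.card (Γ ≃g Γ) := (dvd_pow_self p hk0.ne').trans hk
  obtain ⟨g, hg⟩ := exists_prime_orderOf_dvd_card' p hpG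
  have hbound : ∀ n, (∀ H : Subgroup (Γ ≃g Γ), Nat.card H ≠ p ^ (n + 1)) → p ^ k ∣ p ^ n := by
    intro n hn
    refine pow_dvd_pow p ?_
    by_contra hlt
    obtain ⟨H, hH⟩ := Sylow.exists_subgroup_card_pow_prime p
      ((pow_dvd_pow p (show n + 1 ≤ k by omega)).trans hk)
    exact hn H hH
  rcases hΓ.prime_order_cases hp (by rintro rfl; exact h2 hpG) hg with rfl | rfl | rfl
  · exact (hbound 3 hΓ.not_card_eq_81).trans (by norm_num)
  · exact (hbound 1 hΓ.not_card_eq_49).trans (by norm_num)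
  · exact (hbound 1 hΓ.not_card_eq_121).trans (by norm_num)

omit hΓ [Fintype V] in
theorem eq_one_of_dvd_of_mod {n m p : ℕ} (hm : m ≠ 0) (h : n ∣ m) (hp : n % p = 1)
    (hall : ∀ k ∈ Nat.divisors m, k % p = 1 → k = 1) : n = 1 :=
  hall n (Nat.mem_divisors.2 ⟨h, hm⟩) hp

omit hΓ in
theorem sylow_conj_mem {p : ℕ} [Fact p.Prime] (h : Nat.card (Sylow p (Γ ≃g Γ)) = 1)
    (P : Sylow p (Γ ≃g Γ)) {q : Γ ≃g Γ} (hq : q ∈ P) (g : Γ ≃g Γ) : g * q * g⁻¹ ∈ P := by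
  have hsub : Subsingleton (Sylow p (Γ ≃g Γ)) := (Nat.card_eq_one_iff_unique.1 h).1
  exact (Sylow.normal_of_subsingleton P).conj_mem q hq g

/-- The Sylow 11-subgroup is normal, so an element of order 7 fixing x acts on the 11 vertices of
its orbit through x. It would fix at least 4 of them, as 11 ≡ 4 mod 7, yet it fixes only one vertex.
-/
theorem not_eleven_dvd_of_seven_dvd (h2 : ¬ 2 ∣ Nat.card (Γ ≃g Γ)) (h7 : 7 ∣ Nat.card (Γ ≃g Γ)) :
    ¬ 11 ∣ Nat.card (Γ ≃g Γ) := by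
  intro h11
  have : Fact (Nat.Prime 11) := ⟨by norm_num⟩
  have : Fact (Nat.Prime 7) := ⟨by norm_num⟩
  have hd := hΓ.card_dvd_of_odd h2
  obtain ⟨Q⟩ : Nonempty (Sylow 11 (Γ ≃g Γ)) := inferInstance
  have hn : Nat.card (Sylow 11 (Γ ≃g Γ)) = 1 := by
    refine eq_one_of_dvd_of_mod (m := 3 ^ 3 * 7 * 11) (by norm_num)
      ((Q.card_dvd_index.trans (Subgroup.index_dvd_card _)).trans hd)
      (card_sylow_modEq_one 11 _) ?_
    decide +kernel
  have hQ : Nat.card Q = 11 := by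
    have h1 : Nat.card Q ∣ 3 ^ 3 * 7 * 11 := (Subgroup.card_subgroup_dvd_card _).trans hd
    obtain ⟨k, hk⟩ := (IsPGroup.iff_card).1 Q.2
    have h3 : 11 ∣ Nat.card Q := Q.dvd_card_of_dvd_card h11
    rw [hk] at h1 h3 ⊢
    have hk2 : k < 2 := by
      by_contra hk2
      exact absurd ((pow_dvd_pow 11 (not_lt.1 hk2)).trans h1) (by norm_num)
    interval_cases k
    · exact absurd h3 (by norm_num)
    · rfl
  obtain ⟨g, hg⟩ := exists_prime_orderOf_dvd_card' (G := Γ ≃g Γ) 7 h7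
  have hg7 : g ^ 7 = 1 := by rw [← hg, pow_orderOf_eq_one]
  have hg1 : g ≠ 1 := by rintro rfl; rw [orderOf_one] at hg; omega
  have hfix := hΓ.seven_card_fixedSet hg7 hg1
  obtain ⟨x, hx⟩ := Finset.card_eq_one.1 hfix
  have hgx : g x = x := by
    rw [← mem_fixedSet, hx]; exact Finset.mem_singleton_self x
  set O := Finset.univ.image fun q : Q => (q : Γ ≃g Γ) x with hO
  have hOc : O.card = 11 := by
    rw [hO, Finset.card_image_of_injective, Finset.card_univ, ← Nat.card_eq_fintype_card]
    · exact hQ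
    intro a b hab
    have h1 : ((b : Γ ≃g Γ)⁻¹ * a) x = x := by
      rw [aut_mul_apply]; simp only at hab; rw [hab, aut_inv_apply_self]
    have hm : (b : Γ ≃g Γ)⁻¹ * a ∈ (Q : Subgroup (Γ ≃g Γ)) := Q.mul_mem (Q.inv_mem b.2) a.2
    by_contra hne
    have hne1 : (b : Γ ≃g Γ)⁻¹ * a ≠ 1 := fun h => hne (Subtype.ext (inv_mul_eq_one.1 h)).symm
    exact hΓ.ne_of_fixedSet_card_zero
      (hΓ.card_fixedSet_eq_zero_of_eleven (pow_card_of_mem hQ hm) hne1) x h1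
  have h1 := aut_card_modEq (p := 7) (n := 1) (g := g) (by rwa [pow_one]) O (by
    intro v hv
    obtain ⟨q, -, rfl⟩ := Finset.mem_image.1 hv
    refine Finset.mem_image.2 ⟨⟨g * q * g⁻¹, sylow_conj_mem hn Q q.2 g⟩, Finset.mem_univ _, ?_⟩
    simp only [aut_mul_apply]
    rw [aut_inv_eq_iff.2 hgx.symm])
  have h3 : (O.filter fun v => g v = v).card ≤ 1 := by
    rw [← hfix]
    exact Finset.card_le_card fun v hv => mem_fixedSet.2 (Finset.mem_filter.1 hv).2
  rw [hOc] at h1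
  have h4 : 11 % 7 = (O.filter fun v => g v = v).card % 7 := h1
  omega

theorem card_eq_seven_or (h2 : ¬ 2 ∣ Nat.card (Γ ≃g Γ)) (h7 : 7 ∣ Nat.card (Γ ≃g Γ)) :
    (Nat.card (Γ ≃g Γ) = 7 ∨ Nat.card (Γ ≃g Γ) = 21) ∧
      ∃ z : Γ ≃g Γ, orderOf z = 7 ∧ (Subgroup.zpowers z).Normal := by
  have : Fact (Nat.Prime 7) := ⟨by norm_num⟩
  have hd := hΓ.card_dvd_of_odd h2
  have h11 := hΓ.not_eleven_dvd_of_seven_dvd h2 h7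
  have hd' : Nat.card (Γ ≃g Γ) ∣ 3 ^ 3 * 7 :=
    (((Nat.Prime.coprime_iff_not_dvd (by norm_num : Nat.Prime 11)).2 h11).symm).dvd_of_dvd_mul_right
      hd
  obtain ⟨P⟩ : Nonempty (Sylow 7 (Γ ≃g Γ)) := inferInstance
  have hn : Nat.card (Sylow 7 (Γ ≃g Γ)) = 1 := by
    refine eq_one_of_dvd_of_mod (m := 3 ^ 3 * 7) (by norm_num)
      ((P.card_dvd_index.trans (Subgroup.index_dvd_card _)).trans hd')
      (card_sylow_modEq_one 7 _) ?_
    decide +kernel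
  have hP : Nat.card P = 7 := by
    have h1 : Nat.card P ∣ 3 ^ 3 * 7 := (Subgroup.card_subgroup_dvd_card _).trans hd'
    obtain ⟨k, hk⟩ := (IsPGroup.iff_card).1 P.2
    have h3 : 7 ∣ Nat.card P := P.dvd_card_of_dvd_card h7
    rw [hk] at h1 h3 ⊢
    have hk2 : k < 2 := by
      by_contra hk2
      exact absurd ((pow_dvd_pow 7 (not_lt.1 hk2)).trans h1) (by norm_num)
    interval_cases k
    · exact absurd h3 (by norm_num)
    · rfl
  obtain ⟨⟨z, hzP⟩, hz⟩ := exists_prime_orderOf_dvd_card' (G := P) 7 (by rw [hP])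
  rw [Subgroup.orderOf_mk] at hz
  have hzpow : Subgroup.zpowers z = P :=
    Subgroup.eq_of_le_of_card_ge (Subgroup.zpowers_le.2 hzP) (by
      rw [Nat.card_zpowers, hz]; exact hP.le)
  have hnormal : (Subgroup.zpowers z).Normal := by
    rw [hzpow]
    exact ⟨fun q hq g => sylow_conj_mem hn P hq g⟩
  refine ⟨?_, z, hz, hnormal⟩
  have hz7 : z ^ 7 = 1 := by rw [← hz, pow_orderOf_eq_one]
  have hz1 : z ≠ 1 := by rintro rfl; rw [orderOf_one] at hz; omega
  have hfix := hΓ.seven_card_fixedSet hz7 hz1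
  obtain ⟨x, hx⟩ := Finset.card_eq_one.1 hfix
  have hzx : ∀ v, z v = v ↔ v = x := by
    intro v; rw [← mem_fixedSet, hx, Finset.mem_singleton]
  -- Conjugates of z are powers of z and fix x, so z fixes g x; uniqueness of its fixed vertex gives
  -- g x = x.
  have hGx : ∀ g : Γ ≃g Γ, g x = x := by
    intro g
    rw [← hzx]
    have h1 := hnormal.conj_mem z (Subgroup.mem_zpowers z) g⁻¹
    rw [mem_zpowers_iff_mem_range_orderOf] at h1
    obtain ⟨k, -, hk⟩ := Finset.mem_image.1 h1
    have h3 : (g⁻¹ * z * g⁻¹⁻¹) x = x := by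
      rw [← hk]; exact aut_pow_fixed ((hzx x).2 rfl) k
    rw [inv_inv, aut_mul_apply, aut_mul_apply, aut_inv_eq_iff] at h3
    exact h3
  have h9 := hΓ.not_nine_dvd_of_fixed ⊤ (x := x) fun g _ => hGx g
  rw [Subgroup.card_top] at h9
  have hdec : ∀ n ∈ Nat.divisors (3 ^ 3 * 7), 7 ∣ n → ¬ 3 ^ 2 ∣ n → n = 7 ∨ n = 21 := by
    decide +kernel
  exact hdec _ (Nat.mem_divisors.2 ⟨hd', by norm_num⟩) h7 h9

/-- Elements of orders `3` and `7` do not commute. -/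
theorem eq_one_of_commute_seven {z k : Γ ≃g Γ} (hz : orderOf z = 7) (hk : k ^ 3 = 1)
    (h : k * z = z * k) : k = 1 := by
  by_contra hk1
  have : Fact (Nat.Prime 7) := ⟨by norm_num⟩
  have hz7 : z ^ 7 = 1 := by rw [← hz, pow_orderOf_eq_one]
  have hz1 : z ≠ 1 := by rintro rfl; rw [orderOf_one] at hz; omega
  have hfix := hΓ.seven_card_fixedSet hz7 hz1
  obtain ⟨x, hx⟩ := Finset.card_eq_one.1 hfix
  have hzx : ∀ v, z v = v ↔ v = x := by
    intro v; rw [← mem_fixedSet, hx, Finset.mem_singleton]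
  have hkx : k x = x := by
    rw [← hzx, ← aut_mul_apply, ← h, aut_mul_apply, (hzx x).2 rfl]
  rcases hΓ.three_pow_cases (n := 1) (by simpa using hk) hk1 with h0 | ⟨h0, -⟩
  · exact hΓ.ne_of_fixedSet_card_zero h0 x hkx
  -- Since z permutes the three fixed vertices of k, it would fix all three, whereas it fixes only
  -- one vertex.
  have h1 := aut_card_modEq (p := 7) (n := 1) (g := z) (by rwa [pow_one]) (fixedSet k) (by
    intro v hv
    rw [mem_fixedSet] at hv ⊢
    rw [← aut_mul_apply, h, aut_mul_apply, hv])
  have h3 : ((fixedSet k).filter fun v => z v = v).card ≤ 1 := by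
    rw [← hfix]
    exact Finset.card_le_card fun v hv => mem_fixedSet.2 (Finset.mem_filter.1 hv).2
  rw [h0] at h1
  have h4 : 3 % 7 = ((fixedSet k).filter fun v => z v = v).card % 7 := h1
  omega

end IsConway99

end OddOrder

end

/-! ### Structure of the automorphism group. -/

theorem corollary4p4 {V : Type*} [Fintype V] (Γ : SimpleGraph V)
    [DecidableRel Γ.Adj] (hΓ : Γ.IsSRGWith 99 14 1 2) :
    (2 ∣ Nat.card (Γ ≃g Γ) →
      Nat.card (Γ ≃g Γ) ∣ 6 ∧
        (Nonempty ((Γ ≃g Γ) ≃* Multiplicative (ZMod 2)) ∨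
          Nonempty ((Γ ≃g Γ) ≃* Multiplicative (ZMod 6)) ∨
          Nonempty ((Γ ≃g Γ) ≃* Equiv.Perm (Fin 3)))) ∧
    (7 ∣ Nat.card (Γ ≃g Γ) →
      Nonempty ((Γ ≃g Γ) ≃* Multiplicative (ZMod 7)) ∨
        Nonempty ((Γ ≃g Γ) ≃* Frob21)) := by
  have hC := hΓ.isConway99
  refine ⟨fun h2 => ?_, fun h7 => ?_⟩
  · rcases hC.card_eq_two_or_six h2 with h | h
    · have : Fact (Nat.Prime 2) := ⟨Nat.prime_two⟩
      exact ⟨by rw [h]; norm_num, Or.inl ⟨mulEquivOfPrimeCardEq h (by simp)⟩⟩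
    · exact ⟨by rw [h], Or.inr (mulEquiv_of_card_eq_six h)⟩
  · have h2 : ¬ 2 ∣ Nat.card (Γ ≃g Γ) := by
      intro h2
      rcases hC.card_eq_two_or_six h2 with h | h <;> rw [h] at h7 <;> exact absurd h7 (by decide)
    obtain ⟨h | h, z, hz, hn⟩ := hC.card_eq_seven_or h2 h7
    · have : Fact (Nat.Prime 7) := ⟨by norm_num⟩
      exact Or.inl ⟨mulEquivOfPrimeCardEq h (by simp)⟩
    · have : Fact (Nat.Prime 3) := ⟨Nat.prime_three⟩
      have : Finite (Γ ≃g Γ) := Nat.finite_of_card_ne_zero (by rw [h]; norm_num)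
      obtain ⟨c, hc⟩ := exists_prime_orderOf_dvd_card' (G := Γ ≃g Γ) 3 (by rw [h]; norm_num)
      refine Or.inr (mulEquiv_frob21 h hz hc hn fun k hk hkz => ?_)
      refine hC.eq_one_of_commute_seven hz ?_ hkz
      obtain ⟨n, rfl⟩ := Subgroup.mem_zpowers_iff.1 hk
      rw [← zpow_natCast, zpow_comm, zpow_natCast, ← hc, pow_orderOf_eq_one, one_zpow]
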